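/- \textbf{Theorem (Plemelj--Sokhotski).} Let $\mathbb A$ be a finite-dimensional real alternative algebra with unity and with an anti-involution $a\mapsto a^c$ (real linear, $(a^c)^c=a$, $(ab)^c=b^ca^c$). Let $m\ge 1$ and let $v_0=1,v_1,\dots,v_m\in\mathbb A$ be a hypercomplex basis, i.e. linearly independent with $v_s+v_s^c=0$, $v_sv_s^c=1$ for $1\le s\le m$ and $v_sv_t=-v_tv_s$ for distinct $s,t\in\{1,\dots,m\}$; put $M=\mathrm{span}_{\mathbb R}(v_0,\dots,v_m)$, complete $(v_s)$ to a real basis of $\mathbb A$, and let $|\cdot|$ be the Euclidean norm of $\mathbb A$ for that basis. Let $n\ge1$, $N=(m+1)n$, and identify $M^n$ with $\mathbb R^{N}$ through $x_j=\sum_{s}x_{j,s}v_s$, $j=1,\dots,n$. Let $\Omega\subset M^n$ be a bounded domain with piecewise smooth boundary $\Gamma=\partial\Omega$: outside a subset of surface measure zero, $\Gamma$ is a $C^1$ hypersurface with $\Omega$ locally on one side, and near each of its points $\Gamma$ is contained in a finite union of $C^1$ hypersurfaces. Let $\Omega^-=M^n\setminus\overline\Omega$, let $dS$ be the surface measure and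 $\nu=(\nu_1,\dots,\nu_n)$ the unit exterior normal (defined $dS$-a.e. on $\Gamma$). Let $0<\alpha<1$ and let $f:\Gamma\to\mathbb A$ satisfy $|f(x)-f(x')|\le C|x-x'|^\alpha$ on $\Gamma$ for some constant $C$. With $\sigma_N$ the area of the unit sphere of $\mathbb R^N$ and $$K_j(x)=\frac1{\sigma_N}\frac{x_j^c}{|x|^{N}},\qquad K(x,y)\ast f(y)=\sum_{j=1}^nK_j(y-x)\,\bigl(\nu_j(y)f(y)\bigr)\,dS(y),$$ let $C_\Gamma[f](x)=\int_\Gamma K(x,y)\ast f(y)$ for $x\in M^n\setminus\Gamma$. Then this integral converges for every $x\notin\Gamma$, and for every $x\in\Gamma$ the limits $$\tau(x)=\lim_{\epsilon\to0^+}\frac{\mathrm{vol}(S(x,\epsilon)\cap\Omega)}{\mathrm{vol}(S(x,\epsilon))},\qquad C_\Gamma[f](x)=\mathrm{P.V.}\int_\Gamma K(x,y)\ast f(y)=\lim_{\epsilon\to0^+}\int_{\Gamma\setminus B(x,\epsilon)}K(x,y)\ast f(y)$$ exist (the solid angle of the tangent cone and the singular integral), the truncated integrals being convergent; moreover $C_\Gamma[f](x')$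 has non-tangential limits as $x'\to x$ from $\Omega$ and from $\Omega^-$, given by $$C_\Gamma^+[f](x)=C_\Gamma[f](x)+(1-\tau(x))f(x),\qquad C_\Gamma^-[f](x)=C_\Gamma[f](x)-\tau(x)f(x).$$ Here $x'\to x$ non-tangentially from $D\in\{\Omega,\Omega^-\}$ means: for every $c>0$, the limit is taken over those $x'\in D$ for which $x'-x$ has distance at least $c|x'-x|$ from the tangent cone of $\Gamma$ at $x$. -/

import Mathlib

open Filter Set MeasureTheory
open scoped Topology

namespace Hypercomplex

noncomputable section

/-! ### Alternative `*`-algebras and hypercomplex bases -/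

/-- Alternativity of a (not necessarily associative) multiplication:
`[x, x, y] = 0 = [y, x, x]`. -/
def IsAlternative (A : Type*) [NonAssocRing A] : Prop :=
  (∀ x y : A, (x * x) * y = x * (x * y)) ∧ (∀ x y : A, (y * x) * x = y * (x * x))

/-- The sphere of imaginary units: trace `x + xᶜ = 0` and squared norm `x xᶜ = 1`. -/
def imaginaryUnits (A : Type*) [NonAssocRing A] [Star A] : Set A :=
  {x | x + star x = 0 ∧ x * star x = 1}

/-- `(v₀, …, vₘ)` is a hypercomplex basis of the subspace `M` that it spans: `m ≥ 1`, `v₀ = 1`,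
the vectors are linearly independent, `v₁, …, vₘ` are imaginary units and they anticommute
pairwise.  (Such a span automatically lies in the quadratic cone of `A`.) -/
structure IsHypercomplexBasis {A : Type*} [NonAssocRing A] [Module ℝ A] [Star A] {m : ℕ}
    (v : Fin (m + 1) → A) : Prop where
  one_le : 1 ≤ m
  linearIndependent : LinearIndependent ℝ v
  zero : v 0 = 1
  unit : ∀ s, s ≠ 0 → v s ∈ imaginaryUnits A
  anticomm : ∀ s t, s ≠ 0 → t ≠ 0 → s ≠ t → v s * v t = -(v t * v s)

/-- The space `Mⁿ`, identified with `ℝ^{(m+1)n}` (Euclidean norm) through the coordinates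
`x = (x_{j,s})`. -/
abbrev Space (n m : ℕ) : Type := EuclideanSpace ℝ (Fin n × Fin (m + 1))

/-- The real dimension `N = (m+1)n` of `Mⁿ`. -/
abbrev dimN (n m : ℕ) : ℕ := (m + 1) * n

section Algebra

variable {A : Type*} [NonAssocRing A] [Module ℝ A] {d : ℕ}

/-- The `j`-th hypercomplex coordinate `x_j = ∑ₛ x_{j,s} vₛ ∈ M` of a point of `Mⁿ`. -/
def hcoord {n m : ℕ} (v : Fin (m + 1) → A) (x : Space n m) (j : Fin n) : A :=
  ∑ s, x (j, s) • v s

/-- The Euclidean norm of `A` attached to a real basis. -/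
def euclNorm (b : Module.Basis (Fin (d + 1)) ℝ A) (a : A) : ℝ :=
  √(∑ t, (b.repr a t) ^ 2)

/-- Convergence `F → L` in `A` along a filter, in the Euclidean norm. -/
def ConvergesTo {X : Type*} (b : Module.Basis (Fin (d + 1)) ℝ A) (F : X → A) (l : Filter X)
    (L : A) : Prop :=
  Tendsto (fun z => euclNorm b (F z - L)) l (𝓝 0)

/-- Hölder condition of exponent `α` on a set `E`. -/
def IsHolderOn {n m : ℕ} (b : Module.Basis (Fin (d + 1)) ℝ A) (α : ℝ) (E : Set (Space n m))
    (f : Space n m → A) : Prop :=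
  ∃ C : ℝ, ∀ x ∈ E, ∀ x' ∈ E, euclNorm b (f x - f x') ≤ C * ‖x - x'‖ ^ α

/-- An `A`-valued function is integrable when all its real components are. -/
def IntegrableComp {X : Type*} [MeasurableSpace X] (b : Module.Basis (Fin (d + 1)) ℝ A)
    (μ : Measure X) (g : X → A) : Prop :=
  ∀ t, Integrable (fun y => b.repr (g y) t) μ

/-- The integral of an `A`-valued function, taken componentwise. -/
def integralComp {X : Type*} [MeasurableSpace X] (b : Module.Basis (Fin (d + 1)) ℝ A)
    (μ : Measure X) (g : X → A) : A :=
  ∑ t, (∫ y, b.repr (g y) t ∂μ) • b t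

end Algebra

/-! ### Geometry of the boundary -/

/-- The classical surface measure `dS` on hypersurfaces of `Mⁿ = ℝᴺ`: the `(N-1)`-dimensional
Hausdorff measure, normalised to agree with Lebesgue measure on `ℝ^{N-1}`. -/
def surfaceMeasure (n m : ℕ) : Measure (Space n m) := μHE[dimN n m - 1]

/-- The surface area `σ_N` of the unit sphere of `ℝᴺ`. -/
def sphereArea (n m : ℕ) : ℝ := (surfaceMeasure n m).real (Metric.sphere 0 1)

/-- `ν` is the unit exterior normal to the open set `Ω` at its boundary point `y`: near `y` the
set `Ω` is `{ρ < 0}` for some `C¹` function `ρ` with `ρ y = 0` and `∇ρ(y) ≠ 0`, and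
`ν = ∇ρ(y) / |∇ρ(y)|`. -/
def IsOuterNormal {n m : ℕ} (Ω : Set (Space n m)) (y ν : Space n m) : Prop :=
  ∃ ρ : Space n m → ℝ, ContDiffAt ℝ 1 ρ y ∧ ρ y = 0 ∧ gradient ρ y ≠ 0 ∧
    (∀ᶠ z in 𝓝 y, (z ∈ Ω ↔ ρ z < 0)) ∧ ν = ‖gradient ρ y‖⁻¹ • gradient ρ y

/-- The points at which the boundary of `Ω` is smooth, with `Ω` locally on one side of it. -/
def regularPart {n m : ℕ} (Ω : Set (Space n m)) : Set (Space n m) :=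
  {y ∈ frontier Ω | ∃ ν, IsOuterNormal Ω y ν}

/-- The boundary of `Ω` is piecewise smooth (piecewise `C¹`): apart from a set of vanishing surface
measure (edges, corners, …) it is a `C¹` hypersurface with `Ω` locally on one side, and, up to
and including the exceptional set, it is locally made of finitely many pieces of
`C¹` hypersurfaces `{ρᵢ = 0}`, `∇ρᵢ ≠ 0`. -/
structure HasPiecewiseSmoothBoundary {n m : ℕ} (Ω : Set (Space n m)) : Prop where
  singular_null : surfaceMeasure n m (frontier Ω \ regularPart Ω) = 0
  pieces : ∀ x ∈ frontier Ω, ∃ (k : ℕ) (ρ : Fin k → Space n m → ℝ),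
    (∀ i, ContDiffAt ℝ 1 (ρ i) x ∧ gradient (ρ i) x ≠ 0) ∧
      ∀ᶠ z in 𝓝[frontier Ω] x, ∃ i, ρ i z = 0

open Classical in
/-- The unit exterior normal field, defined on the regular part of the boundary (extended by `0`,
which concerns a set of surface measure zero when the boundary is piecewise smooth). -/
def outerNormal {n m : ℕ} (Ω : Set (Space n m)) (y : Space n m) : Space n m :=
  if h : ∃ ν, IsOuterNormal Ω y ν then h.choose else 0

/-- `τ` is the solid angle at `x` of the tangent cone to the boundary of `Ω`:
`τ = lim_{ε → 0} vol(S(x,ε) ∩ Ω) / vol(S(x,ε))`. -/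
def HasSolidAngle {n m : ℕ} (Ω : Set (Space n m)) (x : Space n m) (τ : ℝ) : Prop :=
  Tendsto (fun ε : ℝ => (surfaceMeasure n m).real (Metric.sphere x ε ∩ Ω) /
    (surfaceMeasure n m).real (Metric.sphere x ε)) (𝓝[>] 0) (𝓝 τ)

/-- Non-tangential approach region in `D` to a point `x` of `Γ`, of aperture `c`: the points
`x'` of `D` such that `x' - x` keeps an angle of sine at least `c` from the tangent cone of `Γ`
at `x`, that is, `dist(x' - x, T_x Γ) ≥ c |x' - x|`. -/
def approachRegion {n m : ℕ} (D Γ : Set (Space n m)) (x : Space n m) (c : ℝ) :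
    Set (Space n m) :=
  {x' ∈ D | ∀ w ∈ posTangentConeAt Γ x, c * ‖x' - x‖ ≤ ‖(x' - x) - w‖}

/-! ### The Bochner–Martinelli integral -/

section Integral

variable {A : Type*} [NonAssocRing A] [Module ℝ A] [Star A] {d n m : ℕ}

/-- `F` has the non-tangential limit `L` at `x ∈ Γ` from `D`. -/
def HasNTLimit (b : Module.Basis (Fin (d + 1)) ℝ A) (D Γ : Set (Space n m))
    (F : Space n m → A) (x : Space n m) (L : A) : Prop :=
  ∀ c : ℝ, 0 < c → ConvergesTo b F (𝓝[approachRegion D Γ x c] x) L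

/-- `K_j(x) = x_jᶜ / (σ_N |x|ᴺ)`. -/
def kernelK (v : Fin (m + 1) → A) (j : Fin n) (x : Space n m) : A :=
  (sphereArea n m * ‖x‖ ^ dimN n m)⁻¹ • star (hcoord v x j)

/-- The density of `K(x,y) * f(y)` with respect to `dS(y)`:
`∑_j K_j(y - x) (ν_j(y) f(y))`. -/
def bmDensity (v : Fin (m + 1) → A) (Ω : Set (Space n m)) (f : Space n m → A)
    (x y : Space n m) : A :=
  ∑ j, kernelK v j (y - x) * (hcoord v (outerNormal Ω y) j * f y)

/-- The Bochner–Martinelli integral `C_Γ[f](x)`, `Γ = ∂Ω`, for `x` off `Γ`. -/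
def bmIntegral (v : Fin (m + 1) → A) (b : Module.Basis (Fin (d + 1)) ℝ A) (Ω : Set (Space n m))
    (f : Space n m → A) (x : Space n m) : A :=
  integralComp b ((surfaceMeasure n m).restrict (frontier Ω)) (bmDensity v Ω f x)

/-- `L` is the singular Bochner–Martinelli integral at `x ∈ Γ`: the principal value
`lim_{ε → 0} ∫_{Γ \ B(x,ε)} K(x,y) * f(y)`, all the truncated integrals being convergent. -/
def HasPrincipalValue (v : Fin (m + 1) → A) (b : Module.Basis (Fin (d + 1)) ℝ A)
    (Ω : Set (Space n m)) (f : Space n m → A) (x : Space n m) (L : A) : Prop :=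
  (∀ ε : ℝ, 0 < ε → IntegrableComp b
    ((surfaceMeasure n m).restrict (frontier Ω \ Metric.ball x ε)) (bmDensity v Ω f x)) ∧
  ConvergesTo b (fun ε : ℝ => integralComp b
    ((surfaceMeasure n m).restrict (frontier Ω \ Metric.ball x ε)) (bmDensity v Ω f x))
    (𝓝[>] 0) L

end Integral

end

end Hypercomplex

open Hypercomplex

/-!
The theorem rests on one computation, the integral of the kernel against a constant. In real
coordinates `i = (j, s)` of `Mⁿ`, the real components of `K(x,y) * a` are combinations
`∑ B i i' zᵢ νᵢ' / |z|ᴺ`, `z = y - x`, of components of the gradient field `z / |z|ᴺ` and of the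
normal `ν`. The hypercomplex relations and the linearized alternative law
`x (y a) + y (x a) = (x y + y x) a` say that the matrices `B` have scalar symmetric part
(`structureMatrix_add_swap`). The Jacobian matrix of the field `θ(|z|²) z / |z|ᴺ`, where the cutoff
`θ` removes the singularity, is symmetric. Hence only its divergence survives in the divergence
theorem, and that divergence is radial and concentrated where `θ` varies
(`setIntegral_cutoff_mul_contractedKernel`). In polar coordinates this gives a weighted average of
the measures of the sphere sections `{u ∈ S : x + r u ∈ Ω}` over small radii `r`. So the integral of
`K(x,y) * a` is `a` for `x` in `Ω`, it is `0` for `x` outside the closure, and at a boundary point its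
truncated integrals tend to `τ a`, where `τ` is the solid angle
(`abs_setIntegral_contractedKernel_sub_le`).

For a Hölder function `f`, the integral is split by `f(y) = (f(y) - f(x)) + f(x)`. At a boundary point
`x` the first part has an integrand bounded by a multiple of `|y - x| ^ (α - (N - 1))`, which is
integrable since the boundary is locally a finite union of almost flat hypersurfaces
(`integrable_norm_sub_rpow_frontier`). In a non-tangential approach region `|y - x'|` is bounded below
by a multiple of `|y - x|` (`exists_mul_norm_le_of_mem_approachRegion`), so that dominated convergence
applies to this part as `x'` tends to `x`. The second part is the computation for constants.

The geometric prerequisites are proved here for the normalized Hausdorff measure.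

* The divergence theorem `setIntegral_fderiv_eq_integral_frontier`. Near a smooth boundary point,
  projection along a direction `e` transversal to the boundary does not increase the surface measure
  and, for `e` equal to the normal, almost preserves it; with integration along the lines of direction
  `e` this shows that the flux of `φ e` is at most `∫ φ dS`, with almost equality for the normal
  direction. The bound in unit directions close to the normal forces the flux in tangential
  directions to be negligible (`exists_nhds_flux_approx`), and a partition of unity adds up the local
  estimates. The singular part, a compact set of measure zero, is removed by cutoff functions whose
  gradients are small in `L¹` (`exists_cutoff_of_measure_eq_zero`).
* The identification of the Hausdorff measure of the sphere with the measure of polar coordinates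
  (`surfaceMeasure_restrict_sphere`), by the divergence theorem for radial fields on the ball.
* The existence of the solid angle (`exists_hasSolidAngle`). Off finitely many hyperplanes of
  directions, a ray issuing from a boundary point does not meet the boundary again near that point, so
  that it eventually stays in `Ω` or outside; dominated convergence on the sphere concludes.
-/

/-! ### Orthogonal projection to a hyperplane and Hausdorff measure -/

namespace Hypercomplex

section Hyperplane

variable {E : Type*} [NormedAddCommGroup E] [InnerProductSpace ℝ E]

/-- The hyperplane through the origin orthogonal to `e`. -/
noncomputable abbrev normalHyperplane (e : E) : Submodule ℝ E := (ℝ ∙ e)ᗮ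

/-- Orthogonal projection to the hyperplane orthogonal to `e`. -/
noncomputable abbrev hyperplaneProj (e : E) : E →L[ℝ] normalHyperplane e :=
  (normalHyperplane e).orthogonalProjectionOnto

theorem coe_hyperplaneProj {e : E} (he : ‖e‖ = 1) (x : E) :
    (hyperplaneProj e x : E) = x - inner ℝ e x • e := by
  have h := Submodule.starProjection_orthogonal_val (K := ℝ ∙ e) x
  rw [Submodule.starProjection_unit_singleton ℝ he x] at h
  simpa using h

theorem hyperplaneProj_add_inner_smul {e : E} (he : ‖e‖ = 1) (x : E) :
    (hyperplaneProj e x : E) + inner ℝ e x • e = x := by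
  rw [coe_hyperplaneProj he]; abel

theorem inner_normalHyperplane {e : E} (z : normalHyperplane e) : inner ℝ e (z : E) = 0 :=
  (Submodule.mem_orthogonal_singleton_iff_inner_right).1 z.2

theorem hyperplaneProj_add_smul {e : E} (z : normalHyperplane e) (t : ℝ) :
    hyperplaneProj e ((z : E) + t • e) = z := by
  have h1 : hyperplaneProj e e = 0 :=
    Submodule.orthogonalProjectionOnto_orthogonal_apply_eq_zero
      (Submodule.mem_span_singleton_self e)
  rw [map_add, map_smul, h1, smul_zero, add_zero]
  exact Submodule.orthogonalProjectionOnto_mem_subspace_eq_self z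

theorem inner_add_smul_self {e : E} (he : ‖e‖ = 1) (z : normalHyperplane e) (t : ℝ) :
    inner ℝ e ((z : E) + t • e) = t := by
  rw [inner_add_right, inner_normalHyperplane, inner_smul_right, real_inner_self_eq_norm_sq, he]
  simp

theorem norm_hyperplaneProj_le (e x : E) : ‖hyperplaneProj e x‖ ≤ ‖x‖ :=
  Submodule.norm_orthogonalProjectionOnto_apply_le _ _

theorem norm_sq_hyperplaneProj {e : E} (he : ‖e‖ = 1) (x : E) :
    ‖hyperplaneProj e x‖ ^ 2 = ‖x‖ ^ 2 - (inner ℝ e x) ^ 2 := by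
  have h : ‖hyperplaneProj e x‖ = ‖x - inner ℝ e x • e‖ := by
    rw [← coe_hyperplaneProj he]; rfl
  rw [h, @norm_sub_sq_real, norm_smul, he, inner_smul_right, real_inner_comm, mul_one,
    Real.norm_eq_abs, sq_abs]
  ring

variable [FiniteDimensional ℝ E]

theorem finrank_normalHyperplane {d : ℕ} (hd : Module.finrank ℝ E = d + 1) {e : E}
    (he : ‖e‖ = 1) : Module.finrank ℝ (normalHyperplane e) = d := by
  have h := (ℝ ∙ e).finrank_add_finrank_orthogonal
  rw [finrank_span_singleton (by rintro rfl; simp at he), hd] at h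
  change Module.finrank ℝ ((ℝ ∙ e)ᗮ : Submodule ℝ E) = d
  omega

variable [MeasurableSpace E] [BorelSpace E]

/-- Cartesian coordinates adapted to a unit vector `e`: the points `z + t e` with `z ⟂ e`. -/
theorem measurePreserving_hyperplane_add_smul {e : E} (he : ‖e‖ = 1) :
    MeasurePreserving (fun p : normalHyperplane e × ℝ => (p.1 : E) + p.2 • e)
      (volume.prod volume) volume := by
  have h1 := ((ℝ ∙ e).measurePreserving_measurableEquivProd (0 : E)).symm
  rw [InnerProductSpace.euclideanHausdorffMeasure_eq_volume] at h1
  have h2 : MeasurePreserving (LinearIsometryEquiv.toSpanUnitSingleton (𝕜 := ℝ) e he)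
      volume volume := LinearIsometryEquiv.measurePreserving _
  have h3 := h2.prod (MeasurePreserving.id (volume : Measure (normalHyperplane e)))
  have h4 : MeasurePreserving (Prod.swap : normalHyperplane e × ℝ → ℝ × normalHyperplane e)
      (volume.prod volume) (volume.prod volume) := Measure.measurePreserving_swap
  have h5 := h1.comp (h3.comp h4)
  have h6 : (fun p : normalHyperplane e × ℝ => (p.1 : E) + p.2 • e) =
      ((ℝ ∙ e).measurableEquivProd (0 : E)).symm ∘
        Prod.map (LinearIsometryEquiv.toSpanUnitSingleton (𝕜 := ℝ) e he) id ∘ Prod.swap := by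
    funext p
    simp [add_comm]
  rw [h6]
  exact h5

/-- Fubini's theorem in the coordinates `z + t e`. -/
theorem integral_eq_integral_hyperplane_line {e : E} (he : ‖e‖ = 1) {g : E → ℝ}
    (hg : Integrable g) :
    ∫ x, g x = ∫ z : normalHyperplane e, ∫ t : ℝ, g ((z : E) + t • e) := by
  have hmp := measurePreserving_hyperplane_add_smul he
  have hg' : Integrable (fun p : normalHyperplane e × ℝ => g ((p.1 : E) + p.2 • e))
      (volume.prod volume) := hmp.integrable_comp_of_integrable hg
  rw [← integral_prod _ hg', ← hmp.map_eq, integral_map hmp.measurable.aemeasurable]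
  rw [hmp.map_eq]; exact hg.aestronglyMeasurable

end Hyperplane

section Projection

variable {E : Type*} [NormedAddCommGroup E] [InnerProductSpace ℝ E] [FiniteDimensional ℝ E]
  [MeasurableSpace E] [BorelSpace E]

theorem euclideanHausdorffMeasure_image_le {X Y : Type*} [MetricSpace X] [MeasurableSpace X]
    [BorelSpace X] [MetricSpace Y] [MeasurableSpace Y] [BorelSpace Y] {f : X → Y} {s : Set X}
    {K : NNReal} (hf : LipschitzOnWith K f s) (d : ℕ) :
    μHE[d] (f '' s) ≤ (K : ENNReal) ^ d * μHE[d] s := by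
  rw [Measure.euclideanHausdorffMeasure_def, Measure.euclideanHausdorffMeasure_def,
    Measure.smul_apply, Measure.smul_apply, ENNReal.smul_def, ENNReal.smul_def, smul_eq_mul,
    smul_eq_mul, mul_left_comm]
  gcongr
  simpa using hf.hausdorffMeasure_image_le (d := (d : ℝ)) (by positivity)

/-- The projection to a hyperplane does not increase `d`-dimensional measure. -/
theorem volume_hyperplaneProj_image_le {d : ℕ} (hd : Module.finrank ℝ E = d + 1) {e : E}
    (he : ‖e‖ = 1) (A : Set E) : volume (hyperplaneProj e '' A) ≤ μHE[d] A := by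
  rw [← InnerProductSpace.euclideanHausdorffMeasure_eq_volume, finrank_normalHyperplane hd he]
  have h : LipschitzWith 1 (hyperplaneProj e) :=
    LipschitzWith.of_dist_le_mul fun x y => by
      rw [dist_eq_norm, dist_eq_norm, ← map_sub]; simpa using norm_hyperplaneProj_le e (x - y)
  simpa using euclideanHausdorffMeasure_image_le (h.lipschitzOnWith (s := A)) d

/-- If the projection is `κ`-antilipschitz on `A`, then it decreases `d`-dimensional measure at
most by the factor `κ ^ d`. -/
theorem le_volume_hyperplaneProj_image {d : ℕ} (hd : Module.finrank ℝ E = d + 1) {e : E}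
    (he : ‖e‖ = 1) {A : Set E} {κ : NNReal}
    (hA : ∀ p ∈ A, ∀ q ∈ A, ‖p - q‖ ≤ κ * ‖hyperplaneProj e (p - q)‖) :
    μHE[d] A ≤ (κ : ENNReal) ^ d * volume (hyperplaneProj e '' A) := by
  rw [← InnerProductSpace.euclideanHausdorffMeasure_eq_volume, finrank_normalHyperplane hd he]
  have hinj : InjOn (hyperplaneProj e) A := fun p hp q hq hpq => by
    have := hA p hp q hq
    rw [map_sub, hpq, sub_self, norm_zero, mul_zero] at this
    exact sub_eq_zero.1 (norm_le_zero_iff.1 this)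
  have hleft : LeftInvOn (Function.invFunOn (hyperplaneProj e) A) (hyperplaneProj e) A :=
    hinj.leftInvOn_invFunOn
  have hLip : LipschitzOnWith κ (Function.invFunOn (hyperplaneProj e) A)
      (hyperplaneProj e '' A) := by
    refine LipschitzOnWith.of_dist_le_mul ?_
    rintro _ ⟨p, hp, rfl⟩ _ ⟨q, hq, rfl⟩
    rw [hleft hp, hleft hq, dist_eq_norm, dist_eq_norm, ← map_sub]
    exact hA p hp q hq
  have h := euclideanHausdorffMeasure_image_le hLip d
  rwa [hleft.image_image] at h

end Projection

end Hypercomplex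

/-! ### Flux through a graph -/

namespace Hypercomplex

section Graph

variable {E : Type*} [NormedAddCommGroup E] [InnerProductSpace ℝ E]

/-- Around a point where `ρ` vanishes and increases in the direction `e`, there is a cylinder with
axis `e` on which `ρ` increases in the direction `e`, from negative values at the bottom to positive
values at the top. -/
theorem exists_cylinder {e : E} (he : ‖e‖ = 1) {ρ : E → ℝ} {ρ' : E →L[ℝ] ℝ} {y : E}
    (hρ : HasStrictFDerivAt ρ ρ' y) (hy : ρ y = 0) (hpos : 0 < ρ' e) {V : Set E} (hV : V ∈ 𝓝 y) :
    ∃ δ₁ > 0, ∃ δ₂ > 0, ∀ C : Set E,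
      C = {x | ‖hyperplaneProj e (x - y)‖ ≤ δ₁ ∧ |inner ℝ e (x - y)| ≤ δ₂} →
      C ⊆ V ∧ ContinuousOn ρ C ∧
      (∀ p ∈ C, ∀ t : ℝ, 0 < t → p + t • e ∈ C → ρ p < ρ (p + t • e)) ∧
      (∀ p ∈ C, inner ℝ e (p - y) = -δ₂ → ρ p < 0) ∧
      (∀ p ∈ C, inner ℝ e (p - y) = δ₂ → 0 < ρ p) := by
  obtain ⟨s, hs, hlin⟩ := hρ.approximates_deriv_on_nhds
    (c := ⟨ρ' e / 2, by positivity⟩) (Or.inr (by exact half_pos hpos))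
  obtain ⟨r, hr, hball⟩ := Metric.mem_nhds_iff.1 (inter_mem hV hs)
  set a := ρ' e with ha
  -- the radius is so small that `ρ'` cannot make up for the increment of `ρ` along the axis
  set δ₂ := r / 4 with hδ₂
  have hδ₂pos : 0 < δ₂ := by positivity
  set δ₁ := min δ₂ (δ₂ * a / (4 * (‖ρ'‖ + a))) with hδ₁
  have hden : 0 < ‖ρ'‖ + a := by positivity
  have hδ₁pos : 0 < δ₁ := by positivity
  have hδ₁le : δ₁ * (‖ρ'‖ + a) ≤ δ₂ * a / 4 := by
    calc δ₁ * (‖ρ'‖ + a) ≤ (δ₂ * a / (4 * (‖ρ'‖ + a))) * (‖ρ'‖ + a) := by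
          gcongr; exact min_le_right _ _
      _ = δ₂ * a / 4 := by field_simp
  refine ⟨δ₁, hδ₁pos, δ₂, hδ₂pos, ?_⟩
  rintro C rfl
  have hdec : ∀ x : E, x = (hyperplaneProj e x : E) + inner ℝ e x • e := fun x =>
    (hyperplaneProj_add_inner_smul he x).symm
  have hsub : {x | ‖hyperplaneProj e (x - y)‖ ≤ δ₁ ∧ |inner ℝ e (x - y)| ≤ δ₂} ⊆
      Metric.ball y r := by
    rintro x ⟨h1, h2⟩
    rw [Metric.mem_ball, dist_eq_norm, hdec (x - y)]
    refine lt_of_le_of_lt (norm_add_le _ _) ?_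
    rw [norm_smul, he, mul_one, Real.norm_eq_abs]
    have h3 : ‖((hyperplaneProj e (x - y) : normalHyperplane e) : E)‖ ≤ δ₁ := h1
    have h4 : δ₁ ≤ δ₂ := min_le_left _ _
    linarith
  have hest : ∀ p ∈ s, ∀ q ∈ s, |ρ p - ρ q - ρ' (p - q)| ≤ a / 2 * ‖p - q‖ := by
    intro p hp q hq
    exact hlin p hp q hq
  have hys : y ∈ s := mem_of_mem_nhds hs
  have hends : ∀ p ∈ {x | ‖hyperplaneProj e (x - y)‖ ≤ δ₁ ∧ |inner ℝ e (x - y)| ≤ δ₂},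
      |ρ p - inner ℝ e (p - y) * a| ≤ δ₂ * a * (3 / 4) := by
    rintro p hp
    have h1 := hest p (hball (hsub hp)).2 y hys
    have h2 : ρ' (p - y) = ρ' (hyperplaneProj e (p - y) : E) + inner ℝ e (p - y) * a := by
      conv_lhs => rw [hdec (p - y)]
      rw [map_add, map_smul, smul_eq_mul]
    have h3 : |ρ' (hyperplaneProj e (p - y) : E)| ≤ ‖ρ'‖ * δ₁ :=
      (ρ'.le_opNorm _).trans (by gcongr; exact hp.1)
    have h4 : ‖p - y‖ ≤ δ₁ + δ₂ := by
      rw [hdec (p - y)]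
      refine (norm_add_le _ _).trans ?_
      rw [norm_smul, he, mul_one, Real.norm_eq_abs]
      exact add_le_add hp.1 hp.2
    have h5 : a / 2 * ‖p - y‖ ≤ a / 2 * (δ₁ + δ₂) := by gcongr
    rw [hy, h2] at h1
    rw [abs_le] at h1 h3 ⊢
    have h6 : 0 < a * δ₁ := by positivity
    constructor <;> nlinarith
  refine ⟨fun x hx => (hball (hsub hx)).1, ?_, ?_, ?_, ?_⟩
  · exact hlin.continuousOn.mono fun x hx => (hball (hsub hx)).2
  · intro p hp t ht hpt
    have h1 := hest _ (hball (hsub hpt)).2 p (hball (hsub hp)).2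
    rw [add_sub_cancel_left, map_smul, smul_eq_mul, norm_smul, he, mul_one, Real.norm_eq_abs,
      abs_of_pos ht, ← ha] at h1
    have h2 := (abs_le.1 h1).1
    nlinarith [mul_pos ht hpos]
  · intro p hp hpe
    have := (abs_le.1 (hends p hp)).2
    rw [hpe] at this
    nlinarith [mul_pos hδ₂pos hpos]
  · intro p hp hpe
    have := (abs_le.1 (hends p hp)).1
    rw [hpe] at this
    nlinarith [mul_pos hδ₂pos hpos]

variable [FiniteDimensional ℝ E] [MeasurableSpace E] [BorelSpace E]

/-- On a compact set `G` on which the projection `P` along `e` is `κ`-antilipschitz, the image of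
the volume of `P(G)` under the inverse of `P` is comparable with the `d`-dimensional measure. -/
theorem graph_measure_comparison {d : ℕ} (hd : Module.finrank ℝ E = d + 1) {e : E}
    (he : ‖e‖ = 1) {G : Set E} (hG : IsCompact G) {κ : NNReal}
    (hA : ∀ p ∈ G, ∀ q ∈ G, ‖p - q‖ ≤ κ * ‖hyperplaneProj e (p - q)‖) :
    ∃ g : normalHyperplane e → E, (∀ p ∈ G, g (hyperplaneProj e p) = p) ∧
      AEMeasurable g (volume.restrict (hyperplaneProj e '' G)) ∧
      (volume.restrict (hyperplaneProj e '' G)).map g ≤ (μHE[d]).restrict G ∧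
      (μHE[d]).restrict G ≤
        (κ : ENNReal) ^ d • (volume.restrict (hyperplaneProj e '' G)).map g := by
  have hinj : InjOn (hyperplaneProj e) G := fun p hp q hq hpq => by
    have := hA p hp q hq
    rw [map_sub, hpq, sub_self, norm_zero, mul_zero] at this
    exact sub_eq_zero.1 (norm_le_zero_iff.1 this)
  set g := Function.invFunOn (hyperplaneProj e) G with hgdef
  have hleft : LeftInvOn g (hyperplaneProj e) G := hinj.leftInvOn_invFunOn
  have hPG : IsCompact (hyperplaneProj e '' G) := hG.image (hyperplaneProj e).continuous
  have hPGm : MeasurableSet (hyperplaneProj e '' G) := hPG.measurableSet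
  have hLip : LipschitzOnWith κ g (hyperplaneProj e '' G) := by
    refine LipschitzOnWith.of_dist_le_mul ?_
    rintro _ ⟨p, hp, rfl⟩ _ ⟨q, hq, rfl⟩
    rw [hleft hp, hleft hq, dist_eq_norm, dist_eq_norm, ← map_sub]
    exact hA p hp q hq
  have hgm : AEMeasurable g (volume.restrict (hyperplaneProj e '' G)) :=
    hLip.continuousOn.aemeasurable hPGm
  have hset : ∀ B : Set E, g ⁻¹' B ∩ hyperplaneProj e '' G = hyperplaneProj e '' (B ∩ G) := by
    intro B
    ext z
    constructor
    · rintro ⟨hz, p, hp, rfl⟩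
      exact ⟨p, ⟨by simpa [hleft hp] using hz, hp⟩, rfl⟩
    · rintro ⟨p, ⟨hpB, hp⟩, rfl⟩
      exact ⟨by simpa [hleft hp] using hpB, p, hp, rfl⟩
  refine ⟨g, fun p hp => hleft hp, hgm, ?_, ?_⟩
  · refine Measure.le_iff.2 fun B hB => ?_
    rw [Measure.map_apply_of_aemeasurable hgm hB, Measure.restrict_apply' hPGm, hset,
      Measure.restrict_apply hB]
    exact volume_hyperplaneProj_image_le hd he _
  · refine Measure.le_iff.2 fun B hB => ?_
    rw [Measure.smul_apply, Measure.map_apply_of_aemeasurable hgm hB,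
      Measure.restrict_apply' hPGm, hset, Measure.restrict_apply hB]
    exact le_volume_hyperplaneProj_image hd he fun p hp q hq => hA p hp.2 q hq.2

/-- Near a boundary point at which `Ω` is the subgraph of a function in the direction `e`, the flux
of `φ e` out of `Ω` is comparable with `∫ φ dS`. -/
theorem exists_nhds_flux_comparison {d : ℕ} (hd : Module.finrank ℝ E = d + 1) {e : E}
    (he : ‖e‖ = 1) {Ω : Set E} (hΩ : IsOpen Ω) {ρ : E → ℝ} {ρ' : E →L[ℝ] ℝ} {y : E}
    (hρ : HasStrictFDerivAt ρ ρ' y) (hy : ρ y = 0) (hpos : 0 < ρ' e)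
    (hloc : ∀ᶠ z in 𝓝 y, (z ∈ Ω ↔ ρ z < 0)) {κ : NNReal} {W : Set E} (hW : W ∈ 𝓝 y)
    (hA : ∀ p ∈ W, ∀ q ∈ W, ρ p = 0 → ρ q = 0 → ‖p - q‖ ≤ κ * ‖hyperplaneProj e (p - q)‖) :
    ∃ U : Set E, IsOpen U ∧ y ∈ U ∧
      ∀ φ : E → ℝ, ContDiff ℝ 1 φ → HasCompactSupport φ → tsupport φ ⊆ U →
        (∀ z ∈ frontier Ω, 0 ≤ φ z) →
        ∫ x in Ω, fderiv ℝ φ x e ≤ ∫ x in frontier Ω, φ x ∂μHE[d] ∧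
        ∫ x in frontier Ω, φ x ∂μHE[d] ≤ κ ^ d * ∫ x in Ω, fderiv ℝ φ x e := by
  obtain ⟨δ₁, hδ₁, δ₂, hδ₂, hC⟩ := exists_cylinder he hρ hy hpos (inter_mem hW hloc)
  set C := {x | ‖hyperplaneProj e (x - y)‖ ≤ δ₁ ∧ |inner ℝ e (x - y)| ≤ δ₂} with hCdef
  obtain ⟨hCV, hcont, hmono, hbot, htop⟩ := hC C rfl
  have hcn : Continuous fun x : E => ‖hyperplaneProj e (x - y)‖ := by fun_prop
  have hci : Continuous fun x : E => |inner ℝ e (x - y)| := by fun_prop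
  have hCclosed : IsClosed C :=
    (isClosed_le hcn continuous_const).inter (isClosed_le hci continuous_const)
  have hCbdd : C ⊆ Metric.closedBall y (δ₁ + δ₂) := by
    rintro x ⟨h1, h2⟩
    rw [Metric.mem_closedBall, dist_eq_norm, ← hyperplaneProj_add_inner_smul he (x - y)]
    refine (norm_add_le _ _).trans ?_
    rw [norm_smul, he, mul_one, Real.norm_eq_abs]
    exact add_le_add h1 h2
  have hCcpt : IsCompact C := (isCompact_closedBall y _).of_isClosed_subset hCclosed hCbdd
  set U := {x | ‖hyperplaneProj e (x - y)‖ < δ₁ ∧ |inner ℝ e (x - y)| < δ₂} with hUdef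
  have hUopen : IsOpen U :=
    (isOpen_lt hcn continuous_const).inter (isOpen_lt hci continuous_const)
  have hyU : y ∈ U := by simp [hUdef, hδ₁, hδ₂]
  have hUC : U ⊆ C := fun x hx => ⟨hx.1.le, hx.2.le⟩
  set G := {x ∈ C | ρ x = 0} with hGdef
  have hGcpt : IsCompact G := by
    have : IsClosed G := hcont.preimage_isClosed_of_isClosed hCclosed isClosed_singleton
    exact hCcpt.of_isClosed_subset this fun x hx => hx.1
  have hΩC : ∀ x ∈ C, (x ∈ Ω ↔ ρ x < 0) := fun x hx => (hCV hx).2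
  -- inside the cylinder, the boundary of `Ω` is the zero set of `ρ`
  have hfrontier : frontier Ω ∩ U = G ∩ U := by
    ext x
    constructor
    · rintro ⟨hxf, hxU⟩
      refine ⟨⟨hUC hxU, ?_⟩, hxU⟩
      rw [hΩ.frontier_eq] at hxf
      have h1 : 0 ≤ ρ x := not_lt.1 fun h => hxf.2 ((hΩC x (hUC hxU)).2 h)
      refine le_antisymm (not_lt.1 fun h => ?_) h1
      have hcx : ContinuousAt ρ x :=
        hcont.continuousAt (mem_of_superset (hUopen.mem_nhds hxU) hUC)
      have h2 : ∀ᶠ z in 𝓝 x, 0 < ρ z ∧ z ∈ U :=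
        (hcx.eventually_const_lt h).and (hUopen.mem_nhds hxU)
      obtain ⟨z, ⟨hz1, hz2⟩, hz3⟩ := mem_closure_iff_nhds.1 hxf.1 _ h2
      exact absurd ((hΩC z (hUC hz2)).1 hz3) (not_lt.2 hz1.le)
    · rintro ⟨⟨hxC, hx0⟩, hxU⟩
      refine ⟨?_, hxU⟩
      rw [hΩ.frontier_eq]
      refine ⟨?_, fun h => by simpa [hx0] using (hΩC x hxC).1 h⟩
      rw [mem_closure_iff_frequently]
      have hlim : Tendsto (fun t : ℝ => x + -t • e) (𝓝[>] 0) (𝓝 x) := by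
        have : Continuous fun t : ℝ => x + -t • e := by fun_prop
        simpa using (this.tendsto 0).mono_left nhdsWithin_le_nhds
      have hev : ∀ᶠ t : ℝ in 𝓝[>] 0, x + -t • e ∈ Ω := by
        filter_upwards [hlim.eventually (hUopen.mem_nhds hxU), self_mem_nhdsWithin] with t ht ht0
        rw [hΩC _ (hUC ht)]
        have := hmono _ (hUC ht) t ht0 (by simpa using hxC)
        simpa [hx0] using this
      exact hlim.frequently hev.frequently
  obtain ⟨g, hgl, hgm, hle, hge⟩ := graph_measure_comparison hd he hGcpt
    (fun p hp q hq => hA p (hCV hp.1).1 q (hCV hq.1).1 hp.2 hq.2)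
  refine ⟨U, hUopen, hyU, fun φ hφ hφc hφU hφ0 => ?_⟩
  have hφcont : Continuous φ := hφ.continuous
  have hφz : ∀ x ∉ U, φ x = 0 := fun x hx =>
    image_eq_zero_of_notMem_tsupport fun h => hx (hφU h)
  have hdz : ∀ x ∉ U, fderiv ℝ φ x = 0 := fun x hx =>
    image_eq_zero_of_notMem_tsupport (f := fderiv ℝ φ)
      fun h => hx (hφU (tsupport_fderiv_subset ℝ h))
  have hdcont : Continuous fun x => fderiv ℝ φ x e :=
    (hφ.continuous_fderiv one_ne_zero).clm_apply continuous_const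
  have hdcpt : HasCompactSupport fun x => fderiv ℝ φ x e :=
    (hφc.fderiv (𝕜 := ℝ)).mono fun x hx => by
      rw [Function.mem_support] at hx ⊢
      intro h
      exact hx (by rw [h]; rfl)
  have hdint : Integrable fun x => fderiv ℝ φ x e := hdcont.integrable_of_hasCompactSupport hdcpt
  have hGfr : ∫ x in frontier Ω, φ x ∂μHE[d] = ∫ x in G, φ x ∂μHE[d] := by
    rw [setIntegral_eq_of_subset_of_forall_sdiff_eq_zero isClosed_frontier.measurableSet
        (inter_subset_left (t := U)) fun x hx => hφz x fun h => hx.2 ⟨hx.1, h⟩,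
      setIntegral_eq_of_subset_of_forall_sdiff_eq_zero hGcpt.measurableSet
        (inter_subset_left (t := U)) fun x hx => hφz x fun h => hx.2 ⟨hx.1, h⟩, hfrontier]
  -- integration along the lines of direction `e`
  have hline : ∀ z : normalHyperplane e,
      ∫ t : ℝ, Ω.indicator (fun x => fderiv ℝ φ x e) ((z : E) + t • e) =
        (hyperplaneProj e '' G).indicator (fun z => φ (g z)) z := by
    intro z
    have hP : ∀ t : ℝ, hyperplaneProj e ((z : E) + t • e - y) = z - hyperplaneProj e y := by
      intro t
      rw [map_sub, hyperplaneProj_add_smul]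
    have hI : ∀ t : ℝ, inner ℝ e ((z : E) + t • e - y) = t - inner ℝ e y := by
      intro t
      rw [inner_sub_right, inner_add_smul_self he]
    set c := inner ℝ e y with hc
    by_cases hz : ‖z - hyperplaneProj e y‖ ≤ δ₁
    · have hmem : ∀ t : ℝ, |t - c| ≤ δ₂ → (z : E) + t • e ∈ C := fun t ht =>
        ⟨by rw [hP]; exact hz, by rw [hI]; exact ht⟩
      have hlc : Continuous fun t : ℝ => (z : E) + t • e := by fun_prop
      obtain ⟨t₀, ht₀, hroot⟩ : ∃ t₀ ∈ Icc (c - δ₂) (c + δ₂), ρ ((z : E) + t₀ • e) = 0 := by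
        have hc1 : ContinuousOn (fun t : ℝ => ρ ((z : E) + t • e)) (Icc (c - δ₂) (c + δ₂)) :=
          hcont.comp hlc.continuousOn fun t ht =>
            hmem t (abs_le.2 ⟨by linarith [ht.1], by linarith [ht.2]⟩)
        have hivt := intermediate_value_Icc (by linarith : c - δ₂ ≤ c + δ₂) hc1
        refine hivt ⟨(hbot _ (hmem _ (by simp [abs_of_pos hδ₂])) ?_).le,
          (htop _ (hmem _ (by simp [abs_of_pos hδ₂])) ?_).le⟩
        · rw [hI]; ring
        · rw [hI]; ring
      have ht₀C : (z : E) + t₀ • e ∈ C :=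
        hmem _ (abs_le.2 ⟨by linarith [ht₀.1], by linarith [ht₀.2]⟩)
      have hzG : (z : E) + t₀ • e ∈ G := ⟨ht₀C, hroot⟩
      have hPz : hyperplaneProj e ((z : E) + t₀ • e) = z := hyperplaneProj_add_smul z t₀
      have hgz : g z = (z : E) + t₀ • e := by
        have := hgl _ hzG
        rwa [hPz] at this
      rw [indicator_of_mem (show z ∈ hyperplaneProj e '' G from ⟨_, hzG, hPz⟩), hgz]
      have hderiv : ∀ t : ℝ, HasDerivAt (fun t : ℝ => φ ((z : E) + t • e))
          (fderiv ℝ φ ((z : E) + t • e) e) t := by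
        intro t
        have h1 := (hφ.differentiable one_ne_zero ((z : E) + t • e)).hasFDerivAt
        have h2 : HasDerivAt (fun t : ℝ => (z : E) + t • e) e t := by
          simpa using ((hasDerivAt_id t).smul_const e).const_add (z : E)
        exact h1.comp_hasDerivAt t h2
      have hind : ∀ t : ℝ, t ≠ t₀ → Ω.indicator (fun x => fderiv ℝ φ x e) ((z : E) + t • e) =
          (Ioc (c - δ₂) t₀).indicator (fun t => fderiv ℝ φ ((z : E) + t • e) e) t := by
        intro t htne
        by_cases htU : (z : E) + t • e ∈ U
        · have htc : |t - c| < δ₂ := by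
            have := htU.2
            rwa [hI] at this
          have htC := hUC htU
          rw [abs_lt] at htc
          rcases lt_or_gt_of_ne htne with hlt | hgt
          · have h1 := hmono _ htC (t₀ - t) (by linarith) (by
              rw [add_assoc, ← add_smul, add_sub_cancel]; exact ht₀C)
            rw [add_assoc, ← add_smul, add_sub_cancel, hroot] at h1
            rw [indicator_of_mem ((hΩC _ htC).2 h1),
              indicator_of_mem (show t ∈ Ioc (c - δ₂) t₀ from ⟨by linarith, hlt.le⟩)]
          · have h1 := hmono _ ht₀C (t - t₀) (by linarith) (by
              rw [add_assoc, ← add_smul, add_sub_cancel]; exact htC)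
            rw [add_assoc, ← add_smul, add_sub_cancel, hroot] at h1
            rw [indicator_of_notMem (fun h => absurd ((hΩC _ htC).1 h) (not_lt.2 h1.le)),
              indicator_of_notMem (fun h => absurd h.2 (not_le.2 hgt))]
        · have h0 : fderiv ℝ φ ((z : E) + t • e) e = 0 := by rw [hdz _ htU]; rfl
          have h1 : Ω.indicator (fun x => fderiv ℝ φ x e) ((z : E) + t • e) = 0 := by
            simp [indicator, h0]
          rw [h1]
          simp [indicator, h0]
      rw [integral_congr_ae (g := (Ioc (c - δ₂) t₀).indicator
        (fun t => fderiv ℝ φ ((z : E) + t • e) e)), integral_indicator measurableSet_Ioc,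
        ← intervalIntegral.integral_of_le ht₀.1,
        intervalIntegral.integral_eq_sub_of_hasDerivAt (fun t _ => hderiv t)
          ((hdcont.comp hlc).intervalIntegrable _ _),
        hφz ((z : E) + (c - δ₂) • e), sub_zero]
      · intro h
        have := h.2
        rw [hI, abs_lt] at this
        linarith [this.1]
      · filter_upwards [compl_mem_ae_iff.2 (measure_singleton t₀)] with t ht
        exact hind t ht
    · have hzG : z ∉ hyperplaneProj e '' G := by
        rintro ⟨p, hp, rfl⟩
        exact hz (by rw [← map_sub]; exact hp.1.1)
      rw [indicator_of_notMem hzG]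
      have : ∀ t : ℝ, Ω.indicator (fun x => fderiv ℝ φ x e) ((z : E) + t • e) = 0 := by
        intro t
        have h0 : fderiv ℝ φ ((z : E) + t • e) e = 0 := by
          rw [hdz _ fun h => hz (by have := h.1; rw [hP] at this; exact this.le)]; rfl
        simp [indicator, h0]
      simp [this]
  have hflux : ∫ x in Ω, fderiv ℝ φ x e =
      ∫ x, φ x ∂((volume.restrict (hyperplaneProj e '' G)).map g) := by
    rw [integral_map hgm hφcont.aestronglyMeasurable,
      ← integral_indicator hΩ.measurableSet,
      integral_eq_integral_hyperplane_line he (hdint.indicator hΩ.measurableSet),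
      ← integral_indicator (hGcpt.image (hyperplaneProj e).continuous).measurableSet]
    exact integral_congr_ae (Eventually.of_forall hline)
  have hfin : IsFiniteMeasure ((volume.restrict (hyperplaneProj e '' G)).map g) := by
    have hlt : volume (hyperplaneProj e '' G) < ⊤ :=
      (hGcpt.image (hyperplaneProj e).continuous).measure_lt_top
    have : IsFiniteMeasure (volume.restrict (hyperplaneProj e '' G)) :=
      ⟨by rwa [Measure.restrict_apply_univ]⟩
    exact Measure.isFiniteMeasure_map _ _
  have hfinκ : IsFiniteMeasure ((κ : ENNReal) ^ d •
      (volume.restrict (hyperplaneProj e '' G)).map g) :=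
    Measure.smul_finite _ (ENNReal.pow_ne_top ENNReal.coe_ne_top)
  have hfinG : IsFiniteMeasure ((μHE[d] : Measure E).restrict G) := isFiniteMeasure_of_le _ hge
  have hint : ∀ μ : Measure E, IsFiniteMeasure μ → Integrable φ μ := fun μ hμ =>
    hφcont.integrable_of_hasCompactSupport hφc
  have hGnn : ∀ᵐ x ∂((μHE[d] : Measure E).restrict G), 0 ≤ φ x := by
    refine (ae_restrict_iff' hGcpt.measurableSet).2 (Eventually.of_forall fun x hx => ?_)
    by_cases hxU : x ∈ U
    · exact hφ0 x (hfrontier.symm.subset ⟨hx, hxU⟩).1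
    · exact (hφz x hxU).ge
  rw [hGfr, hflux]
  refine ⟨integral_mono_measure hle hGnn (hint _ hfinG), ?_⟩
  have hmapnn : ∀ᵐ x ∂((volume.restrict (hyperplaneProj e '' G)).map g), 0 ≤ φ x :=
    hGnn.filter_mono (ae_mono hle)
  have h1 := integral_mono_measure hge
    (show ∀ᵐ x ∂((κ : ENNReal) ^ d • (volume.restrict (hyperplaneProj e '' G)).map g), 0 ≤ φ x from
      hmapnn.filter_mono (Measure.smul_absolutelyContinuous.ae_le)) (hint _ hfinκ)
  rw [integral_smul_measure] at h1
  simpa using h1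

end Graph

end Hypercomplex

/-! ### Flux at a smooth boundary point -/

namespace Hypercomplex

section Flat

variable {E : Type*} [NormedAddCommGroup E] [InnerProductSpace ℝ E]

/-- Near a regular point, secants of the hypersurface `ρ = 0` are almost tangent to it. -/
theorem eventually_zeroSet_flat {ρ : E → ℝ} {ρ' : E →L[ℝ] ℝ} {y : E}
    (hρ : HasStrictFDerivAt ρ ρ' y) {c : ℝ} (hc : 0 < c) :
    ∃ W ∈ 𝓝 y, ∀ p ∈ W, ∀ q ∈ W, ρ p = 0 → ρ q = 0 → |ρ' (p - q)| ≤ c * ‖p - q‖ := by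
  obtain ⟨W, hW, hlin⟩ := hρ.approximates_deriv_on_nhds (c := ⟨c, hc.le⟩) (Or.inr hc)
  refine ⟨W, hW, fun p hp q hq hp0 hq0 => ?_⟩
  have h : ‖ρ p - ρ q - ρ' (p - q)‖ ≤ c * ‖p - q‖ := hlin p hp q hq
  rwa [hp0, hq0, sub_zero, zero_sub, norm_neg, Real.norm_eq_abs] at h

/-- Near a regular point, the projection along a transversal direction is antilipschitz on the
hypersurface `ρ = 0`. -/
theorem exists_antilipschitz_of_transversal {ρ : E → ℝ} {ρ' : E →L[ℝ] ℝ} {y : E}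
    (hρ : HasStrictFDerivAt ρ ρ' y) {e : E} (he : ‖e‖ = 1) (hpos : 0 < ρ' e) :
    ∃ κ : NNReal, ∃ W ∈ 𝓝 y, ∀ p ∈ W, ∀ q ∈ W, ρ p = 0 → ρ q = 0 →
      ‖p - q‖ ≤ κ * ‖hyperplaneProj e (p - q)‖ := by
  obtain ⟨W, hW, hflat⟩ := eventually_zeroSet_flat hρ (half_pos hpos)
  refine ⟨⟨2 * (ρ' e + ‖ρ'‖) / ρ' e, by positivity⟩, W, hW, fun p hp q hq hp0 hq0 => ?_⟩
  have h1 := hflat p hp q hq hp0 hq0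
  set w := p - q
  have hw : w = (hyperplaneProj e w : E) + inner ℝ e w • e :=
    (hyperplaneProj_add_inner_smul he w).symm
  have h2 : ‖w‖ ≤ ‖hyperplaneProj e w‖ + |inner ℝ e w| := by
    conv_lhs => rw [hw]
    refine (norm_add_le _ _).trans ?_
    rw [norm_smul, he, mul_one, Real.norm_eq_abs]
    exact le_rfl
  have h3 : ρ' w = ρ' (hyperplaneProj e w : E) + inner ℝ e w * ρ' e := by
    conv_lhs => rw [hw]
    rw [map_add, map_smul, smul_eq_mul]
  have h4 : |ρ' (hyperplaneProj e w : E)| ≤ ‖ρ'‖ * ‖hyperplaneProj e w‖ := ρ'.le_opNorm _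
  have h5 : |inner ℝ e w| * ρ' e ≤ ρ' e / 2 * ‖w‖ + ‖ρ'‖ * ‖hyperplaneProj e w‖ := by
    rw [← abs_of_pos hpos, ← abs_mul, abs_of_pos hpos]
    have : inner ℝ e w * ρ' e = ρ' w - ρ' (hyperplaneProj e w : E) := by rw [h3]; ring
    rw [this]
    exact (abs_sub _ _).trans (add_le_add h1 h4)
  change ‖w‖ ≤ 2 * (ρ' e + ‖ρ'‖) / ρ' e * ‖hyperplaneProj e w‖
  rw [div_mul_eq_mul_div, le_div_iff₀ hpos]
  nlinarith

/-- Near a regular point, the projection along the normal is almost isometric on the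
hypersurface `ρ = 0`. -/
theorem exists_antilipschitz_normal {ρ : E → ℝ} {ρ' : E →L[ℝ] ℝ} {y : E}
    (hρ : HasStrictFDerivAt ρ ρ' y) {e : E} (he : ‖e‖ = 1) {a : ℝ} (ha : 0 < a)
    (hρ' : ∀ w, ρ' w = a * inner ℝ e w) {κ : NNReal} (hκ : 1 < κ) :
    ∃ W ∈ 𝓝 y, ∀ p ∈ W, ∀ q ∈ W, ρ p = 0 → ρ q = 0 →
      ‖p - q‖ ≤ κ * ‖hyperplaneProj e (p - q)‖ := by
  have hκ' : (1 : ℝ) < κ := by exact_mod_cast hκ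
  have hη : 0 < 1 - ((κ : ℝ) ^ 2)⁻¹ := by
    have : ((κ : ℝ) ^ 2)⁻¹ < 1 := inv_lt_one_of_one_lt₀ (by nlinarith)
    linarith
  set η := √(1 - ((κ : ℝ) ^ 2)⁻¹) with hηdef
  have hηsq : η ^ 2 = 1 - ((κ : ℝ) ^ 2)⁻¹ := Real.sq_sqrt hη.le
  have hηpos : 0 < η := Real.sqrt_pos.2 hη
  obtain ⟨W, hW, hflat⟩ := eventually_zeroSet_flat hρ (mul_pos ha hηpos)
  refine ⟨W, hW, fun p hp q hq hp0 hq0 => ?_⟩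
  have h1 := hflat p hp q hq hp0 hq0
  set w := p - q
  rw [hρ', abs_mul, abs_of_pos ha, mul_assoc] at h1
  have h2 : |inner ℝ e w| ≤ η * ‖w‖ := le_of_mul_le_mul_left h1 ha
  have h3 : (inner ℝ e w) ^ 2 ≤ η ^ 2 * ‖w‖ ^ 2 := by
    rw [← sq_abs, ← mul_pow]; gcongr
  have h4 := norm_sq_hyperplaneProj he w
  have h5 : ‖w‖ ^ 2 ≤ (κ * ‖hyperplaneProj e w‖) ^ 2 := by
    rw [mul_pow, h4]
    rw [hηsq] at h3
    have h6 : (κ : ℝ) ^ 2 * ((1 - ((κ : ℝ) ^ 2)⁻¹) * ‖w‖ ^ 2) = κ ^ 2 * ‖w‖ ^ 2 - ‖w‖ ^ 2 := by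
      field_simp
    have h7 := mul_le_mul_of_nonneg_left h3 (sq_nonneg (κ : ℝ))
    rw [h6] at h7
    linarith
  exact (sq_le_sq₀ (norm_nonneg _) (by positivity)).1 h5

end Flat

section Flux

variable {E : Type*} [NormedAddCommGroup E] [InnerProductSpace ℝ E]

/-- Test functions for the flux through `∂Ω` inside `U`: compactly supported `C¹` functions with
support in `U`, nonnegative on `∂Ω`. -/
structure IsFluxTest (Ω U : Set E) (φ : E → ℝ) : Prop where
  contDiff : ContDiff ℝ 1 φ
  hasCompactSupport : HasCompactSupport φ
  tsupport_subset : tsupport φ ⊆ U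
  nonneg : ∀ z ∈ frontier Ω, 0 ≤ φ z

theorem IsFluxTest.mono {Ω U V : Set E} {φ : E → ℝ} (h : IsFluxTest Ω U φ) (hUV : U ⊆ V) :
    IsFluxTest Ω V φ :=
  ⟨h.1, h.2, h.3.trans hUV, h.4⟩

variable [FiniteDimensional ℝ E] [MeasurableSpace E] [BorelSpace E]

theorem integrable_fderiv_apply {φ : E → ℝ} (hφ : ContDiff ℝ 1 φ) (hφc : HasCompactSupport φ)
    (e : E) : Integrable fun x => fderiv ℝ φ x e := by
  refine ((hφ.continuous_fderiv one_ne_zero).clm_apply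
    continuous_const).integrable_of_hasCompactSupport ?_
  exact (hφc.fderiv (𝕜 := ℝ)).mono fun x hx => by
    rw [Function.mem_support] at hx ⊢
    intro h
    exact hx (by rw [h]; rfl)

theorem setIntegral_fderiv_add_smul {φ : E → ℝ} (hφ : ContDiff ℝ 1 φ) (hφc : HasCompactSupport φ)
    (Ω : Set E) (a b : ℝ) (e f : E) :
    ∫ x in Ω, fderiv ℝ φ x (a • e + b • f) =
      a * (∫ x in Ω, fderiv ℝ φ x e) + b * (∫ x in Ω, fderiv ℝ φ x f) := by
  simp only [map_add, map_smul, smul_eq_mul]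
  rw [integral_add ((integrable_fderiv_apply hφ hφc e).const_mul a).integrableOn
    ((integrable_fderiv_apply hφ hφc f).const_mul b).integrableOn, integral_const_mul,
    integral_const_mul]

/-- At a smooth boundary point, the flux of `φ e` is asymptotically `⟪ν, e⟫ ∫ φ dS`: the normal part
is given by the comparison in the direction `ν`.  For a tangential direction `τ` the upper bound
`flux ≤ ∫ φ dS` in the unit directions `√(1 - s²) ν + s τ` leaves at most a flux `2 s ∫ φ dS` in the
direction `τ`. -/
theorem exists_nhds_flux_approx {d : ℕ} (hd : Module.finrank ℝ E = d + 1) {Ω : Set E}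
    (hΩ : IsOpen Ω) {ρ : E → ℝ} {ρ' : E →L[ℝ] ℝ} {y : E} (hρ : HasStrictFDerivAt ρ ρ' y)
    (hy : ρ y = 0) (hloc : ∀ᶠ z in 𝓝 y, (z ∈ Ω ↔ ρ z < 0)) {ν : E} (hν : ‖ν‖ = 1) {a : ℝ}
    (ha : 0 < a) (hρ' : ∀ w, ρ' w = a * inner ℝ ν w) (e : E) {ε : ℝ} (hε : 0 < ε) :
    ∃ U : Set E, IsOpen U ∧ y ∈ U ∧ ∀ φ : E → ℝ, IsFluxTest Ω U φ →
      |(∫ x in Ω, fderiv ℝ φ x e) - inner ℝ ν e * ∫ x in frontier Ω, φ x ∂μHE[d]| ≤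
        ε * ∫ x in frontier Ω, φ x ∂μHE[d] := by
  have hI : ∀ U φ, IsFluxTest Ω U φ → 0 ≤ ∫ x in frontier Ω, φ x ∂μHE[d] := fun U φ h =>
    setIntegral_nonneg isClosed_frontier.measurableSet h.nonneg
  have hνν : inner ℝ ν ν = (1 : ℝ) := by rw [real_inner_self_eq_norm_sq, hν]; norm_num
  -- the normal direction
  have hnormal : ∀ δ : ℝ, 0 < δ → ∃ U : Set E, IsOpen U ∧ y ∈ U ∧ ∀ φ : E → ℝ,
      IsFluxTest Ω U φ →
      (∫ x in Ω, fderiv ℝ φ x ν ≤ ∫ x in frontier Ω, φ x ∂μHE[d]) ∧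
      (1 - δ) * (∫ x in frontier Ω, φ x ∂μHE[d]) ≤ ∫ x in Ω, fderiv ℝ φ x ν := by
    intro δ hδ
    obtain ⟨κ, hκ1, hκ⟩ : ∃ κ : NNReal, 1 < κ ∧ (κ : ℝ) ^ d < 1 + δ := by
      have hc : Continuous fun κ : NNReal => (κ : ℝ) ^ d := by fun_prop
      have h1 : ∀ᶠ κ : NNReal in 𝓝 1, (κ : ℝ) ^ d < 1 + δ :=
        hc.continuousAt.eventually_lt_const (by simpa using hδ)
      have h2 : ∀ᶠ κ : NNReal in 𝓝[>] 1, (κ : ℝ) ^ d < 1 + δ := nhdsWithin_le_nhds h1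
      obtain ⟨κ, h3, h4⟩ := (h2.and self_mem_nhdsWithin).exists
      exact ⟨κ, h4, h3⟩
    obtain ⟨W, hW, hA⟩ := exists_antilipschitz_normal hρ hν ha hρ' hκ1
    obtain ⟨U, hU, hyU, hφ⟩ := exists_nhds_flux_comparison hd hν hΩ hρ hy
      (by rw [hρ', hνν]; simpa using ha) hloc hW hA
    refine ⟨U, hU, hyU, fun φ h => ?_⟩
    obtain ⟨h1, h2⟩ := hφ φ h.1 h.2 h.3 h.4
    refine ⟨h1, ?_⟩
    have h3 := hI U φ h
    set A := ∫ x in Ω, fderiv ℝ φ x ν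
    set I := ∫ x in frontier Ω, φ x ∂μHE[d]
    have hA0 : 0 ≤ A := by
      have : (0 : ℝ) < (κ : ℝ) ^ d := by
        have : (0 : ℝ) < κ := by exact_mod_cast zero_lt_one.trans hκ1
        positivity
      by_contra hneg
      nlinarith [not_le.1 hneg]
    nlinarith
  -- unit directions orthogonal to the normal
  have htang : ∀ τ : E, ‖τ‖ = 1 → inner ℝ ν τ = 0 → ∀ s : ℝ, 0 < s → s < 1 →
      ∃ U : Set E, IsOpen U ∧ y ∈ U ∧ ∀ φ : E → ℝ, IsFluxTest Ω U φ →
        ∫ x in Ω, fderiv ℝ φ x τ ≤ 2 * s * ∫ x in frontier Ω, φ x ∂μHE[d] := by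
    intro τ hτ hντ s hs hs1
    have hs2 : 0 < 1 - s ^ 2 := by nlinarith
    set b := √(1 - s ^ 2) with hb
    have hbpos : 0 < b := Real.sqrt_pos.2 hs2
    have hbsq : b ^ 2 = 1 - s ^ 2 := Real.sq_sqrt hs2.le
    have hb1 : b ≤ 1 := by nlinarith
    have hunit : ‖b • ν + s • τ‖ = 1 := by
      have h1 : ‖b • ν + s • τ‖ ^ 2 = 1 := by
        rw [@norm_add_sq_real, norm_smul, norm_smul, hν, hτ, inner_smul_left, inner_smul_right,
          hντ, Real.norm_of_nonneg hbpos.le, Real.norm_of_nonneg hs.le]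
        simp only [mul_one, mul_zero, add_zero]
        linarith
      nlinarith [norm_nonneg (b • ν + s • τ)]
    have hpos : 0 < ρ' (b • ν + s • τ) := by
      rw [hρ', inner_add_right, inner_smul_right, inner_smul_right, hντ, hνν]
      simp only [mul_one, mul_zero, add_zero]
      positivity
    obtain ⟨κ, W, hW, hA⟩ := exists_antilipschitz_of_transversal hρ hunit hpos
    obtain ⟨U₁, hU₁, hyU₁, hφ₁⟩ := exists_nhds_flux_comparison hd hunit hΩ hρ hy hpos hloc hW hA
    obtain ⟨U₂, hU₂, hyU₂, hφ₂⟩ := hnormal (s ^ 2) (by positivity)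
    refine ⟨U₁ ∩ U₂, hU₁.inter hU₂, ⟨hyU₁, hyU₂⟩, fun φ h => ?_⟩
    have h1 := (hφ₁ φ h.1 h.2 (h.3.trans inter_subset_left) h.4).1
    have h2 := (hφ₂ φ (h.mono inter_subset_right)).2
    rw [setIntegral_fderiv_add_smul h.1 h.2] at h1
    have h3 := hI _ φ h
    set A := ∫ x in Ω, fderiv ℝ φ x ν
    set B := ∫ x in Ω, fderiv ℝ φ x τ
    set I := ∫ x in frontier Ω, φ x ∂μHE[d]
    have hbge : 1 - s ^ 2 ≤ b := by nlinarith [mul_nonneg hbpos.le (sub_nonneg.2 hb1)]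
    have h4 : (1 - s ^ 2) * ((1 - s ^ 2) * I) ≤ b * A :=
      mul_le_mul hbge h2 (by positivity) hbpos.le
    have h5 : s * B ≤ s * (2 * s * I) := by nlinarith [mul_nonneg (sq_nonneg (s ^ 2)) h3]
    exact le_of_mul_le_mul_left h5 hs
  -- an arbitrary direction is a combination of the normal and a tangential direction
  set c := inner ℝ ν e with hc
  set w := e - c • ν with hw
  have hwν : inner ℝ ν w = 0 := by
    rw [hw, inner_sub_right, inner_smul_right, hνν, ← hc]; ring
  set δ := min (1 / 2) (ε / (|c| + 2 * ‖w‖ + 1)) with hδ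
  have hden : 0 < |c| + 2 * ‖w‖ + 1 := by positivity
  have hδpos : 0 < δ := by positivity
  have hδ1 : δ < 1 := (min_le_left _ _).trans_lt (by norm_num)
  have hδε : (|c| + 2 * ‖w‖) * δ ≤ ε := by
    calc (|c| + 2 * ‖w‖) * δ ≤ (|c| + 2 * ‖w‖ + 1) * (ε / (|c| + 2 * ‖w‖ + 1)) := by
          refine mul_le_mul (by linarith) (min_le_right _ _) hδpos.le hden.le
      _ = ε := by field_simp
  obtain ⟨U₁, hU₁, hyU₁, hφ₁⟩ := hnormal δ hδpos
  obtain ⟨U₂, hU₂, hyU₂, hφ₂⟩ : ∃ U : Set E, IsOpen U ∧ y ∈ U ∧ ∀ φ : E → ℝ, IsFluxTest Ω U φ →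
      |∫ x in Ω, fderiv ℝ φ x w| ≤ 2 * ‖w‖ * δ * ∫ x in frontier Ω, φ x ∂μHE[d] := by
    by_cases hw0 : w = 0
    · exact ⟨univ, isOpen_univ, mem_univ _, fun φ _ => by simp [hw0]⟩
    have hwn : 0 < ‖w‖ := norm_pos_iff.2 hw0
    set τ := ‖w‖⁻¹ • w with hτdef
    have hτ : ‖τ‖ = 1 := by rw [hτdef, norm_smul, norm_inv, norm_norm, inv_mul_cancel₀ hwn.ne']
    have hντ : inner ℝ ν τ = 0 := by rw [hτdef, inner_smul_right, hwν, mul_zero]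
    obtain ⟨V₁, hV₁, hyV₁, hψ₁⟩ := htang τ hτ hντ δ hδpos hδ1
    obtain ⟨V₂, hV₂, hyV₂, hψ₂⟩ := htang (-τ) (by rwa [norm_neg])
      (by rw [inner_neg_right, hντ, neg_zero]) δ hδpos hδ1
    refine ⟨V₁ ∩ V₂, hV₁.inter hV₂, ⟨hyV₁, hyV₂⟩, fun φ h => ?_⟩
    have h1 := hψ₁ φ (h.mono inter_subset_left)
    have h2 := hψ₂ φ (h.mono inter_subset_right)
    have hwτ : w = ‖w‖ • τ := by rw [hτdef, smul_inv_smul₀ hwn.ne']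
    have h3 : ∫ x in Ω, fderiv ℝ φ x w = ‖w‖ * ∫ x in Ω, fderiv ℝ φ x τ := by
      conv_lhs => rw [hwτ]
      simp only [map_smul, smul_eq_mul]
      rw [integral_const_mul]
    simp only [map_neg] at h2
    rw [integral_neg] at h2
    rw [h3, abs_mul, abs_of_pos hwn, mul_assoc, mul_assoc, mul_left_comm]
    gcongr
    rw [abs_le]
    constructor <;> linarith
  refine ⟨U₁ ∩ U₂, hU₁.inter hU₂, ⟨hyU₁, hyU₂⟩, fun φ h => ?_⟩
  obtain ⟨h1, h2⟩ := hφ₁ φ (h.mono inter_subset_left)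
  have h3 := hφ₂ φ (h.mono inter_subset_right)
  have h4 := hI _ φ h
  have he : e = c • ν + (1 : ℝ) • w := by rw [hw, one_smul]; abel
  have h5 : ∫ x in Ω, fderiv ℝ φ x e =
      c * (∫ x in Ω, fderiv ℝ φ x ν) + 1 * ∫ x in Ω, fderiv ℝ φ x w := by
    rw [← setIntegral_fderiv_add_smul h.1 h.2, ← he]
  set A := ∫ x in Ω, fderiv ℝ φ x ν
  set I := ∫ x in frontier Ω, φ x ∂μHE[d]
  set B := ∫ x in Ω, fderiv ℝ φ x w
  have h6 : |A - I| ≤ δ * I := by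
    rw [abs_le]; constructor <;> linarith
  calc |(∫ x in Ω, fderiv ℝ φ x e) - c * I| = |c * (A - I) + B| := by rw [h5]; ring_nf
    _ ≤ |c| * |A - I| + |B| := by
        refine (abs_add_le _ _).trans ?_
        rw [abs_mul]
    _ ≤ |c| * (δ * I) + 2 * ‖w‖ * δ * I := by gcongr
    _ = ((|c| + 2 * ‖w‖) * δ) * I := by ring
    _ ≤ ε * I := by gcongr

end Flux

end Hypercomplex

/-! ### Cutoffs near sets of vanishing Hausdorff measure -/

namespace Hypercomplex

section Cutoff

/-- A set of vanishing `d`-dimensional Hausdorff measure is covered by small balls with small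
`∑ rᵢ ^ d`. -/
theorem exists_ball_cover_of_hausdorffMeasure_eq_zero {X : Type*} [Nonempty X]
    [MetricSpace X] [MeasurableSpace X] [BorelSpace X] {d : ℕ} {Z : Set X} (hZ : IsCompact Z)
    (h0 : μHE[d] Z = 0) {δ ε : ℝ} (hδ : 0 < δ) (hε : 0 < ε) :
    ∃ (F : Finset ℕ) (x : ℕ → X) (r : ℕ → ℝ), (∀ i ∈ F, x i ∈ Z ∧ 0 < r i ∧ r i < δ) ∧
      Z ⊆ ⋃ i ∈ F, Metric.ball (x i) (r i) ∧ ∑ i ∈ F, r i ^ d ≤ ε := by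
  rcases Z.eq_empty_or_nonempty with rfl | ⟨z₀, hz₀⟩
  · exact ⟨∅, fun _ => Classical.arbitrary X, fun _ => 0, by simp, by simp, by simpa using hε.le⟩
  have hH : μH[(d : ℝ)] Z = 0 := by
    rw [Measure.euclideanHausdorffMeasure_def, Measure.smul_apply, ENNReal.smul_def,
      smul_eq_mul, mul_eq_zero] at h0
    refine h0.resolve_left ?_
    simpa using Measure.addHaarScalarFactor_volume_hausdorffMeasure_ne_zero d
  rw [Measure.hausdorffMeasure_apply] at hH
  simp only [ENNReal.iSup_eq_zero] at hH
  have hδ' : 0 < ENNReal.ofReal (δ / 2) := by simpa using hδ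
  have h1 := hH _ hδ'
  have h2 : (⨅ (t : ℕ → Set X) (_ : Z ⊆ ⋃ n, t n) (_ : ∀ n, Metric.ediam (t n) ≤ ENNReal.ofReal (δ / 2)),
      ∑' n, ⨆ _ : (t n).Nonempty, Metric.ediam (t n) ^ (d : ℝ)) < ENNReal.ofReal (ε / 2) := by
    rw [h1]; simpa using hε
  simp only [iInf_lt_iff] at h2
  obtain ⟨t, hcov, hdiam, hsum⟩ := h2
  set D : ℕ → ℝ := fun n => (Metric.ediam (t n)).toReal with hD
  have hdiamtop : ∀ n, Metric.ediam (t n) ≠ ⊤ := fun n =>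
    ((hdiam n).trans_lt ENNReal.ofReal_lt_top).ne
  have hDle : ∀ n, D n ≤ δ / 2 := fun n => ENNReal.toReal_le_of_le_ofReal (by positivity) (hdiam n)
  have hr : ∀ n, ∃ r : ℝ, D n < r ∧ r < δ ∧ r ^ d < D n ^ d + ε / 2 / 2 / 2 ^ n := by
    intro n
    have hc : Continuous fun r : ℝ => r ^ d := by fun_prop
    have h3 : ∀ᶠ r in 𝓝[>] (D n), r ^ d < D n ^ d + ε / 2 / 2 / 2 ^ n :=
      nhdsWithin_le_nhds (hc.continuousAt.eventually_lt_const (by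
        have : 0 < ε / 2 / 2 / 2 ^ n := by positivity
        linarith))
    have h4 : ∀ᶠ r in 𝓝[>] (D n), r < δ :=
      nhdsWithin_le_nhds (eventually_lt_nhds (by linarith [hDle n]))
    obtain ⟨r, ⟨h5, h6⟩, h7⟩ := ((h3.and h4).and self_mem_nhdsWithin).exists
    exact ⟨r, h7, h6, h5⟩
  -- the radii slightly exceed the diameters, with a geometric series of errors in `∑ rᵢ ^ d`
  choose r hrD hrδ hrε using hr
  have hD0 : ∀ n, 0 ≤ D n := fun n => ENNReal.toReal_nonneg
  have hx : ∀ n, ∃ x ∈ Z, (t n ∩ Z).Nonempty → x ∈ t n := by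
    intro n
    by_cases h : (t n ∩ Z).Nonempty
    · obtain ⟨x, hx1, hx2⟩ := h
      exact ⟨x, hx2, fun _ => hx1⟩
    · exact ⟨z₀, hz₀, fun h' => absurd h' h⟩
  choose x hxZ hxt using hx
  have hcov' : Z ⊆ ⋃ n : {n : ℕ // (t n).Nonempty}, Metric.ball (x n) (r n) := by
    intro z hz
    obtain ⟨n, hn⟩ := mem_iUnion.1 (hcov hz)
    refine mem_iUnion.2 ⟨⟨n, z, hn⟩, ?_⟩
    rw [Metric.mem_ball]
    refine lt_of_le_of_lt ?_ (hrD n)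
    rw [dist_edist]
    exact ENNReal.toReal_mono (hdiamtop n) (Metric.edist_le_ediam_of_mem hn (hxt n ⟨z, hn, hz⟩))
  obtain ⟨F', hF'⟩ := hZ.elim_finite_subcover _ (fun n => Metric.isOpen_ball) hcov'
  refine ⟨F'.map (Function.Embedding.subtype _), x, r, ?_, ?_, ?_⟩
  · intro i _
    exact ⟨hxZ i, (hD0 i).trans_lt (hrD i), hrδ i⟩
  · intro z hz
    obtain ⟨n, hn, hzn⟩ := mem_iUnion₂.1 (hF' hz)
    exact mem_iUnion₂.2 ⟨n, Finset.mem_map_of_mem (Function.Embedding.subtype _) hn, hzn⟩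
  · rw [Finset.sum_map]
    have hle : ∀ n : {n : ℕ // (t n).Nonempty}, ENNReal.ofReal (D n ^ d) ≤
        ⨆ _ : (t n).Nonempty, Metric.ediam (t n) ^ (d : ℝ) := by
      intro n
      rw [iSup_pos n.2, ENNReal.ofReal_pow (hD0 n), hD, ENNReal.ofReal_toReal (hdiamtop n),
        ENNReal.rpow_natCast]
    have hsumD : ∑ n ∈ F', D n ^ d ≤ ε / 2 := by
      have h8 : ENNReal.ofReal (∑ n ∈ F', D n ^ d) ≤ ENNReal.ofReal (ε / 2) := by
        rw [ENNReal.ofReal_sum_of_nonneg fun (n : {n : ℕ // (t n).Nonempty}) _ =>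
          pow_nonneg (hD0 n) d]
        calc ∑ n ∈ F', ENNReal.ofReal (D n ^ d)
            ≤ ∑ n ∈ F', ⨆ _ : (t n).Nonempty, Metric.ediam (t n) ^ (d : ℝ) :=
              Finset.sum_le_sum fun n _ => hle n
          _ = ∑ n ∈ F'.map (Function.Embedding.subtype _),
                ⨆ _ : (t n).Nonempty, Metric.ediam (t n) ^ (d : ℝ) := by
              rw [Finset.sum_map]; rfl
          _ ≤ ∑' n, ⨆ _ : (t n).Nonempty, Metric.ediam (t n) ^ (d : ℝ) := ENNReal.sum_le_tsum _
          _ ≤ ENNReal.ofReal (ε / 2) := hsum.le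
      exact (ENNReal.ofReal_le_ofReal_iff (by positivity)).1 h8
    have hgeo : ∑ n ∈ F', ε / 2 / 2 / 2 ^ (n : ℕ) ≤ ε / 2 := by
      have h9 : ∑ n ∈ F', ε / 2 / 2 / 2 ^ (n : ℕ) =
          ∑ n ∈ F'.map (Function.Embedding.subtype _), ε / 2 / 2 / 2 ^ n := by
        rw [Finset.sum_map]; rfl
      rw [h9]
      refine ((summable_geometric_two' (ε / 2)).sum_le_tsum _ fun n _ => by positivity).trans ?_
      exact (tsum_geometric_two' (ε / 2)).le
    calc ∑ n ∈ F', r n ^ d ≤ ∑ n ∈ F', (D n ^ d + ε / 2 / 2 / 2 ^ (n : ℕ)) :=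
          Finset.sum_le_sum fun n _ => (hrε n).le
      _ ≤ ε := by rw [Finset.sum_add_distrib]; linarith

variable {E : Type*} [NormedAddCommGroup E] [InnerProductSpace ℝ E] [FiniteDimensional ℝ E]
  [MeasurableSpace E] [BorelSpace E]

/-- Bump functions at scale `r`: their gradients have integral `O(r ^ d)`, `d = dim E - 1`. -/
theorem exists_scaled_bump {d : ℕ} (hd : Module.finrank ℝ E = d + 1) :
    ∃ C : ℝ, 0 ≤ C ∧ ∀ (x : E) (r : ℝ), 0 < r → ∃ χ : E → ℝ, ContDiff ℝ 1 χ ∧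
      (∀ z, 0 ≤ χ z ∧ χ z ≤ 1) ∧ (∀ z ∈ Metric.closedBall x r, χ z = 1) ∧
      (∀ z ∉ Metric.ball x (2 * r), χ z = 0) ∧
      Integrable (fun z => ‖fderiv ℝ χ z‖) ∧ ∫ z, ‖fderiv ℝ χ z‖ ≤ C * r ^ d := by
  let β : ContDiffBump (0 : E) := ⟨1, 2, one_pos, one_lt_two⟩
  have hβ : ContDiff ℝ 1 β := β.contDiff
  have hβc : HasCompactSupport β := β.hasCompactSupport
  have hint : Integrable fun z => ‖fderiv ℝ β z‖ :=
    ((hβ.continuous_fderiv one_ne_zero).norm).integrable_of_hasCompactSupport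
      (hβc.fderiv (𝕜 := ℝ)).norm
  refine ⟨∫ z, ‖fderiv ℝ β z‖, integral_nonneg fun _ => norm_nonneg _, fun x r hr => ?_⟩
  have hfd : ∀ z, ‖fderiv ℝ (fun z => β (r⁻¹ • (z - x))) z‖ =
      r⁻¹ * ‖fderiv ℝ β (r⁻¹ • (z - x))‖ := by
    intro z
    have h1 : HasFDerivAt (fun z : E => r⁻¹ • (z - x)) (r⁻¹ • ContinuousLinearMap.id ℝ E) z :=
      ((hasFDerivAt_id z).sub_const x).const_smul r⁻¹
    have h2 := ((hβ.differentiable one_ne_zero (r⁻¹ • (z - x))).hasFDerivAt).comp z h1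
    rw [HasFDerivAt.fderiv (f := fun z => β (r⁻¹ • (z - x))) h2, ContinuousLinearMap.comp_smul,
      ContinuousLinearMap.comp_id, norm_smul, norm_inv, Real.norm_of_nonneg hr.le]
  have hcomp : Integrable fun z => ‖fderiv ℝ β (r⁻¹ • (z - x))‖ := by
    have h1 := hint.comp_smul (R := r⁻¹) (inv_ne_zero hr.ne')
    exact h1.comp_sub_right x
  refine ⟨fun z => β (r⁻¹ • (z - x)), hβ.comp (by fun_prop), fun z => ⟨β.nonneg, β.le_one⟩,
    fun z hz => ?_, fun z hz => ?_, ?_, ?_⟩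
  · refine β.one_of_mem_closedBall ?_
    rw [Metric.mem_closedBall, dist_eq_norm] at hz
    rw [mem_closedBall_zero_iff, norm_smul, norm_inv, Real.norm_of_nonneg hr.le]
    rw [inv_mul_le_iff₀ hr]
    change ‖z - x‖ ≤ r * 1
    linarith
  · refine β.zero_of_le_dist ?_
    rw [Metric.mem_ball, dist_eq_norm, not_lt] at hz
    rw [dist_zero_right, norm_smul, norm_inv, Real.norm_of_nonneg hr.le]
    rw [le_inv_mul_iff₀ hr]
    change r * 2 ≤ ‖z - x‖
    linarith
  · simp only [hfd]
    exact hcomp.const_mul _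
  · simp only [hfd]
    rw [integral_const_mul, integral_sub_right_eq_self (fun z => ‖fderiv ℝ β (r⁻¹ • z)‖) x,
      Measure.integral_comp_inv_smul_of_nonneg volume (fun z => ‖fderiv ℝ β z‖) hr.le, hd,
      smul_eq_mul]
    apply le_of_eq
    rw [pow_succ]
    field_simp

/-- Cutoff functions vanishing near a compact set of vanishing `d`-dimensional measure,
`d = dim E - 1`, with gradient small in `L¹`. -/
theorem exists_cutoff_of_measure_eq_zero {d : ℕ} (hd : Module.finrank ℝ E = d + 1)
    {Z : Set E} (hZ : IsCompact Z) (h0 : μHE[d] Z = 0) {δ ε : ℝ} (hδ : 0 < δ) (hε : 0 < ε) :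
    ∃ ψ : E → ℝ, ContDiff ℝ 1 ψ ∧ (∀ z, 0 ≤ ψ z ∧ ψ z ≤ 1) ∧ Disjoint (tsupport ψ) Z ∧
      (∀ z, (∀ w ∈ Z, δ ≤ dist z w) → ψ z = 1) ∧
      Integrable (fun z => ‖fderiv ℝ ψ z‖) ∧ ∫ z, ‖fderiv ℝ ψ z‖ ≤ ε := by
  obtain ⟨C, hC, hbump⟩ := exists_scaled_bump hd
  obtain ⟨F, x, r, hF, hcov, hsum⟩ := exists_ball_cover_of_hausdorffMeasure_eq_zero hZ h0
    (half_pos hδ) (show 0 < ε / (C + 1) by positivity)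
  -- the cutoff is the product of the functions `1 - χᵢ`, with bumps `χᵢ` on the balls of the cover
  have key : ∀ F' : Finset ℕ, (∀ i ∈ F', 0 < r i) →
      ∃ ψ : E → ℝ, ContDiff ℝ 1 ψ ∧ (∀ z, 0 ≤ ψ z ∧ ψ z ≤ 1) ∧
      (∀ i ∈ F', ∀ z ∈ Metric.closedBall (x i) (r i), ψ z = 0) ∧
      (∀ z, (∀ i ∈ F', z ∉ Metric.ball (x i) (2 * r i)) → ψ z = 1) ∧
      Integrable (fun z => ‖fderiv ℝ ψ z‖) ∧ ∫ z, ‖fderiv ℝ ψ z‖ ≤ ∑ i ∈ F', C * r i ^ d := by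
    intro F'
    induction F' using Finset.induction_on with
    | empty =>
      intro _
      exact ⟨fun _ => 1, contDiff_const, by simp, by simp, by simp, by simp, by simp⟩
    | insert i F' hi ih =>
      intro hpos
      obtain ⟨ψ, h1, h2, h3, h4, h5, h6⟩ := ih fun j hj => hpos j (Finset.mem_insert_of_mem hj)
      obtain ⟨χ, g1, g2, g3, g4, g5, g6⟩ := hbump (x i) (r i) (hpos i (Finset.mem_insert_self _ _))
      have hle : ∀ z, ‖fderiv ℝ (fun z => ψ z * (1 - χ z)) z‖ ≤
          ‖fderiv ℝ ψ z‖ + ‖fderiv ℝ χ z‖ := by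
        intro z
        have hd1 := h1.differentiable one_ne_zero z
        have hd2 := g1.differentiable one_ne_zero z
        have hfd : fderiv ℝ (fun z => ψ z * (1 - χ z)) z =
            (ψ z) • (-fderiv ℝ χ z) + (1 - χ z) • fderiv ℝ ψ z := by
          exact (hd1.hasFDerivAt.mul (hd2.hasFDerivAt.const_sub 1)).fderiv
        rw [hfd]
        refine (norm_add_le _ _).trans ?_
        rw [norm_smul, norm_smul, norm_neg, Real.norm_of_nonneg (h2 z).1,
          Real.norm_of_nonneg (by linarith [(g2 z).2])]
        have k1 : ψ z * ‖fderiv ℝ χ z‖ ≤ 1 * ‖fderiv ℝ χ z‖ := by gcongr; exact (h2 z).2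
        have k2 : (1 - χ z) * ‖fderiv ℝ ψ z‖ ≤ 1 * ‖fderiv ℝ ψ z‖ := by
          gcongr; linarith [(g2 z).1]
        linarith
      have hcd : ContDiff ℝ 1 fun z => ψ z * (1 - χ z) := h1.mul (contDiff_const.sub g1)
      have hint : Integrable fun z => ‖fderiv ℝ (fun z => ψ z * (1 - χ z)) z‖ :=
        (h5.add g5).mono' (hcd.continuous_fderiv one_ne_zero).norm.aestronglyMeasurable
          (Eventually.of_forall fun z => by rw [norm_norm]; exact hle z)
      refine ⟨fun z => ψ z * (1 - χ z), hcd, fun z => ⟨?_, ?_⟩, ?_, ?_, hint, ?_⟩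
      · exact mul_nonneg (h2 z).1 (by linarith [(g2 z).2])
      · exact mul_le_one₀ (h2 z).2 (by linarith [(g2 z).2]) (by linarith [(g2 z).1])
      · intro j hj z hz
        rcases Finset.mem_insert.1 hj with rfl | hj
        · simp [g3 z hz]
        · simp [h3 j hj z hz]
      · intro z hz
        simp [h4 z fun j hj => hz j (Finset.mem_insert_of_mem hj),
          g4 z (hz i (Finset.mem_insert_self _ _))]
      · rw [Finset.sum_insert hi]
        calc ∫ z, ‖fderiv ℝ (fun z => ψ z * (1 - χ z)) z‖
            ≤ ∫ z, (‖fderiv ℝ ψ z‖ + ‖fderiv ℝ χ z‖) := integral_mono hint (h5.add g5) hle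
          _ = (∫ z, ‖fderiv ℝ ψ z‖) + ∫ z, ‖fderiv ℝ χ z‖ := integral_add h5 g5
          _ ≤ C * r i ^ d + ∑ j ∈ F', C * r j ^ d := by linarith
  obtain ⟨ψ, h1, h2, h3, h4, h5, h6⟩ := key F fun i hi => (hF i hi).2.1
  refine ⟨ψ, h1, h2, ?_, fun z hz => h4 z fun i hi hzi => ?_, h5, h6.trans ?_⟩
  · rw [Set.disjoint_left]
    intro z hz hzZ
    obtain ⟨i, hi, hzi⟩ := mem_iUnion₂.1 (hcov hzZ)
    refine (notMem_tsupport_iff_eventuallyEq.2 ?_) hz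
    filter_upwards [Metric.isOpen_ball.mem_nhds hzi] with w hw
    exact h3 i hi w (Metric.ball_subset_closedBall hw)
  · have := hz _ (hF i hi).1
    rw [Metric.mem_ball] at hzi
    linarith [(hF i hi).2.2]
  · rw [← Finset.mul_sum]
    calc C * ∑ i ∈ F, r i ^ d ≤ C * (ε / (C + 1)) := by gcongr
      _ ≤ ε := by
        rw [mul_div_assoc', div_le_iff₀ (by positivity)]
        nlinarith

end Cutoff

end Hypercomplex

/-! ### The exterior normal -/

namespace Hypercomplex

variable {n m : ℕ}

theorem finrank_space (n m : ℕ) : Module.finrank ℝ (Space n m) = dimN n m := by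
  simp [Space, dimN, mul_comm]

theorem finrank_space_eq_add_one {n m : ℕ} (hn : 1 ≤ n) :
    Module.finrank ℝ (Space n m) = (dimN n m - 1) + 1 := by
  rw [finrank_space]
  have : 0 < dimN n m := Nat.mul_pos (Nat.succ_pos m) hn
  omega

section Ray

variable {E : Type*} [NormedAddCommGroup E] [NormedSpace ℝ E]

theorem tendsto_ray (y w : E) : Tendsto (fun t : ℝ => y + t • w) (𝓝[>] 0) (𝓝 y) := by
  have : Continuous fun t : ℝ => y + t • w := by fun_prop
  simpa using (this.tendsto 0).mono_left nhdsWithin_le_nhds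

theorem tendsto_div_along_ray {ρ : E → ℝ} {ρ' : E →L[ℝ] ℝ} {y : E} (h : HasFDerivAt ρ ρ' y)
    (hy : ρ y = 0) (w : E) :
    Tendsto (fun t : ℝ => ρ (y + t • w) / t) (𝓝[>] 0) (𝓝 (ρ' w)) := by
  have hline : HasDerivAt (fun t : ℝ => ρ (y + t • w)) (ρ' w) 0 := by
    have h6 : HasDerivAt (fun t : ℝ => y + t • w) w 0 := by
      simpa using ((hasDerivAt_id (0 : ℝ)).smul_const w).const_add y
    have h7 : HasFDerivAt ρ ρ' (y + (0 : ℝ) • w) := by simpa using h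
    exact h7.comp_hasDerivAt 0 h6
  have hslope := (hasDerivAt_iff_tendsto_slope.1 hline).mono_left
    (nhdsWithin_mono (0 : ℝ) (fun t (ht : t ∈ Ioi (0 : ℝ)) => (ne_of_gt ht : t ≠ 0)))
  refine hslope.congr fun t => ?_
  rw [slope_def_field]
  simp [hy]

end Ray

section Normal

variable {Ω : Set (Space n m)} {y ν : Space n m}

theorem IsOuterNormal.norm_eq_one (h : IsOuterNormal Ω y ν) : ‖ν‖ = 1 := by
  obtain ⟨ρ, -, -, h3, -, rfl⟩ := h
  rw [norm_smul, norm_inv, norm_norm, inv_mul_cancel₀ (norm_ne_zero_iff.2 h3)]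

theorem IsOuterNormal.exists_defining_function (h : IsOuterNormal Ω y ν) :
    ∃ (ρ : Space n m → ℝ) (ρ' : Space n m →L[ℝ] ℝ) (a : ℝ), HasStrictFDerivAt ρ ρ' y ∧ ρ y = 0 ∧
      0 < a ∧ (∀ w, ρ' w = a * inner ℝ ν w) ∧ ∀ᶠ z in 𝓝 y, (z ∈ Ω ↔ ρ z < 0) := by
  obtain ⟨ρ, h1, h2, h3, h4, rfl⟩ := h
  have h5 : 0 < ‖gradient ρ y‖ := norm_pos_iff.2 h3
  refine ⟨ρ, fderiv ℝ ρ y, ‖gradient ρ y‖, h1.hasStrictFDerivAt one_ne_zero, h2, h5, fun w => ?_,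
    h4⟩
  rw [real_inner_smul_left, ← mul_assoc, mul_inv_cancel₀ h5.ne', one_mul, inner_gradient_left]

/-- Directions making an obtuse angle with the exterior normal point into `Ω`. -/
theorem IsOuterNormal.eventually_mem (h : IsOuterNormal Ω y ν) {w : Space n m}
    (hw : inner ℝ ν w < 0) : ∀ᶠ t : ℝ in 𝓝[>] 0, y + t • w ∈ Ω := by
  obtain ⟨ρ, ρ', a, h1, h2, h3, h4, h5⟩ := h.exists_defining_function
  have hneg : ρ' w < 0 := by rw [h4]; exact mul_neg_of_pos_of_neg h3 hw
  filter_upwards [(tendsto_div_along_ray h1.hasFDerivAt h2 w).eventually_lt_const hneg,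
    (tendsto_ray y w).eventually h5, self_mem_nhdsWithin] with t ht1 ht2 ht3
  exact ht2.2 ((div_neg_iff.1 ht1).resolve_left fun h => (lt_asymm h.2 ht3)).1

theorem IsOuterNormal.unique {ν' : Space n m} (h : IsOuterNormal Ω y ν)
    (h' : IsOuterNormal Ω y ν') : ν = ν' := by
  by_contra hne
  have h1 := h.norm_eq_one
  have h2 := h'.norm_eq_one
  have h3 : inner ℝ ν ν' < 1 := (inner_lt_one_iff_real_of_norm_eq_one h1 h2).2 hne
  -- `ν' - ν` points into `Ω` by the first normal, and out of it by the second one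
  have h4 : inner ℝ ν (ν' - ν) < 0 := by
    rw [inner_sub_right, real_inner_self_eq_norm_sq, h1]; linarith
  have h5 : 0 < inner ℝ ν' (ν' - ν) := by
    rw [inner_sub_right, real_inner_self_eq_norm_sq, h2, real_inner_comm]; linarith
  obtain ⟨ρ, ρ', a, k1, k2, k3, k4, k5⟩ := h'.exists_defining_function
  have hpos : 0 < ρ' (ν' - ν) := by rw [k4]; exact mul_pos k3 h5
  obtain ⟨t, ⟨⟨ht1, ht2⟩, ht3⟩, ht4⟩ :=
    ((((tendsto_div_along_ray k1.hasFDerivAt k2 _).eventually_const_lt hpos).and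
      ((tendsto_ray y _).eventually k5)).and (h.eventually_mem h4)).and self_mem_nhdsWithin |>.exists
  exact lt_asymm ht1 (div_neg_of_neg_of_pos (ht2.1 ht3) ht4)

theorem outerNormal_spec (h : ∃ ν, IsOuterNormal Ω y ν) : IsOuterNormal Ω y (outerNormal Ω y) := by
  rw [outerNormal, dif_pos h]; exact h.choose_spec

theorem IsOuterNormal.outerNormal_eq (h : IsOuterNormal Ω y ν) : outerNormal Ω y = ν :=
  (outerNormal_spec ⟨ν, h⟩).unique h

theorem norm_outerNormal_le_one (Ω : Set (Space n m)) (y : Space n m) : ‖outerNormal Ω y‖ ≤ 1 := by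
  by_cases h : ∃ ν, IsOuterNormal Ω y ν
  · exact (outerNormal_spec h).norm_eq_one.le
  · rw [outerNormal, dif_neg h]; simp

/-- Near a boundary point with an exterior normal, the normalized gradient of a defining function is
the exterior normal at every boundary point. -/
theorem IsOuterNormal.exists_continuousAt_normal (hΩ : IsOpen Ω) (h : IsOuterNormal Ω y ν) :
    ∃ N : Space n m → Space n m, ContinuousAt N y ∧ N y = ν ∧
      ∀ᶠ z in 𝓝 y, z ∈ frontier Ω → IsOuterNormal Ω z (N z) := by
  obtain ⟨ρ, h1, h2, h3, h4, rfl⟩ := h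
  have hgrad : ContinuousAt (gradient ρ) y := by
    have h5 : ContinuousAt (fderiv ℝ ρ) y := h1.continuousAt_fderiv one_ne_zero
    exact (LinearIsometryEquiv.continuous _).continuousAt.comp h5
  refine ⟨fun z => ‖gradient ρ z‖⁻¹ • gradient ρ z,
    (hgrad.norm.inv₀ (norm_ne_zero_iff.2 h3)).smul hgrad, rfl, ?_⟩
  have e1 : ∀ᶠ z in 𝓝 y, ContDiffAt ℝ 1 ρ z := h1.eventually (by simp)
  have e2 : ∀ᶠ z in 𝓝 y, gradient ρ z ≠ 0 := hgrad.eventually_ne h3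
  filter_upwards [e1, e2, h4.eventually_nhds] with z hz1 hz2 hz3 hzf
  refine ⟨ρ, hz1, ?_, hz2, hz3, rfl⟩
  rw [hΩ.frontier_eq] at hzf
  have h6 : 0 ≤ ρ z := not_lt.1 fun h => hzf.2 (hz3.self_of_nhds.2 h)
  refine le_antisymm (not_lt.1 fun h => ?_) h6
  obtain ⟨w, ⟨hw1, hw2⟩, hw3⟩ := mem_closure_iff_nhds.1 hzf.1 _
    ((hz1.continuousAt.eventually_const_lt h).and hz3)
  exact absurd (hw2.1 hw3) (not_lt.2 hw1.le)

theorem continuousWithinAt_outerNormal (hΩ : IsOpen Ω) (hy : y ∈ regularPart Ω) :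
    ContinuousWithinAt (outerNormal Ω) (frontier Ω) y := by
  obtain ⟨hyf, ν, h⟩ := hy
  obtain ⟨N, h1, h2, h3⟩ := h.exists_continuousAt_normal hΩ
  refine h1.continuousWithinAt.congr_of_eventuallyEq ?_ (by rw [h.outerNormal_eq, h2])
  filter_upwards [nhdsWithin_le_nhds h3, self_mem_nhdsWithin] with z hz hzf
  exact (hz hzf).outerNormal_eq

theorem isClosed_singularPart (hΩ : IsOpen Ω) : IsClosed (frontier Ω \ regularPart Ω) := by
  rw [← isOpen_compl_iff, isOpen_iff_mem_nhds]
  intro y hy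
  by_cases hyf : y ∈ frontier Ω
  · have hyr : y ∈ regularPart Ω := by
      by_contra hcon
      exact hy ⟨hyf, hcon⟩
    obtain ⟨N, -, -, h3⟩ := hyr.2.choose_spec.exists_continuousAt_normal hΩ
    filter_upwards [h3] with z hz hz'
    exact hz'.2 ⟨hz'.1, _, hz hz'.1⟩
  · filter_upwards [isClosed_frontier.isOpen_compl.mem_nhds hyf] with z hz hz'
    exact hz hz'.1

theorem ae_mem_regularPart (hsing : surfaceMeasure n m (frontier Ω \ regularPart Ω) = 0) :
    ∀ᵐ z ∂(surfaceMeasure n m).restrict (frontier Ω), z ∈ regularPart Ω := by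
  rw [ae_restrict_iff' isClosed_frontier.measurableSet, ae_iff]
  refine measure_mono_null (fun z hz => ?_) hsing
  simp only [mem_ofPred_eq, Classical.not_imp] at hz
  exact hz

theorem aestronglyMeasurable_outerNormal (hΩ : IsOpen Ω)
    (hsing : surfaceMeasure n m (frontier Ω \ regularPart Ω) = 0) :
    AEStronglyMeasurable (outerNormal Ω) ((surfaceMeasure n m).restrict (frontier Ω)) := by
  have hset : regularPart Ω = frontier Ω \ (frontier Ω \ regularPart Ω) := by
    rw [sdiff_sdiff_right_self]
    exact (inter_eq_self_of_subset_right fun z hz => hz.1).symm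
  have hmeas : MeasurableSet (regularPart Ω) := by
    rw [hset]
    exact isClosed_frontier.measurableSet.diff (isClosed_singularPart hΩ).measurableSet
  have h1 : ContinuousOn (outerNormal Ω) (regularPart Ω) := fun y hy =>
    (continuousWithinAt_outerNormal hΩ hy).mono fun z hz => hz.1
  have h2 := h1.aestronglyMeasurable (μ := surfaceMeasure n m) hmeas
  have h3 : (surfaceMeasure n m).restrict (frontier Ω) =
      (surfaceMeasure n m).restrict (regularPart Ω) := by
    refine Measure.restrict_congr_set ?_
    refine (ae_eq_set.2 ⟨hsing, ?_⟩)
    rw [sdiff_eq_empty.2 fun z hz => hz.1]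
    exact measure_empty
  rwa [h3]

end Normal

end Hypercomplex

/-! ### The divergence theorem -/

namespace Hypercomplex

section Gauss

variable {n m : ℕ} {Ω : Set (Space n m)}

theorem integrable_mul_inner_outerNormal (hΩ : IsOpen Ω)
    (hsing : surfaceMeasure n m (frontier Ω \ regularPart Ω) = 0)
    {φ : Space n m → ℝ} (hφ : Integrable φ ((surfaceMeasure n m).restrict (frontier Ω)))
    (e : Space n m) : Integrable (fun z => φ z * inner ℝ (outerNormal Ω z) e)
      ((surfaceMeasure n m).restrict (frontier Ω)) := by
  refine hφ.mul_bdd (c := ‖e‖)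
    ((aestronglyMeasurable_outerNormal hΩ hsing).inner aestronglyMeasurable_const) ?_
  refine Eventually.of_forall fun z => (norm_inner_le_norm _ _).trans ?_
  calc ‖outerNormal Ω z‖ * ‖e‖ ≤ 1 * ‖e‖ := by gcongr; exact norm_outerNormal_le_one _ _
    _ = ‖e‖ := one_mul _

theorem integrable_frontier_of_continuous (hfin : surfaceMeasure n m (frontier Ω) < ⊤)
    {φ : Space n m → ℝ} (hφ : Continuous φ) (hc : HasCompactSupport φ) :
    Integrable φ ((surfaceMeasure n m).restrict (frontier Ω)) := by
  have : IsFiniteMeasure ((surfaceMeasure n m).restrict (frontier Ω)) :=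
    ⟨by rwa [Measure.restrict_apply_univ]⟩
  exact hφ.integrable_of_hasCompactSupport hc

/-- A test function supported away from `∂Ω` has no flux: its restriction to `Ω` is again a test
function. -/
theorem setIntegral_fderiv_eq_zero (hΩ : IsOpen Ω) {φ : Space n m → ℝ} (hφ : ContDiff ℝ 1 φ)
    (hc : HasCompactSupport φ) (hsupp : tsupport φ ⊆ (frontier Ω)ᶜ) (e : Space n m) :
    ∫ x in Ω, fderiv ℝ φ x e = 0 := by
  -- the function equal to `φ` on `Ω` and to `0` elsewhere is differentiable everywhere
  have hderiv : ∀ x, HasLineDerivAt ℝ (Ω.indicator φ)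
      (Ω.indicator (fun z => fderiv ℝ φ z e) x) x e := by
    intro x
    have hd := (hφ.differentiable one_ne_zero x).hasFDerivAt
    by_cases hx : x ∈ Ω
    · rw [indicator_of_mem hx]
      have : Ω.indicator φ =ᶠ[𝓝 x] φ := by
        filter_upwards [hΩ.mem_nhds hx] with z hz
        exact indicator_of_mem hz φ
      exact (hd.congr_of_eventuallyEq this).hasLineDerivAt e
    · rw [indicator_of_notMem hx]
      have : Ω.indicator φ =ᶠ[𝓝 x] fun _ => 0 := by
        by_cases hxc : x ∈ closure Ω
        · have hxf : x ∈ frontier Ω := by rw [hΩ.frontier_eq]; exact ⟨hxc, hx⟩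
          have hxs : x ∉ tsupport φ := fun h => hsupp h hxf
          filter_upwards [(isClosed_tsupport φ).isOpen_compl.mem_nhds hxs] with z hz
          simp [indicator, image_eq_zero_of_notMem_tsupport hz]
        · filter_upwards [isClosed_closure.isOpen_compl.mem_nhds hxc] with z hz
          exact indicator_of_notMem (fun h => hz (subset_closure h)) φ
      have h0 : HasFDerivAt (fun _ : Space n m => (0 : ℝ)) (0 : Space n m →L[ℝ] ℝ) x :=
        hasFDerivAt_const 0 x
      simpa using (h0.congr_of_eventuallyEq this).hasLineDerivAt e
  have h1 := integral_bilinear_hasLineDerivAt_right_eq_neg_left_of_integrable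
    (μ := (volume : Measure (Space n m))) (B := ContinuousLinearMap.mul ℝ ℝ) (v := e)
    (f := Ω.indicator φ) (f' := Ω.indicator (fun z => fderiv ℝ φ z e)) (g := fun _ => 1)
    (g' := fun _ => 0)
    (by simpa using (integrable_fderiv_apply hφ hc e).indicator hΩ.measurableSet)
    (by simp)
    (by simpa using (hφ.continuous.integrable_of_hasCompactSupport hc).indicator hΩ.measurableSet)
    (fun x _ => hderiv x)
    (fun x _ => by simpa using (hasFDerivAt_const (1 : ℝ) x).hasLineDerivAt e)
  simpa [integral_indicator hΩ.measurableSet] using h1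

/-- Locally, and away from the singular part of `∂Ω`, the divergence theorem holds up to a small
multiple of `∫ φ dS`. -/
theorem exists_nhds_divergence_approx (hn : 1 ≤ n) (hΩ : IsOpen Ω)
    (hsing : surfaceMeasure n m (frontier Ω \ regularPart Ω) = 0)
    (hfin : surfaceMeasure n m (frontier Ω) < ⊤) {y : Space n m}
    (hy : y ∉ frontier Ω \ regularPart Ω) (e : Space n m) {ε : ℝ} (hε : 0 < ε) :
    ∃ U : Set (Space n m), IsOpen U ∧ y ∈ U ∧ ∀ φ : Space n m → ℝ, IsFluxTest Ω U φ →
      |(∫ x in Ω, fderiv ℝ φ x e) -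
        ∫ x in frontier Ω, φ x * inner ℝ (outerNormal Ω x) e ∂(surfaceMeasure n m)| ≤
        ε * ∫ x in frontier Ω, φ x ∂(surfaceMeasure n m) := by
  by_cases hyf : y ∈ frontier Ω
  · have hyr : y ∈ regularPart Ω := by
      by_contra hcon
      exact hy ⟨hyf, hcon⟩
    obtain ⟨ν, hν⟩ := hyr.2
    obtain ⟨ρ, ρ', a, h1, h2, h3, h4, h5⟩ := hν.exists_defining_function
    obtain ⟨U₁, hU₁, hyU₁, hφ₁⟩ := exists_nhds_flux_approx (finrank_space_eq_add_one hn) hΩ h1 h2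
      h5 hν.norm_eq_one h3 h4 e (half_pos hε)
    have hcont : ContinuousWithinAt (fun z => inner ℝ (outerNormal Ω z) e) (frontier Ω) y :=
      (continuousWithinAt_outerNormal hΩ hyr).inner continuousWithinAt_const
    have hev := Metric.tendsto_nhds.1 hcont (ε / 2) (half_pos hε)
    simp only [hν.outerNormal_eq] at hev
    obtain ⟨U₂, hU₂, hyU₂, hU₂'⟩ := mem_nhdsWithin.1 hev
    refine ⟨U₁ ∩ U₂, hU₁.inter hU₂, ⟨hyU₁, hyU₂⟩, fun φ h => ?_⟩
    have k1 := hφ₁ φ (h.mono inter_subset_left)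
    change |(∫ x in Ω, fderiv ℝ φ x e) -
      inner ℝ ν e * ∫ x in frontier Ω, φ x ∂(surfaceMeasure n m)| ≤
      ε / 2 * ∫ x in frontier Ω, φ x ∂(surfaceMeasure n m) at k1
    have hint := integrable_frontier_of_continuous hfin h.1.continuous h.2
    have hint2 := integrable_mul_inner_outerNormal hΩ hsing hint e
    have k2 : |inner ℝ ν e * (∫ x in frontier Ω, φ x ∂(surfaceMeasure n m)) -
        ∫ x in frontier Ω, φ x * inner ℝ (outerNormal Ω x) e ∂(surfaceMeasure n m)| ≤
        ε / 2 * ∫ x in frontier Ω, φ x ∂(surfaceMeasure n m) := by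
      rw [← integral_const_mul, ← integral_sub (hint.const_mul _) hint2, ← integral_const_mul,
        ← Real.norm_eq_abs]
      refine norm_integral_le_of_norm_le (hint.const_mul _) ?_
      refine (ae_restrict_iff' isClosed_frontier.measurableSet).2 (Eventually.of_forall ?_)
      intro x hx
      by_cases hxU : x ∈ U₂
      · have h6 : |inner ℝ (outerNormal Ω x) e - inner ℝ ν e| < ε / 2 := hU₂' ⟨hxU, hx⟩
        have h7 : inner ℝ ν e * φ x - φ x * inner ℝ (outerNormal Ω x) e =
            -(inner ℝ (outerNormal Ω x) e - inner ℝ ν e) * φ x := by ring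
        rw [h7, Real.norm_eq_abs, abs_mul, abs_neg, abs_of_nonneg (h.nonneg x hx)]
        exact mul_le_mul_of_nonneg_right h6.le (h.nonneg x hx)
      · have : φ x = 0 := image_eq_zero_of_notMem_tsupport fun h' => hxU (h.3 h').2
        simp [this]
    calc _ ≤ _ := abs_sub_le _ (inner ℝ ν e * ∫ x in frontier Ω, φ x ∂(surfaceMeasure n m)) _
      _ ≤ _ := add_le_add k1 k2
      _ = _ := by ring
  · refine ⟨(frontier Ω)ᶜ, isClosed_frontier.isOpen_compl, hyf, fun φ h => ?_⟩
    have hφz : ∀ x ∈ frontier Ω, φ x = 0 := fun x hx =>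
      image_eq_zero_of_notMem_tsupport fun h' => h.3 h' hx
    have e1 : ∫ x in frontier Ω, φ x ∂(surfaceMeasure n m) = 0 := by
      rw [setIntegral_congr_fun isClosed_frontier.measurableSet hφz]; simp
    have e2 : ∫ x in frontier Ω, φ x * inner ℝ (outerNormal Ω x) e ∂(surfaceMeasure n m) = 0 := by
      rw [setIntegral_congr_fun isClosed_frontier.measurableSet
        (g := fun _ => 0) fun x hx => by simp [hφz x hx]]
      simp
    rw [e1, e2, setIntegral_fderiv_eq_zero hΩ h.1 h.2 h.3]
    simp

/-- The divergence theorem for test functions supported away from the singular part of `∂Ω`. -/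
theorem setIntegral_fderiv_eq_of_tsupport (hn : 1 ≤ n) (hΩ : IsOpen Ω)
    (hsing : surfaceMeasure n m (frontier Ω \ regularPart Ω) = 0)
    (hfin : surfaceMeasure n m (frontier Ω) < ⊤) (e : Space n m) {φ : Space n m → ℝ}
    (hφ : IsFluxTest Ω (frontier Ω \ regularPart Ω)ᶜ φ) :
    ∫ x in Ω, fderiv ℝ φ x e =
      ∫ x in frontier Ω, φ x * inner ℝ (outerNormal Ω x) e ∂(surfaceMeasure n m) := by
  set I := ∫ x in frontier Ω, φ x ∂(surfaceMeasure n m) with hI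
  have hI0 : 0 ≤ I := setIntegral_nonneg isClosed_frontier.measurableSet hφ.nonneg
  have key : ∀ ε : ℝ, 0 < ε → |(∫ x in Ω, fderiv ℝ φ x e) -
      ∫ x in frontier Ω, φ x * inner ℝ (outerNormal Ω x) e ∂(surfaceMeasure n m)| ≤ ε * I := by
    intro ε hε
    have hloc : ∀ y : tsupport φ, ∃ U : Set (Space n m), IsOpen U ∧ (y : Space n m) ∈ U ∧
        ∀ φ : Space n m → ℝ, IsFluxTest Ω U φ → |(∫ x in Ω, fderiv ℝ φ x e) -
          ∫ x in frontier Ω, φ x * inner ℝ (outerNormal Ω x) e ∂(surfaceMeasure n m)| ≤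
          ε * ∫ x in frontier Ω, φ x ∂(surfaceMeasure n m) := fun y =>
      exists_nhds_divergence_approx hn hΩ hsing hfin (hφ.3 y.2) e hε
    choose U hU hyU hUφ using hloc
    -- by a partition of unity, the local errors `ε ∫ fᵢ φ dS` add up to `ε ∫ φ dS`
    obtain ⟨f, hf⟩ := SmoothPartitionOfUnity.exists_isSubordinate
      (modelWithCornersSelf ℝ (Space n m)) (isClosed_tsupport φ) U hU
      (fun y hy => mem_iUnion.2 ⟨⟨y, hy⟩, hyU _⟩)
    have hfs : ∀ i, ContDiff ℝ 1 (f i) := fun i => (f i).contMDiff.contDiff.of_le (by simp)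
    have hFfin : {i | (Function.support (f i) ∩ tsupport φ).Nonempty}.Finite :=
      f.locallyFinite.finite_nonempty_inter_compact hφ.2
    set F := hFfin.toFinset with hF
    have hsum : ∀ x, φ x = ∑ i ∈ F, f i x * φ x := by
      intro x
      by_cases hx : x ∈ tsupport φ
      · rw [← Finset.sum_mul]
        have h1 : ∑ i ∈ F, f i x = 1 := by
          rw [← f.sum_eq_one hx]
          refine (finsum_eq_sum_of_support_subset _ fun i hi => ?_).symm
          rw [hF, Finite.coe_toFinset]
          exact ⟨x, hi, hx⟩
        rw [h1, one_mul]
      · simp [image_eq_zero_of_notMem_tsupport hx]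
    have htest : ∀ i, IsFluxTest Ω (U i) fun x => f i x * φ x := fun i =>
      ⟨(hfs i).mul hφ.1, hφ.2.mul_left, (tsupport_mul_subset_left (f := f i) (g := φ)).trans (hf i),
        fun z hz => mul_nonneg (f.nonneg i z) (hφ.nonneg z hz)⟩
    have hφint := fun i => integrable_frontier_of_continuous hfin (htest i).1.continuous (htest i).2
    have s1 : ∫ x in Ω, fderiv ℝ φ x e = ∑ i ∈ F, ∫ x in Ω, fderiv ℝ (fun x => f i x * φ x) x e := by
      rw [← integral_finsetSum _ fun i _ =>
        (integrable_fderiv_apply (htest i).1 (htest i).2 e).integrableOn]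
      refine integral_congr_ae (Eventually.of_forall fun x => ?_)
      have h1 : fderiv ℝ φ x = fderiv ℝ (fun x => ∑ i ∈ F, f i x * φ x) x := by
        congr 1; exact funext hsum
      change fderiv ℝ φ x e = _
      rw [h1, fderiv_fun_sum fun i _ => (htest i).1.differentiable one_ne_zero x,
        sum_apply]
    have s2 : ∫ x in frontier Ω, φ x * inner ℝ (outerNormal Ω x) e ∂(surfaceMeasure n m) =
        ∑ i ∈ F, ∫ x in frontier Ω, (f i x * φ x) * inner ℝ (outerNormal Ω x) e
          ∂(surfaceMeasure n m) := by
      rw [← integral_finsetSum _ fun i _ =>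
        integrable_mul_inner_outerNormal hΩ hsing (hφint i) e]
      refine integral_congr_ae (Eventually.of_forall fun x => ?_)
      change φ x * inner ℝ (outerNormal Ω x) e =
        ∑ i ∈ F, (f i x * φ x) * inner ℝ (outerNormal Ω x) e
      rw [← Finset.sum_mul, ← hsum]
    have s3 : I = ∑ i ∈ F, ∫ x in frontier Ω, f i x * φ x ∂(surfaceMeasure n m) := by
      rw [← integral_finsetSum _ fun i _ => hφint i]
      exact integral_congr_ae (Eventually.of_forall fun x => hsum x)
    rw [s1, s2, s3, ← Finset.sum_sub_distrib, Finset.mul_sum]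
    exact (Finset.abs_sum_le_sum_abs _ _).trans (Finset.sum_le_sum fun i _ => hUφ i _ (htest i))
  rw [← sub_eq_zero, ← abs_nonpos_iff]
  refine le_of_forall_pos_le_add fun ε hε => ?_
  rw [zero_add]
  refine (key (ε / (I + 1)) (by positivity)).trans ?_
  rw [div_mul_eq_mul_div, div_le_iff₀ (by positivity)]
  nlinarith

/-- The divergence theorem for compactly supported functions that are nonnegative on `∂Ω`; the
singular part of `∂Ω` is removed by cutoff functions. -/
theorem setIntegral_fderiv_eq_of_nonneg (hn : 1 ≤ n) (hΩ : IsOpen Ω)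
    (hΩb : Bornology.IsBounded Ω)
    (hsing : surfaceMeasure n m (frontier Ω \ regularPart Ω) = 0)
    (hfin : surfaceMeasure n m (frontier Ω) < ⊤) (e : Space n m) {φ : Space n m → ℝ}
    (hφ : IsFluxTest Ω univ φ) :
    ∫ x in Ω, fderiv ℝ φ x e =
      ∫ x in frontier Ω, φ x * inner ℝ (outerNormal Ω x) e ∂(surfaceMeasure n m) := by
  set Z := frontier Ω \ regularPart Ω with hZdef
  have hZ : IsCompact Z := by
    refine Metric.isCompact_of_isClosed_isBounded (isClosed_singularPart hΩ) ?_
    exact hΩb.closure.subset fun z hz => frontier_subset_closure hz.1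
  have hcut : ∀ k : ℕ, ∃ ψ : Space n m → ℝ, ContDiff ℝ 1 ψ ∧ (∀ z, 0 ≤ ψ z ∧ ψ z ≤ 1) ∧
      Disjoint (tsupport ψ) Z ∧ (∀ z, (∀ w ∈ Z, 1 / ((k : ℝ) + 1) ≤ dist z w) → ψ z = 1) ∧
      Integrable (fun z => ‖fderiv ℝ ψ z‖) ∧ ∫ z, ‖fderiv ℝ ψ z‖ ≤ 1 / ((k : ℝ) + 1) := fun k =>
    exists_cutoff_of_measure_eq_zero (finrank_space_eq_add_one hn) hZ hsing
      Nat.one_div_pos_of_nat Nat.one_div_pos_of_nat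
  choose ψ h1 h2 h3 h4 h5 h6 using hcut
  have hlim : ∀ z ∉ Z, Tendsto (fun k => ψ k z) atTop (𝓝 1) := by
    intro z hz
    obtain ⟨δ, hδ, hball⟩ := Metric.isOpen_iff.1 (isClosed_singularPart hΩ).isOpen_compl z hz
    refine tendsto_const_nhds.congr' ?_
    filter_upwards [tendsto_one_div_add_atTop_nhds_zero_nat.eventually_lt_const hδ] with k hk
    refine (h4 k z fun w hw => ?_).symm
    by_contra hcon
    refine hball (Metric.mem_ball'.2 ?_) hw
    linarith [not_le.1 hcon]
  obtain ⟨M, hM⟩ := hφ.1.continuous.bounded_above_of_compact_support hφ.2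
  have hM0 : 0 ≤ M := (norm_nonneg _).trans (hM 0)
  have htest : ∀ k, IsFluxTest Ω (frontier Ω \ regularPart Ω)ᶜ fun x => ψ k x * φ x := fun k =>
    ⟨(h1 k).mul hφ.1, hφ.2.mul_left,
      (tsupport_mul_subset_left (f := ψ k) (g := φ)).trans fun z hz hz' =>
        Set.disjoint_left.1 (h3 k) hz hz',
      fun z hz => mul_nonneg (h2 k z).1 (hφ.nonneg z hz)⟩
  have heq := fun k => setIntegral_fderiv_eq_of_tsupport hn hΩ hsing hfin e (htest k)
  have hdφ := integrable_fderiv_apply hφ.1 hφ.2 e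
  -- the term containing the gradient of the cutoff is negligible
  have hDψ : ∀ k, Integrable fun x => φ x * fderiv ℝ (ψ k) x e := by
    intro k
    refine ((h5 k).const_mul (M * ‖e‖)).mono' ?_ (Eventually.of_forall fun x => ?_)
    · exact (hφ.1.continuous.mul (((h1 k).continuous_fderiv one_ne_zero).clm_apply
        continuous_const)).aestronglyMeasurable
    · rw [norm_mul]
      calc ‖φ x‖ * ‖fderiv ℝ (ψ k) x e‖ ≤ M * (‖fderiv ℝ (ψ k) x‖ * ‖e‖) := by
            gcongr
            · exact hM x
            · exact (fderiv ℝ (ψ k) x).le_opNorm e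
        _ = M * ‖e‖ * ‖fderiv ℝ (ψ k) x‖ := by ring
  have hψφ : ∀ k, Integrable fun x => ψ k x * fderiv ℝ φ x e := by
    intro k
    refine hdφ.bdd_mul (c := 1) (h1 k).continuous.aestronglyMeasurable
      (Eventually.of_forall fun x => ?_)
    rw [Real.norm_of_nonneg (h2 k x).1]
    exact (h2 k x).2
  have hexp : ∀ k, ∫ x in Ω, fderiv ℝ (fun x => ψ k x * φ x) x e =
      (∫ x in Ω, ψ k x * fderiv ℝ φ x e) + ∫ x in Ω, φ x * fderiv ℝ (ψ k) x e := by
    intro k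
    rw [← integral_add (hψφ k).integrableOn (hDψ k).integrableOn]
    refine integral_congr_ae (Eventually.of_forall fun x => ?_)
    change fderiv ℝ (fun x => ψ k x * φ x) x e = _
    rw [fderiv_fun_mul ((h1 k).differentiable one_ne_zero x) (hφ.1.differentiable one_ne_zero x)]
    simp
  have t1 : Tendsto (fun k => ∫ x in Ω, ψ k x * fderiv ℝ φ x e) atTop
      (𝓝 (∫ x in Ω, fderiv ℝ φ x e)) := by
    refine tendsto_integral_of_dominated_convergence (fun x => ‖fderiv ℝ φ x e‖)
      (fun k => (hψφ k).integrableOn.aestronglyMeasurable) hdφ.norm.integrableOn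
      (fun k => Eventually.of_forall fun x => ?_) ?_
    · rw [norm_mul, Real.norm_of_nonneg (h2 k x).1]
      exact mul_le_of_le_one_left (norm_nonneg _) (h2 k x).2
    · refine (ae_restrict_iff' hΩ.measurableSet).2 (Eventually.of_forall fun x hx => ?_)
      have hxZ : x ∉ Z := fun h => by
        have := h.1
        rw [hΩ.frontier_eq] at this
        exact this.2 hx
      simpa using (hlim x hxZ).mul_const (fderiv ℝ φ x e)
  have t2 : Tendsto (fun k => ∫ x in Ω, φ x * fderiv ℝ (ψ k) x e) atTop (𝓝 0) := by
    have hb : ∀ k : ℕ, ‖∫ x in Ω, φ x * fderiv ℝ (ψ k) x e‖ ≤ M * ‖e‖ * (1 / ((k : ℝ) + 1)) := by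
      intro k
      calc ‖∫ x in Ω, φ x * fderiv ℝ (ψ k) x e‖ ≤ ∫ x in Ω, ‖φ x * fderiv ℝ (ψ k) x e‖ :=
            norm_integral_le_integral_norm _
        _ ≤ ∫ x, ‖φ x * fderiv ℝ (ψ k) x e‖ :=
            setIntegral_le_integral (hDψ k).norm (Eventually.of_forall fun x => norm_nonneg _)
        _ ≤ ∫ x, M * ‖e‖ * ‖fderiv ℝ (ψ k) x‖ := by
            refine integral_mono (hDψ k).norm ((h5 k).const_mul _) fun x => ?_
            change ‖φ x * fderiv ℝ (ψ k) x e‖ ≤ _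
            rw [norm_mul]
            calc ‖φ x‖ * ‖fderiv ℝ (ψ k) x e‖ ≤ M * (‖fderiv ℝ (ψ k) x‖ * ‖e‖) := by
                  gcongr
                  · exact hM x
                  · exact (fderiv ℝ (ψ k) x).le_opNorm e
              _ = M * ‖e‖ * ‖fderiv ℝ (ψ k) x‖ := by ring
        _ ≤ M * ‖e‖ * (1 / ((k : ℝ) + 1)) := by
            rw [integral_const_mul]
            gcongr
            exact h6 k
    refine squeeze_zero_norm hb ?_
    simpa using tendsto_one_div_add_atTop_nhds_zero_nat.const_mul (M * ‖e‖)
  have hφint := integrable_mul_inner_outerNormal hΩ hsing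
    (integrable_frontier_of_continuous hfin hφ.1.continuous hφ.2) e
  have t3 : Tendsto (fun k => ∫ x in frontier Ω, (ψ k x * φ x) * inner ℝ (outerNormal Ω x) e
      ∂(surfaceMeasure n m)) atTop
      (𝓝 (∫ x in frontier Ω, φ x * inner ℝ (outerNormal Ω x) e ∂(surfaceMeasure n m))) := by
    refine tendsto_integral_of_dominated_convergence
      (fun x => ‖φ x * inner ℝ (outerNormal Ω x) e‖)
      (fun k => (integrable_mul_inner_outerNormal hΩ hsing (integrable_frontier_of_continuous hfin
        (htest k).1.continuous (htest k).2) e).aestronglyMeasurable) hφint.norm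
      (fun k => Eventually.of_forall fun x => ?_) ?_
    · rw [mul_assoc, norm_mul, Real.norm_of_nonneg (h2 k x).1]
      exact mul_le_of_le_one_left (norm_nonneg _) (h2 k x).2
    · filter_upwards [ae_mem_regularPart hsing] with x hx
      have hxZ : x ∉ Z := fun h => h.2 hx
      simpa [mul_assoc] using (hlim x hxZ).mul_const (φ x * inner ℝ (outerNormal Ω x) e)
  have t4 := (t1.add t2).congr fun k => (hexp k).symm
  rw [add_zero] at t4
  exact tendsto_nhds_unique (t4.congr heq) t3

/-- **Divergence theorem** for a bounded open set whose boundary has finite surface measure and is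
smooth outside a set of vanishing surface measure. -/
theorem setIntegral_fderiv_eq_integral_frontier (hn : 1 ≤ n) (hΩ : IsOpen Ω)
    (hΩb : Bornology.IsBounded Ω)
    (hsing : surfaceMeasure n m (frontier Ω \ regularPart Ω) = 0)
    (hfin : surfaceMeasure n m (frontier Ω) < ⊤) (e : Space n m) {φ : Space n m → ℝ}
    (hφ : ContDiff ℝ 1 φ) :
    ∫ x in Ω, fderiv ℝ φ x e =
      ∫ x in frontier Ω, φ x * inner ℝ (outerNormal Ω x) e ∂(surfaceMeasure n m) := by
  obtain ⟨R, hR⟩ := hΩb.closure.subset_ball 0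
  have hR0 : 0 < max R 1 := by positivity
  let χ : ContDiffBump (0 : Space n m) := ⟨max R 1, max R 1 + 1, hR0, by linarith⟩
  have hχ : ContDiff ℝ 1 χ := χ.contDiff
  have hχ1 : ∀ z ∈ closure Ω, χ =ᶠ[𝓝 z] fun _ => 1 := by
    intro z hz
    have h1 : z ∈ Metric.ball (0 : Space n m) (max R 1) :=
      Metric.ball_subset_ball (le_max_left _ _) (hR hz)
    filter_upwards [Metric.isOpen_ball.mem_nhds h1] with w hw
    exact χ.one_of_mem_closedBall (Metric.ball_subset_closedBall hw)
  have hχc : HasCompactSupport χ := χ.hasCompactSupport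
  have hcpt : IsCompact (closure Ω) :=
    Metric.isCompact_of_isClosed_isBounded isClosed_closure hΩb.closure
  obtain ⟨K, hK⟩ := hcpt.exists_bound_of_continuousOn hφ.continuous.continuousOn
  -- shifting `φ` by a constant makes it nonnegative on the boundary
  have ht1 : IsFluxTest Ω univ fun x => (φ x + |K|) * χ x :=
    ⟨(hφ.add contDiff_const).mul hχ, hχc.mul_left, subset_univ _, fun z hz =>
      mul_nonneg (by
        have h1 := hK z (frontier_subset_closure hz)
        rw [Real.norm_eq_abs] at h1
        have h2 := neg_abs_le (φ z)
        have h3 := le_abs_self K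
        linarith) χ.nonneg⟩
  have ht2 : IsFluxTest Ω univ fun x => |K| * χ x :=
    ⟨contDiff_const.mul hχ, hχc.mul_left, subset_univ _, fun z hz =>
      mul_nonneg (abs_nonneg _) χ.nonneg⟩
  have g1 := setIntegral_fderiv_eq_of_nonneg hn hΩ hΩb hsing hfin e ht1
  have g2 := setIntegral_fderiv_eq_of_nonneg hn hΩ hΩb hsing hfin e ht2
  have i1 := integrable_fderiv_apply ht1.1 ht1.2 e
  have i2 := integrable_fderiv_apply ht2.1 ht2.2 e
  have j1 := integrable_mul_inner_outerNormal hΩ hsing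
    (integrable_frontier_of_continuous hfin ht1.1.continuous ht1.2) e
  have j2 := integrable_mul_inner_outerNormal hΩ hsing
    (integrable_frontier_of_continuous hfin ht2.1.continuous ht2.2) e
  have l1 : ∫ x in Ω, fderiv ℝ φ x e = (∫ x in Ω, fderiv ℝ (fun x => (φ x + |K|) * χ x) x e) -
      ∫ x in Ω, fderiv ℝ (fun x => |K| * χ x) x e := by
    rw [← integral_sub i1.integrableOn i2.integrableOn]
    refine setIntegral_congr_fun hΩ.measurableSet fun x hx => ?_
    have e1 : (fun x => (φ x + |K|) * χ x) =ᶠ[𝓝 x] fun x => φ x + |K| := by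
      filter_upwards [hχ1 x (subset_closure hx)] with z hz
      rw [hz, mul_one]
    have e2 : (fun x => |K| * χ x) =ᶠ[𝓝 x] fun x => |K| := by
      filter_upwards [hχ1 x (subset_closure hx)] with z hz
      rw [hz, mul_one]
    change fderiv ℝ φ x e = fderiv ℝ (fun x => (φ x + |K|) * χ x) x e -
      fderiv ℝ (fun x => |K| * χ x) x e
    rw [e1.fderiv_eq, e2.fderiv_eq]
    simp
  rw [l1, g1, g2, ← integral_sub j1 j2]
  refine setIntegral_congr_fun isClosed_frontier.measurableSet fun x hx => ?_
  have := (hχ1 x (frontier_subset_closure hx)).self_of_nhds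
  simp only [this]
  ring

end Gauss

end Hypercomplex

/-! ### Finiteness of the surface measure and weakly singular integrals -/

namespace Hypercomplex

section WeaklySingular

/-- The singularity `|z| ^ (β - d)` is integrable in dimension `d` when `β > 0`. -/
theorem integrableOn_norm_rpow_ball {F : Type*} [NormedAddCommGroup F] [NormedSpace ℝ F]
    [FiniteDimensional ℝ F] [MeasurableSpace F] [BorelSpace F] (μ : Measure F)
    [μ.IsAddHaarMeasure] {d : ℕ} (hF : Module.finrank ℝ F = d) (hd : 1 ≤ d) {β : ℝ} (hβ : 0 < β)
    (r : ℝ) : IntegrableOn (fun z : F => ‖z‖ ^ (β - d)) (Metric.ball 0 r) μ := by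
  have : Nontrivial F := Module.nontrivial_of_finrank_pos (R := ℝ) (by omega)
  rw [integrableOn_fun_norm_addHaar μ (f := fun t : ℝ => t ^ (β - d)), hF]
  have h1 : IntegrableOn (fun t : ℝ => t ^ (β - 1)) (Ioo 0 r) := by
    rcases le_or_gt r 0 with hr | hr
    · simp [Ioo_eq_empty (not_lt.2 hr)]
    · exact (intervalIntegral.integrableOn_Ioo_rpow_iff hr).2 (by linarith)
  refine h1.congr_fun (fun t ht => ?_) measurableSet_Ioo
  have ht0 : 0 < t := ht.1
  change t ^ (β - 1) = t ^ (d - 1) * t ^ (β - d)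
  rw [← Real.rpow_natCast, ← Real.rpow_add ht0, Nat.cast_sub hd]
  congr 1
  push_cast
  ring

variable {E : Type*} [NormedAddCommGroup E] [InnerProductSpace ℝ E] [FiniteDimensional ℝ E]
  [MeasurableSpace E] [BorelSpace E]

/-- On a `C¹` hypersurface through `x`, of dimension `d`, the surface measure is locally finite and
the functions `|p - x| ^ (β - d)`, `0 < β ≤ d`, are locally integrable. -/
theorem exists_nhds_lintegral_hypersurface_lt_top {d : ℕ} (hd : Module.finrank ℝ E = d + 1)
    (hd1 : 1 ≤ d) {ρ : E → ℝ} {ρ' : E →L[ℝ] ℝ} {x : E} (hρ : HasStrictFDerivAt ρ ρ' x)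
    (hx : ρ x = 0) {ν : E} (hν : ‖ν‖ = 1) {a : ℝ} (ha : 0 < a)
    (hρ' : ∀ w, ρ' w = a * inner ℝ ν w) {β : ℝ} (hβ : 0 < β) (hβd : β ≤ d) :
    ∃ W ∈ 𝓝 x, μHE[d] {p ∈ W | ρ p = 0} < ⊤ ∧
      ∫⁻ p in {p ∈ W | ρ p = 0}, ENNReal.ofReal (‖p - x‖ ^ (β - d)) ∂μHE[d] < ⊤ := by
  obtain ⟨W₀, hW₀, hA⟩ := exists_antilipschitz_normal hρ hν ha hρ' (κ := 2) one_lt_two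
  obtain ⟨W₁, hW₁, hlin⟩ := hρ.approximates_deriv_on_nhds (c := 1) (Or.inr one_pos)
  obtain ⟨r, hr, hball⟩ := Metric.nhds_basis_closedBall.mem_iff.1 (inter_mem hW₀ hW₁)
  have hcont : ContinuousOn ρ (Metric.closedBall x r) :=
    hlin.continuousOn.mono fun p hp => (hball hp).2
  set G := {p ∈ Metric.closedBall x r | ρ p = 0} with hGdef
  have hG : IsCompact G := (isCompact_closedBall x r).of_isClosed_subset
    (hcont.preimage_isClosed_of_isClosed Metric.isClosed_closedBall isClosed_singleton)
    fun p hp => hp.1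
  have hAG : ∀ p ∈ G, ∀ q ∈ G, ‖p - q‖ ≤ (2 : NNReal) * ‖hyperplaneProj ν (p - q)‖ :=
    fun p hp q hq => hA p (hball hp.1).1 q (hball hq.1).1 hp.2 hq.2
  have hxG : x ∈ G := ⟨Metric.mem_closedBall_self hr.le, hx⟩
  have hPG : IsCompact (hyperplaneProj ν '' G) := hG.image (hyperplaneProj ν).continuous
  obtain ⟨g, hgl, hgm, -, hge⟩ := graph_measure_comparison hd hν hG hAG
  refine ⟨Metric.closedBall x r, Metric.closedBall_mem_nhds x hr, ?_, ?_⟩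
  · refine (le_volume_hyperplaneProj_image hd hν hAG).trans_lt ?_
    exact ENNReal.mul_lt_top (ENNReal.pow_lt_top ENNReal.coe_lt_top) hPG.measure_lt_top
  · have hmeas : Measurable fun p : E => ENNReal.ofReal (‖p - x‖ ^ (β - d)) := by fun_prop
    have hstep : ∫⁻ p in G, ENNReal.ofReal (‖p - x‖ ^ (β - d)) ∂μHE[d] ≤
        ((2 : NNReal) : ENNReal) ^ d * ∫⁻ z in hyperplaneProj ν '' G,
          ENNReal.ofReal (‖z - hyperplaneProj ν x‖ ^ (β - d)) := by
      calc ∫⁻ p in G, ENNReal.ofReal (‖p - x‖ ^ (β - d)) ∂μHE[d]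
          ≤ ∫⁻ p, ENNReal.ofReal (‖p - x‖ ^ (β - d)) ∂(((2 : NNReal) : ENNReal) ^ d •
              (volume.restrict (hyperplaneProj ν '' G)).map g) := lintegral_mono' hge le_rfl
        _ = ((2 : NNReal) : ENNReal) ^ d * ∫⁻ z in hyperplaneProj ν '' G,
              ENNReal.ofReal (‖g z - x‖ ^ (β - d)) := by
            rw [lintegral_smul_measure, smul_eq_mul, lintegral_map' hmeas.aemeasurable hgm]
        _ ≤ _ := by
            refine mul_le_mul' le_rfl (setLIntegral_mono' hPG.measurableSet ?_)
            rintro _ ⟨p, hp, rfl⟩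
            rw [hgl p hp]
            refine ENNReal.ofReal_le_ofReal ?_
            rw [← map_sub]
            by_cases hpx : p = x
            · simp [hpx]
            · have h1 : 0 < ‖p - x‖ := norm_pos_iff.2 (sub_ne_zero.2 hpx)
              have h2 : 0 < ‖hyperplaneProj ν (p - x)‖ := by
                have := hAG p hp x hxG
                by_contra hcon
                have h3 : ‖hyperplaneProj ν (p - x)‖ = 0 :=
                  le_antisymm (not_lt.1 hcon) (norm_nonneg _)
                rw [h3, mul_zero] at this
                linarith
              exact Real.rpow_le_rpow_of_nonpos h2 (norm_hyperplaneProj_le _ _) (by linarith)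
    refine hstep.trans_lt (ENNReal.mul_lt_top (ENNReal.pow_lt_top ENNReal.coe_lt_top) ?_)
    have hsub : hyperplaneProj ν '' G ⊆ Metric.ball (hyperplaneProj ν x) (r + 1) := by
      rintro _ ⟨p, hp, rfl⟩
      rw [Metric.mem_ball, dist_eq_norm, ← map_sub]
      refine (norm_hyperplaneProj_le _ _).trans_lt ?_
      have h1 : ‖p - x‖ ≤ r := by rw [← dist_eq_norm]; exact hp.1
      linarith
    have hint : IntegrableOn (fun z : normalHyperplane ν =>
        ‖z - hyperplaneProj ν x‖ ^ (β - d)) (Metric.ball (hyperplaneProj ν x) (r + 1)) := by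
      have h1 := integrableOn_norm_rpow_ball (volume : Measure (normalHyperplane ν))
        (finrank_normalHyperplane hd hν) hd1 hβ (r + 1)
      rw [← integrable_indicator_iff measurableSet_ball] at h1 ⊢
      have h2 := h1.comp_sub_right (hyperplaneProj ν x)
      refine h2.congr (Eventually.of_forall fun z => ?_)
      simp only [indicator, Metric.mem_ball, dist_eq_norm, sub_zero]
    refine (lintegral_mono_set hsub).trans_lt ?_
    have h2 := hint.2
    rw [hasFiniteIntegral_iff_ofReal
      (Eventually.of_forall fun z => Real.rpow_nonneg (norm_nonneg _) _)] at h2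
    exact h2

end WeaklySingular

section Boundary

variable {n m : ℕ} {Ω : Set (Space n m)}

theorem one_le_dimN_sub_one (hn : 1 ≤ n) (hm : 1 ≤ m) : 1 ≤ dimN n m - 1 := by
  have : 2 * 1 ≤ (m + 1) * n := Nat.mul_le_mul (by omega) hn
  change 1 ≤ (m + 1) * n - 1
  omega

/-- A nonzero gradient as a positive multiple of a unit vector. -/
theorem exists_unit_normal_of_gradient_ne_zero {ρ : Space n m → ℝ} {x : Space n m}
    (h1 : ContDiffAt ℝ 1 ρ x) (h2 : gradient ρ x ≠ 0) :
    HasStrictFDerivAt ρ (fderiv ℝ ρ x) x ∧ ‖‖gradient ρ x‖⁻¹ • gradient ρ x‖ = 1 ∧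
      0 < ‖gradient ρ x‖ ∧ ∀ w, fderiv ℝ ρ x w =
        ‖gradient ρ x‖ * inner ℝ (‖gradient ρ x‖⁻¹ • gradient ρ x) w := by
  have h5 : 0 < ‖gradient ρ x‖ := norm_pos_iff.2 h2
  refine ⟨h1.hasStrictFDerivAt one_ne_zero, ?_, h5, fun w => ?_⟩
  · rw [norm_smul, norm_inv, norm_norm, inv_mul_cancel₀ h5.ne']
  · rw [real_inner_smul_left, ← mul_assoc, mul_inv_cancel₀ h5.ne', one_mul, inner_gradient_left]

/-- The boundary is locally covered by finitely many hypersurfaces; those that do not pass through `x`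
do not matter near `x`. -/
theorem exists_nhds_lintegral_frontier_lt_top (hn : 1 ≤ n) (hm : 1 ≤ m)
    (hΓ : HasPiecewiseSmoothBoundary Ω) {x : Space n m} (hx : x ∈ frontier Ω) {β : ℝ} (hβ : 0 < β)
    (hβ1 : β ≤ 1) :
    ∃ W ∈ 𝓝 x, surfaceMeasure n m (frontier Ω ∩ W) < ⊤ ∧
      ∫⁻ p in frontier Ω ∩ W, ENNReal.ofReal (‖p - x‖ ^ (β - ((dimN n m - 1 : ℕ) : ℝ)))
        ∂(surfaceMeasure n m) < ⊤ := by
  obtain ⟨k, ρ, hρ, hev⟩ := hΓ.pieces x hx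
  have hd1 := one_le_dimN_sub_one hn hm
  have hβd : β ≤ ((dimN n m - 1 : ℕ) : ℝ) := hβ1.trans (by exact_mod_cast hd1)
  have hloc : ∀ i, ∃ W ∈ 𝓝 x, μHE[dimN n m - 1] {p ∈ W | ρ i p = 0} < ⊤ ∧
      ∫⁻ p in {p ∈ W | ρ i p = 0}, ENNReal.ofReal (‖p - x‖ ^ (β - ((dimN n m - 1 : ℕ) : ℝ)))
        ∂μHE[dimN n m - 1] < ⊤ := by
    intro i
    by_cases hi : ρ i x = 0
    · obtain ⟨h1, h2, h3, h4⟩ := exists_unit_normal_of_gradient_ne_zero (hρ i).1 (hρ i).2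
      exact exists_nhds_lintegral_hypersurface_lt_top (finrank_space_eq_add_one hn) hd1 h1 hi h2 h3
        h4 hβ hβd
    · refine ⟨{p | ρ i p ≠ 0}, (hρ i).1.continuousAt.eventually_ne hi, ?_⟩
      have : {p ∈ {p | ρ i p ≠ 0} | ρ i p = 0} = ∅ := by
        ext p; simp
      rw [this]
      simp
  choose W hW hW1 hW2 using hloc
  obtain ⟨V, hV, hxV, hVsub⟩ := mem_nhdsWithin.1 hev
  have hsub : frontier Ω ∩ (V ∩ ⋂ i, W i) ⊆ ⋃ i, {p ∈ W i | ρ i p = 0} := by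
    rintro p ⟨hp1, hp2, hp3⟩
    obtain ⟨i, hi⟩ := hVsub ⟨hp2, hp1⟩
    exact mem_iUnion.2 ⟨i, mem_iInter.1 hp3 i, hi⟩
  refine ⟨V ∩ ⋂ i, W i, inter_mem (hV.mem_nhds hxV) (iInter_mem.2 hW), ?_, ?_⟩
  · refine (measure_mono hsub).trans_lt ((measure_iUnion_le _).trans_lt ?_)
    rw [tsum_fintype]
    exact ENNReal.sum_lt_top.2 fun i _ => hW1 i
  · refine (lintegral_mono_set hsub).trans_lt ((lintegral_iUnion_le _ _).trans_lt ?_)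
    rw [tsum_fintype]
    exact ENNReal.sum_lt_top.2 fun i _ => hW2 i

theorem isCompact_frontier_of_isBounded (hΩb : Bornology.IsBounded Ω) : IsCompact (frontier Ω) :=
  Metric.isCompact_of_isClosed_isBounded isClosed_frontier
    (hΩb.closure.subset frontier_subset_closure)

theorem surfaceMeasure_frontier_lt_top (hn : 1 ≤ n) (hm : 1 ≤ m) (hΩb : Bornology.IsBounded Ω)
    (hΓ : HasPiecewiseSmoothBoundary Ω) : surfaceMeasure n m (frontier Ω) < ⊤ := by
  have hK := isCompact_frontier_of_isBounded hΩb
  refine hK.measure_lt_top_of_nhdsWithin fun x hx => ?_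
  obtain ⟨W, hW, h1, -⟩ := exists_nhds_lintegral_frontier_lt_top hn hm hΓ hx one_pos le_rfl
  exact ⟨frontier Ω ∩ W, inter_mem self_mem_nhdsWithin (nhdsWithin_le_nhds hW), h1⟩

/-- Weakly singular kernels are integrable on a piecewise smooth boundary. -/
theorem integrable_norm_sub_rpow_frontier (hn : 1 ≤ n) (hm : 1 ≤ m) (hΩb : Bornology.IsBounded Ω)
    (hΓ : HasPiecewiseSmoothBoundary Ω) {x : Space n m} (hx : x ∈ frontier Ω) {β : ℝ} (hβ : 0 < β)
    (hβ1 : β ≤ 1) :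
    Integrable (fun p => ‖p - x‖ ^ (β - ((dimN n m - 1 : ℕ) : ℝ)))
      ((surfaceMeasure n m).restrict (frontier Ω)) := by
  obtain ⟨W, hW, -, h2⟩ := exists_nhds_lintegral_frontier_lt_top hn hm hΓ hx hβ hβ1
  obtain ⟨r, hr, hball⟩ := Metric.mem_nhds_iff.1 hW
  have hmeas : Measurable fun p : Space n m => ‖p - x‖ ^ (β - ((dimN n m - 1 : ℕ) : ℝ)) := by
    fun_prop
  have hfin := surfaceMeasure_frontier_lt_top hn hm hΩb hΓ
  have h3 : IntegrableOn (fun p => ‖p - x‖ ^ (β - ((dimN n m - 1 : ℕ) : ℝ)))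
      (frontier Ω ∩ Metric.ball x r) (surfaceMeasure n m) := by
    refine ⟨hmeas.aestronglyMeasurable, ?_⟩
    rw [hasFiniteIntegral_iff_ofReal
      (Eventually.of_forall fun z => Real.rpow_nonneg (norm_nonneg _) _)]
    exact (lintegral_mono_set (inter_subset_inter_right _ hball)).trans_lt h2
  have hbd := isCompact_frontier_of_isBounded hΩb
  have h4 : IntegrableOn (fun p => ‖p - x‖ ^ (β - ((dimN n m - 1 : ℕ) : ℝ)))
      (frontier Ω \ Metric.ball x r) (surfaceMeasure n m) := by
    have hfin' : surfaceMeasure n m (frontier Ω \ Metric.ball x r) < ⊤ :=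
      (measure_mono sdiff_subset).trans_lt hfin
    refine Measure.integrableOn_of_bounded hfin'.ne hmeas.aestronglyMeasurable
      (M := r ^ (β - ((dimN n m - 1 : ℕ) : ℝ)))
      ((ae_restrict_iff' (hbd.isClosed.measurableSet.diff measurableSet_ball)).2
        (Eventually.of_forall fun p hp => ?_))
    have hp2 : r ≤ ‖p - x‖ := by
      rw [← dist_eq_norm]; exact not_lt.1 hp.2
    rw [Real.norm_of_nonneg (Real.rpow_nonneg (norm_nonneg _) _)]
    refine Real.rpow_le_rpow_of_nonpos hr hp2 (sub_nonpos.2 (hβ1.trans ?_))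
    exact_mod_cast one_le_dimN_sub_one hn hm
  rw [← IntegrableOn, ← inter_union_sdiff (frontier Ω) (Metric.ball x r)]
  exact h3.union h4

end Boundary

section Approach

variable {n m : ℕ}

/-- In a non-tangential approach region to `x`, the distance to a point `y` of `Γ` is comparable
from below with `|y - x|`: otherwise points `y` of `Γ` much closer to `x'` than to `x` would produce,
by compactness of the sphere, a ray of the tangent cone too close to `x' - x`. -/
theorem exists_mul_norm_le_of_mem_approachRegion (D Γ : Set (Space n m)) (x : Space n m) {c : ℝ}
    (hc : 0 < c) :
    ∃ δ > 0, ∀ᶠ x' in 𝓝[approachRegion D Γ x c] x, ∀ y ∈ Γ, δ * ‖y - x‖ ≤ ‖y - x'‖ := by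
  have hnear : ∃ k : ℕ, ∀ y ∈ Γ, ‖y - x‖ < 1 / ((k : ℝ) + 1) → ∀ x' ∈ approachRegion D Γ x c,
      1 / ((k : ℝ) + 1) * ‖y - x‖ ≤ ‖y - x'‖ := by
    by_contra hcon
    push Not at hcon
    choose y hy hyx x' hx' hlt using hcon
    have hyn : ∀ k, 0 < ‖y k - x‖ := by
      intro k
      have h0 : 0 < 1 / ((k : ℝ) + 1) := Nat.one_div_pos_of_nat
      by_contra h
      have h1 : ‖y k - x‖ = 0 := le_antisymm (not_lt.1 h) (norm_nonneg _)
      have := hlt k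
      rw [h1, mul_zero] at this
      exact absurd this (not_lt.2 (norm_nonneg _))
    set u : ℕ → Space n m := fun k => ‖y k - x‖⁻¹ • (y k - x) with hu
    have hus : ∀ k, u k ∈ Metric.sphere (0 : Space n m) 1 := fun k => by
      rw [mem_sphere_zero_iff_norm, hu, norm_smul, norm_inv, norm_norm,
        inv_mul_cancel₀ (hyn k).ne']
    obtain ⟨w, hw, σ, hσ, hlim⟩ := (isCompact_sphere (0 : Space n m) 1).tendsto_subseq hus
    have hinv : Tendsto (fun k : ℕ => 1 / ((k : ℝ) + 1)) atTop (𝓝 0) :=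
      tendsto_one_div_add_atTop_nhds_zero_nat
    have hy0 : Tendsto (fun k => y k - x) atTop (𝓝 0) :=
      squeeze_zero_norm (fun k => (hyx k).le) hinv
    -- limits of secant directions belong to the tangent cone, with all their multiples
    have hcone : ∀ R : ℝ, 0 ≤ R → R • w ∈ posTangentConeAt Γ x := by
      intro R hR
      refine mem_tangentConeAt_of_seq atTop
        (fun k => (⟨R * ‖y (σ k) - x‖⁻¹, by positivity⟩ : NNReal)) (fun k => y (σ k) - x)
        (hy0.comp hσ.tendsto_atTop) (Eventually.of_forall fun k => ?_) ?_
      · rw [add_sub_cancel]; exact hy _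
      · refine (hlim.const_smul R).congr fun k => ?_
        simp only [Function.comp, hu]
        rw [smul_smul]
        rfl
    have hbound : ∀ k, c * (‖y (σ k) - x‖⁻¹ * ‖x' (σ k) - x‖) ≤
        1 / ((σ k : ℝ) + 1) + ‖u (σ k) - w‖ := by
      intro k
      have h1 := (hx' (σ k)).2 _ (hcone ‖y (σ k) - x‖ (norm_nonneg _))
      have h2 : x' (σ k) - x - ‖y (σ k) - x‖ • w =
          -(y (σ k) - x' (σ k)) + ‖y (σ k) - x‖ • (u (σ k) - w) := by
        rw [smul_sub, hu]
        simp only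
        rw [smul_inv_smul₀ (hyn _).ne']
        abel
      rw [h2] at h1
      have h3 := h1.trans (norm_add_le _ _)
      rw [norm_neg, norm_smul, norm_norm] at h3
      have h4 := hlt (σ k)
      have h5 := hyn (σ k)
      rw [mul_left_comm, inv_mul_le_iff₀ h5]
      nlinarith
    have hx'lim : ∀ k, 1 - 1 / ((σ k : ℝ) + 1) ≤ ‖y (σ k) - x‖⁻¹ * ‖x' (σ k) - x‖ := by
      intro k
      have h5 := hyn (σ k)
      have h4 := hlt (σ k)
      rw [le_inv_mul_iff₀ h5]
      have h6 : ‖y (σ k) - x‖ ≤ ‖y (σ k) - x' (σ k)‖ + ‖x' (σ k) - x‖ := by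
        simpa using norm_add_le (y (σ k) - x' (σ k)) (x' (σ k) - x)
      nlinarith
    have hl1 : Tendsto (fun k => c * (1 - 1 / ((σ k : ℝ) + 1))) atTop (𝓝 (c * (1 - 0))) :=
      ((hinv.comp hσ.tendsto_atTop).const_sub 1).const_mul c
    have hl2 : Tendsto (fun k => 1 / ((σ k : ℝ) + 1) + ‖u (σ k) - w‖) atTop (𝓝 (0 + 0)) := by
      refine (hinv.comp hσ.tendsto_atTop).add ?_
      have := (hlim.sub_const w).norm
      simpa using this
    have := le_of_tendsto_of_tendsto' hl1 hl2 fun k =>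
      (mul_le_mul_of_nonneg_left (hx'lim k) hc.le).trans (hbound k)
    linarith
  obtain ⟨k, hk⟩ := hnear
  set η := 1 / ((k : ℝ) + 1) with hη
  have hη0 : 0 < η := Nat.one_div_pos_of_nat
  refine ⟨min η (1 / 2), by positivity, ?_⟩
  have hball : ∀ᶠ x' in 𝓝[approachRegion D Γ x c] x, ‖x' - x‖ < η / 2 := by
    refine nhdsWithin_le_nhds ?_
    filter_upwards [Metric.ball_mem_nhds x (half_pos hη0)] with x' hx'
    rwa [← dist_eq_norm]
  filter_upwards [hball, self_mem_nhdsWithin] with x' hx' hxD y hy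
  by_cases hyx : ‖y - x‖ < η
  · refine le_trans ?_ (hk y hy hyx x' hxD)
    gcongr
    exact min_le_left _ _
  · have h1 : ‖y - x‖ ≤ ‖y - x'‖ + ‖x' - x‖ := by simpa using norm_add_le (y - x') (x' - x)
    have h2 : min η (1 / 2) * ‖y - x‖ ≤ 1 / 2 * ‖y - x‖ := by
      gcongr; exact min_le_right _ _
    linarith [not_lt.1 hyx]

end Approach

end Hypercomplex

/-! ### Polar coordinates and the area of the unit sphere -/

namespace Hypercomplex

section Polar

variable {E : Type*} [NormedAddCommGroup E] [NormedSpace ℝ E] [MeasurableSpace E] [BorelSpace E]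
  [FiniteDimensional ℝ E]

theorem measurableEmbedding_polar : MeasurableEmbedding
    (fun p : Metric.sphere (0 : E) 1 × Ioi (0 : ℝ) => (p.2 : ℝ) • (p.1 : E)) :=
  (MeasurableEmbedding.subtype_coe (measurableSet_singleton (0 : E)).compl).comp
    (homeomorphUnitSphereProd E).symm.measurableEmbedding

variable [Nontrivial E] (μ : Measure E) [μ.IsAddHaarMeasure]

/-- Polar coordinates `(u, r) ↦ r u`. -/
theorem measurePreserving_polar : MeasurePreserving
    (fun p : Metric.sphere (0 : E) 1 × Ioi (0 : ℝ) => (p.2 : ℝ) • (p.1 : E))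
    (μ.toSphere.prod (.volumeIoiPow (Module.finrank ℝ E - 1))) μ := by
  have h1 := (μ.measurePreserving_homeomorphUnitSphereProd).symm
    (homeomorphUnitSphereProd E).toMeasurableEquiv
  have h2 : MeasurePreserving (Subtype.val : ({0}ᶜ : Set E) → E) (μ.comap (↑)) μ := by
    refine ⟨measurable_subtype_coe, ?_⟩
    rw [(MeasurableEmbedding.subtype_coe (measurableSet_singleton (0 : E)).compl).map_comap,
      Subtype.range_coe, restrict_compl_singleton]
  exact h2.comp h1

theorem integral_volumeIoiPow (k : ℕ) (f : ℝ → ℝ) :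
    ∫ r : Ioi (0 : ℝ), f r ∂(.volumeIoiPow k) = ∫ r in Ioi (0 : ℝ), r ^ k * f r := by
  simp only [Measure.volumeIoiPow, ENNReal.ofReal]
  rw [integral_withDensity_eq_integral_smul ((measurable_subtype_coe.pow_const _).real_toNNReal),
    integral_subtype_comap measurableSet_Ioi fun a => Real.toNNReal (a ^ k) • f a]
  refine setIntegral_congr_fun measurableSet_Ioi fun x hx => ?_
  rw [NNReal.smul_def, Real.coe_toNNReal _ (pow_nonneg (le_of_lt hx) _), smul_eq_mul]

theorem integral_eq_integral_sphere_ray {f : E → ℝ} (hf : Integrable f μ) :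
    ∫ x, f x ∂μ = ∫ u : Metric.sphere (0 : E) 1,
      (∫ r in Ioi (0 : ℝ), r ^ (Module.finrank ℝ E - 1) * f (r • (u : E))) ∂μ.toSphere := by
  rw [← (measurePreserving_polar μ).integral_comp measurableEmbedding_polar,
    integral_prod (fun p : Metric.sphere (0 : E) 1 × Ioi (0 : ℝ) => f ((p.2 : ℝ) • (p.1 : E)))
      ((measurePreserving_polar μ).integrable_comp_of_integrable hf)]
  refine integral_congr_ae (Eventually.of_forall fun u => ?_)
  exact integral_volumeIoiPow _ fun r => f (r • (u : E))

theorem integral_eq_integral_ray_sphere {f : E → ℝ} (hf : Integrable f μ) :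
    ∫ x, f x ∂μ = ∫ r in Ioi (0 : ℝ), r ^ (Module.finrank ℝ E - 1) *
      ∫ u : Metric.sphere (0 : E) 1, f (r • (u : E)) ∂μ.toSphere := by
  rw [← (measurePreserving_polar μ).integral_comp measurableEmbedding_polar,
    integral_prod_symm (fun p : Metric.sphere (0 : E) 1 × Ioi (0 : ℝ) =>
      f ((p.2 : ℝ) • (p.1 : E))) ((measurePreserving_polar μ).integrable_comp_of_integrable hf)]
  exact integral_volumeIoiPow _ fun r => ∫ u : Metric.sphere (0 : E) 1, f (r • (u : E)) ∂μ.toSphere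

/-- The divergence theorem for the radial field `h(x) x` on the unit ball. -/
theorem setIntegral_ball_div_radial {h : E → ℝ} (hh : ContDiff ℝ 1 h) :
    ∫ x in Metric.ball (0 : E) 1, (Module.finrank ℝ E * h x + fderiv ℝ h x x) ∂μ =
      ∫ u : Metric.sphere (0 : E) 1, h u ∂μ.toSphere := by
  have hd : 0 < Module.finrank ℝ E := Module.finrank_pos
  set k := Module.finrank ℝ E - 1 with hk
  have hdk : Module.finrank ℝ E = k + 1 := by omega
  have hcont : Continuous fun x : E => Module.finrank ℝ E * h x + fderiv ℝ h x x := by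
    have h1 := hh.continuous
    have h2 := hh.continuous_fderiv one_ne_zero
    fun_prop
  have hint : Integrable ((Metric.ball (0 : E) 1).indicator
      fun x : E => Module.finrank ℝ E * h x + fderiv ℝ h x x) μ := by
    rw [integrable_indicator_iff measurableSet_ball]
    exact (hcont.continuousOn.integrableOn_compact (isCompact_closedBall 0 1)).mono_set
      Metric.ball_subset_closedBall
  rw [← integral_indicator measurableSet_ball, integral_eq_integral_sphere_ray μ hint]
  refine integral_congr_ae (Eventually.of_forall fun u => ?_)
  have hu : ‖(u : E)‖ = 1 := by simp
  have hderiv : ∀ r : ℝ, HasDerivAt (fun r : ℝ => r ^ (k + 1) * h (r • (u : E)))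
      (((k + 1 : ℕ) * r ^ k) * h (r • (u : E)) + r ^ (k + 1) * fderiv ℝ h (r • (u : E)) u) r := by
    intro r
    have h1 : HasDerivAt (fun r : ℝ => r • (u : E)) (u : E) r := by
      simpa using (hasDerivAt_id r).smul_const (u : E)
    have h2 := ((hh.differentiable one_ne_zero) (r • (u : E))).hasFDerivAt.comp_hasDerivAt r h1
    exact (hasDerivAt_pow (k + 1) r).fun_mul h2
  have hcong : ∫ r in Ioi (0 : ℝ), r ^ k * (Metric.ball (0 : E) 1).indicator
      (fun x : E => Module.finrank ℝ E * h x + fderiv ℝ h x x) (r • (u : E)) =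
      ∫ r in (0 : ℝ)..1, (((k + 1 : ℕ) * r ^ k) * h (r • (u : E)) +
        r ^ (k + 1) * fderiv ℝ h (r • (u : E)) u) := by
    rw [intervalIntegral.integral_of_le zero_le_one, integral_Ioc_eq_integral_Ioo,
      ← integral_indicator measurableSet_Ioi, ← integral_indicator measurableSet_Ioo]
    congr 1
    ext r
    by_cases h0 : 0 < r
    · by_cases h1 : r < 1
      · have hmem : r • (u : E) ∈ Metric.ball (0 : E) 1 := by
          rw [mem_ball_zero_iff, norm_smul, hu, mul_one, Real.norm_of_nonneg h0.le]; exact h1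
        rw [indicator_of_mem (show r ∈ Ioi (0 : ℝ) from h0), indicator_of_mem hmem,
          indicator_of_mem (show r ∈ Ioo (0 : ℝ) 1 from ⟨h0, h1⟩), hdk, map_smul, smul_eq_mul]
        ring
      · have hmem : r • (u : E) ∉ Metric.ball (0 : E) 1 := by
          rw [mem_ball_zero_iff, norm_smul, hu, mul_one, Real.norm_of_nonneg h0.le]; exact h1
        rw [indicator_of_mem (show r ∈ Ioi (0 : ℝ) from h0), indicator_of_notMem hmem,
          indicator_of_notMem (fun hr => h1 hr.2), mul_zero]
    · rw [indicator_of_notMem (show r ∉ Ioi (0 : ℝ) from h0),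
        indicator_of_notMem (fun hr => h0 hr.1)]
  change ∫ r in Ioi (0 : ℝ), r ^ k * _ = h u
  rw [hcong, intervalIntegral.integral_eq_sub_of_hasDerivAt fun r _ => hderiv r]
  · simp
  · refine Continuous.intervalIntegrable ?_ _ _
    have h1 := hh.continuous
    have h2 := hh.continuous_fderiv one_ne_zero
    fun_prop

end Polar

section FiniteMeasures

variable {E : Type*} [NormedAddCommGroup E] [NormedSpace ℝ E] [MeasurableSpace E] [BorelSpace E]
  [FiniteDimensional ℝ E]

/-- Two finite measures with the same integrals of `C¹` functions agree on open sets, whose indicator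
functions are limits of smooth functions, and hence are equal. -/
theorem measure_eq_of_forall_integral_contDiff {μ ν : Measure E} [IsFiniteMeasure μ]
    [IsFiniteMeasure ν] (h : ∀ φ : E → ℝ, ContDiff ℝ 1 φ → ∫ x, φ x ∂μ = ∫ x, φ x ∂ν) :
    μ = ν := by
  refine Measure.OuterRegular.ext_isOpen fun U hU => ?_
  obtain ⟨g, hg1, hg2, hg3⟩ := hU.exists_contDiff_support_eq (n := 1)
  have key : ∀ (ξ : Measure E) [IsFiniteMeasure ξ], Tendsto (fun k : ℕ =>
      ∫ x, Real.smoothTransition (k * g x) ∂ξ) atTop (𝓝 (ξ.real U)) := by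
    intro ξ _
    rw [← integral_indicator_one hU.measurableSet]
    refine tendsto_integral_of_dominated_convergence (fun _ => (1 : ℝ)) (fun k => ?_)
      (integrable_const _) (fun k => Eventually.of_forall fun x => ?_)
      (Eventually.of_forall fun x => ?_)
    · exact (Real.smoothTransition.continuous.comp
        (continuous_const.mul hg2.continuous)).aestronglyMeasurable
    · rw [Real.norm_of_nonneg (Real.smoothTransition.nonneg _)]
      exact Real.smoothTransition.le_one _
    · by_cases hx : x ∈ U
      · have hgx : 0 < g x := by
          have h1 : g x ≠ 0 := by rw [← Function.mem_support, hg1]; exact hx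
          exact lt_of_le_of_ne (hg3 (mem_range_self x)).1 h1.symm
        rw [indicator_of_mem hx]
        refine tendsto_const_nhds.congr' ?_
        filter_upwards [(tendsto_natCast_atTop_atTop.atTop_mul_const hgx).eventually_ge_atTop
          (1 : ℝ)] with k hk
        rw [Real.smoothTransition.one_of_one_le hk]
        rfl
      · have hgx : g x = 0 := by
          by_contra h1
          exact hx (hg1 ▸ Function.mem_support.2 h1)
        rw [indicator_of_notMem hx]
        simp [hgx]
  have hcongr : (fun k : ℕ => ∫ x, Real.smoothTransition (k * g x) ∂μ) =
      fun k : ℕ => ∫ x, Real.smoothTransition (k * g x) ∂ν := by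
    ext k
    exact h _ (Real.smoothTransition.contDiff.comp (contDiff_const.mul hg2))
  have h1 := key μ
  rw [hcongr] at h1
  have h2 := tendsto_nhds_unique h1 (key ν)
  exact (measureReal_eq_measureReal_iff).1 h2

end FiniteMeasures

section Sphere

variable {n m : ℕ}

theorem gradient_norm_sq_sub_one (y : Space n m) :
    gradient (fun z : Space n m => ‖z‖ ^ 2 - 1) y = (2 : ℝ) • y := by
  refine HasGradientAt.gradient ?_
  rw [hasGradientAt_iff_hasFDerivAt]
  have h := ((hasStrictFDerivAt_norm_sq y).hasFDerivAt).sub_const (1 : ℝ)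
  refine h.congr_fderiv ?_
  ext w
  simp

theorem isOuterNormal_ball {y : Space n m} (hy : ‖y‖ = 1) :
    IsOuterNormal (Metric.ball 0 1) y y := by
  refine ⟨fun z => ‖z‖ ^ 2 - 1, ((contDiff_norm_sq ℝ).sub contDiff_const).contDiffAt, by simp [hy],
    ?_, Eventually.of_forall fun z => ?_, ?_⟩
  · rw [gradient_norm_sq_sub_one, ← norm_ne_zero_iff, norm_smul, hy]
    norm_num
  · rw [mem_ball_zero_iff, sub_neg, sq_lt_one_iff₀ (norm_nonneg z)]
  · rw [gradient_norm_sq_sub_one, norm_smul, hy, smul_smul]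
    norm_num

theorem frontier_unitBall : frontier (Metric.ball (0 : Space n m) 1) = Metric.sphere 0 1 :=
  frontier_ball 0 one_ne_zero

theorem frontier_unitBall_sdiff_regularPart :
    frontier (Metric.ball (0 : Space n m) 1) \ regularPart (Metric.ball 0 1) = ∅ := by
  refine sdiff_eq_bot_iff.2 fun y hy => ⟨hy, y, isOuterNormal_ball ?_⟩
  rw [frontier_unitBall] at hy
  simpa using hy

theorem hasPiecewiseSmoothBoundary_ball :
    HasPiecewiseSmoothBoundary (Metric.ball (0 : Space n m) 1) where
  singular_null := by rw [frontier_unitBall_sdiff_regularPart, measure_empty]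
  pieces x hx := by
    rw [frontier_unitBall] at hx ⊢
    obtain ⟨ρ, h1, -, h3, -⟩ := isOuterNormal_ball (y := x) (by simpa using hx)
    refine ⟨1, fun _ z => ‖z‖ ^ 2 - 1, fun _ =>
      ⟨((contDiff_norm_sq ℝ).sub contDiff_const).contDiffAt, ?_⟩, ?_⟩
    · have hx1 : ‖x‖ = 1 := by simpa using hx
      rw [gradient_norm_sq_sub_one, ← norm_ne_zero_iff, norm_smul, hx1]
      norm_num
    · filter_upwards [self_mem_nhdsWithin] with z hz
      have hz1 : ‖z‖ = 1 := by simpa using hz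
      exact ⟨0, by simp [hz1]⟩

/-- On the unit sphere, the surface measure is the measure of polar coordinates: both satisfy the
divergence theorem for radial fields on the ball. -/
theorem surfaceMeasure_restrict_sphere (hn : 1 ≤ n) (hm : 1 ≤ m) :
    (surfaceMeasure n m).restrict (Metric.sphere 0 1) =
      (volume : Measure (Space n m)).toSphere.map Subtype.val := by
  have : Nontrivial (Space n m) := Module.nontrivial_of_finrank_pos (R := ℝ) (by
    rw [finrank_space_eq_add_one hn]; omega)
  have hb : Bornology.IsBounded (Metric.ball (0 : Space n m) 1) := Metric.isBounded_ball
  have hfin := surfaceMeasure_frontier_lt_top hn hm hb hasPiecewiseSmoothBoundary_ball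
  have hfin' := hfin
  rw [frontier_unitBall] at hfin'
  have : IsFiniteMeasure ((surfaceMeasure n m).restrict (Metric.sphere 0 1)) :=
    isFiniteMeasure_restrict.2 hfin'.ne
  refine measure_eq_of_forall_integral_contDiff fun φ hφ => ?_
  rw [integral_map measurable_subtype_coe.aemeasurable hφ.continuous.aestronglyMeasurable,
    ← setIntegral_ball_div_radial volume hφ]
  have hgauss : ∀ i : Fin n × Fin (m + 1), ∫ x in Metric.ball (0 : Space n m) 1,
      (φ x + x i * fderiv ℝ φ x (EuclideanSpace.single i 1)) =
      ∫ x in Metric.sphere (0 : Space n m) 1, (φ x * x i) * x i ∂(surfaceMeasure n m) := by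
    intro i
    have hφi : ContDiff ℝ 1 fun x : Space n m => φ x * x i := by fun_prop
    have h1 := setIntegral_fderiv_eq_integral_frontier hn Metric.isOpen_ball hb
      hasPiecewiseSmoothBoundary_ball.singular_null hfin (EuclideanSpace.single i 1) hφi
    rw [frontier_unitBall] at h1
    have h2 : ∀ x : Space n m, fderiv ℝ (fun x : Space n m => φ x * x i) x
        (EuclideanSpace.single i 1) = φ x + x i * fderiv ℝ φ x (EuclideanSpace.single i 1) := by
      intro x
      have h3 : HasFDerivAt (fun x : Space n m => x i)
          (EuclideanSpace.proj i : Space n m →L[ℝ] ℝ) x :=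
        (EuclideanSpace.proj i : Space n m →L[ℝ] ℝ).hasFDerivAt
      rw [((hφ.differentiable one_ne_zero x).hasFDerivAt.fun_mul h3 : HasFDerivAt
        (fun x : Space n m => φ x * x i) _ x).fderiv]
      simp
    simp only [h2] at h1
    rw [h1]
    refine setIntegral_congr_fun Metric.isClosed_sphere.measurableSet fun x hx => ?_
    have hx1 : ‖x‖ = 1 := by simpa using hx
    simp only
    rw [(isOuterNormal_ball hx1).outerNormal_eq, EuclideanSpace.inner_single_right]
    simp
  have hsum1 : ∀ x : Space n m, Module.finrank ℝ (Space n m) * φ x + fderiv ℝ φ x x =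
      ∑ i, (φ x + x i * fderiv ℝ φ x (EuclideanSpace.single i 1)) := by
    intro x
    rw [Finset.sum_add_distrib, Finset.sum_const, Finset.card_univ, nsmul_eq_mul,
      finrank_euclideanSpace]
    congr 1
    have h1 := congrArg (fderiv ℝ φ x)
      ((EuclideanSpace.basisFun (Fin n × Fin (m + 1)) ℝ).sum_repr x)
    simp only [map_sum, map_smul, smul_eq_mul, EuclideanSpace.basisFun_repr,
      EuclideanSpace.basisFun_apply] at h1
    exact h1.symm
  simp only [hsum1]
  rw [integral_finsetSum]
  · simp only [hgauss]
    rw [← integral_finsetSum]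
    · refine setIntegral_congr_fun Metric.isClosed_sphere.measurableSet fun x hx => ?_
      have hx1 : ‖x‖ = 1 := by simpa using hx
      simp only [mul_assoc, ← pow_two]
      rw [← Finset.mul_sum, ← EuclideanSpace.real_norm_sq_eq, hx1, one_pow, mul_one]
    · intro i _
      have h1 : Continuous fun x : Space n m => φ x * x i * x i := by
        have := hφ.continuous
        fun_prop
      exact h1.continuousOn.integrableOn_of_subset_isCompact (isCompact_sphere 0 1)
        Metric.isClosed_sphere.measurableSet subset_rfl hfin'.ne
  · intro i _
    have hc : Continuous fun x : Space n m =>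
        φ x + x i * fderiv ℝ φ x (EuclideanSpace.single i 1) := by
      have h1 := hφ.continuous
      have h2 := hφ.continuous_fderiv one_ne_zero
      fun_prop
    exact (hc.continuousOn.integrableOn_compact (isCompact_closedBall 0 1)).mono_set
      Metric.ball_subset_closedBall

end Sphere

end Hypercomplex

/-! ### The solid angle of the tangent cone -/

namespace Hypercomplex

variable {n m : ℕ}

theorem nontrivial_space (hn : 1 ≤ n) : Nontrivial (Space n m) :=
  Module.nontrivial_of_finrank_pos (R := ℝ) (by rw [finrank_space_eq_add_one hn]; omega)

/-- The directions `u` for which `x + r u` belongs to `Ω`. -/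
def sphereSection (Ω : Set (Space n m)) (x : Space n m) (r : ℝ) :
    Set (Metric.sphere (0 : Space n m) 1) :=
  {u | x + r • (u : Space n m) ∈ Ω}

theorem isOpen_sphereSection {Ω : Set (Space n m)} (hΩ : IsOpen Ω) (x : Space n m) (r : ℝ) :
    IsOpen (sphereSection Ω x r) :=
  hΩ.preimage (f := fun u : Metric.sphere (0 : Space n m) 1 => x + r • (u : Space n m))
    (by fun_prop)

theorem sphereArea_eq (hn : 1 ≤ n) (hm : 1 ≤ m) :
    sphereArea n m = (volume : Measure (Space n m)).toSphere.real univ := by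
  have h := congrArg (fun μ : Measure (Space n m) => μ.real univ)
    (surfaceMeasure_restrict_sphere hn hm)
  rw [sphereArea, ← measureReal_restrict_apply_univ]
  refine h.trans ?_
  rw [map_measureReal_apply measurable_subtype_coe MeasurableSet.univ, preimage_univ]

theorem sphereArea_pos (hn : 1 ≤ n) (hm : 1 ≤ m) : 0 < sphereArea n m := by
  have := nontrivial_space (m := m) hn
  rw [sphereArea_eq hn hm]
  have : NeZero (volume : Measure (Space n m)).toSphere := ⟨Measure.toSphere_ne_zero _⟩
  exact measureReal_univ_pos

open scoped Pointwise in
/-- The area of `Ω` in a sphere, by translation and scaling to the unit sphere. -/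
theorem surfaceMeasure_sphere_inter (hn : 1 ≤ n) (hm : 1 ≤ m) {Ω : Set (Space n m)}
    (hΩ : IsOpen Ω) (x : Space n m) {r : ℝ} (hr : 0 < r) :
    (surfaceMeasure n m).real (Metric.sphere x r ∩ Ω) = r ^ (dimN n m - 1) *
      (volume : Measure (Space n m)).toSphere.real (sphereSection Ω x r) := by
  set B : Set (Space n m) := {y | x + r • y ∈ Ω} with hB
  have hBo : IsOpen B := hΩ.preimage (f := fun y : Space n m => x + r • y) (by fun_prop)
  have h1 : Metric.sphere x r ∩ Ω = (fun y => x + y) '' (r • (Metric.sphere 0 1 ∩ B)) := by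
    ext y
    constructor
    · rintro ⟨hy1, hy2⟩
      refine ⟨y - x, mem_smul_set.2 ⟨r⁻¹ • (y - x), ⟨?_, ?_⟩, ?_⟩, add_sub_cancel x y⟩
      · have : ‖y - x‖ = r := by rwa [← dist_eq_norm]
        rw [mem_sphere_zero_iff_norm, norm_smul, norm_inv, Real.norm_of_nonneg hr.le, this,
          inv_mul_cancel₀ hr.ne']
      · rw [hB, mem_ofPred_eq, smul_inv_smul₀ hr.ne', add_sub_cancel]
        exact hy2
      · rw [smul_inv_smul₀ hr.ne']
    · rintro ⟨_, ⟨u, ⟨hu1, hu2⟩, rfl⟩, rfl⟩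
      refine ⟨?_, hu2⟩
      have : ‖u‖ = 1 := by simpa using hu1
      simp [norm_smul, this, abs_of_pos hr]
  have h2 := congrArg (fun μ : Measure (Space n m) => μ B) (surfaceMeasure_restrict_sphere hn hm)
  beta_reduce at h2
  rw [Measure.restrict_apply hBo.measurableSet,
    Measure.map_apply measurable_subtype_coe hBo.measurableSet] at h2
  have h3 : surfaceMeasure n m (Metric.sphere x r ∩ Ω) =
      ‖r‖₊ ^ (dimN n m - 1) • surfaceMeasure n m (B ∩ Metric.sphere 0 1) := by
    rw [h1, inter_comm B, surfaceMeasure, (isometry_add_left x).euclideanHausdorffMeasure_image,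
      Measure.euclideanHausdorffMeasure_smul₀ _ hr.ne']
  rw [measureReal_def, h3, h2, ENNReal.smul_def, smul_eq_mul, ENNReal.toReal_mul]
  congr 1
  simp [abs_of_pos hr]

/-- Off finitely many hyperplanes of directions, the rays issuing from a boundary point do not meet
the boundary again near that point. -/
theorem HasPiecewiseSmoothBoundary.exists_ray_free {Ω : Set (Space n m)}
    (hΓ : HasPiecewiseSmoothBoundary Ω) {x : Space n m} (hx : x ∈ frontier Ω) :
    ∃ (k : ℕ) (e : Fin k → Space n m), (∀ i, e i ≠ 0) ∧ ∀ w, (∀ i, inner ℝ (e i) w ≠ 0) →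
      ∀ᶠ r : ℝ in 𝓝[>] 0, x + r • w ∉ frontier Ω := by
  obtain ⟨k, ρ, hρ, hev⟩ := hΓ.pieces x hx
  refine ⟨k, fun i => gradient (ρ i) x, fun i => (hρ i).2, fun w hw => ?_⟩
  have hne : ∀ i, ∀ᶠ r : ℝ in 𝓝[>] 0, ρ i (x + r • w) ≠ 0 := by
    intro i
    by_cases hi : ρ i x = 0
    · have h1 := tendsto_div_along_ray ((hρ i).1.differentiableAt one_ne_zero).hasFDerivAt hi w
      have h2 : fderiv ℝ (ρ i) x w ≠ 0 := by rw [← inner_gradient_left]; exact hw i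
      filter_upwards [h1.eventually_ne h2] with r hr h0
      rw [h0, zero_div] at hr
      exact hr rfl
    · exact (tendsto_ray x w).eventually ((hρ i).1.continuousAt.eventually_ne hi)
  filter_upwards [eventually_all.2 hne,
    (tendsto_ray x w).eventually (eventually_nhdsWithin_iff.1 hev)] with r h1 h2 h3
  obtain ⟨i, hi⟩ := h2 h3
  exact h1 i hi

theorem toSphere_hyperplane {e : Space n m} (he : e ≠ 0) :
    (volume : Measure (Space n m)).toSphere {u | inner ℝ e (u : Space n m) = 0} = 0 := by
  have hmeas : MeasurableSet {u : Metric.sphere (0 : Space n m) 1 |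
      inner ℝ e (u : Space n m) = 0} :=
    (isClosed_eq (by fun_prop) continuous_const).measurableSet
  rw [Measure.toSphere_apply' _ hmeas]
  refine mul_eq_zero_of_right _ (measure_mono_null (t := ((ℝ ∙ e)ᗮ : Submodule ℝ (Space n m)))
    ?_ (Measure.addHaar_submodule _ _ ?_))
  · rintro _ ⟨t, ht, _, ⟨u, hu, rfl⟩, rfl⟩
    rw [SetLike.mem_coe, Submodule.mem_orthogonal_singleton_iff_inner_right, real_inner_smul_right]
    rw [show inner ℝ e (u : Space n m) = 0 from hu, mul_zero]
  · intro htop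
    have h1 : e ∈ (ℝ ∙ e)ᗮ := by rw [htop]; trivial
    rw [Submodule.mem_orthogonal_singleton_iff_inner_right, inner_self_eq_zero] at h1
    exact he h1

/-- Along almost every ray issuing from a boundary point, belonging to `Ω` is eventually constant,
because a segment missing the boundary cannot leave `Ω`. -/
theorem ae_eventually_sphereSection_const {Ω : Set (Space n m)} (hΩ : IsOpen Ω)
    (hΓ : HasPiecewiseSmoothBoundary Ω) {x : Space n m} (hx : x ∈ frontier Ω) :
    ∀ᵐ u : Metric.sphere (0 : Space n m) 1 ∂(volume : Measure (Space n m)).toSphere,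
      (∀ᶠ r : ℝ in 𝓝[>] 0, u ∈ sphereSection Ω x r) ∨
        ∀ᶠ r : ℝ in 𝓝[>] 0, u ∉ sphereSection Ω x r := by
  obtain ⟨k, e, he, hray⟩ := hΓ.exists_ray_free hx
  have hae : ∀ᵐ u : Metric.sphere (0 : Space n m) 1 ∂(volume : Measure (Space n m)).toSphere,
      ∀ i, inner ℝ (e i) (u : Space n m) ≠ 0 := by
    refine ae_all_iff.2 fun i => ?_
    rw [ae_iff]
    simpa using toSphere_hyperplane (he i)
  filter_upwards [hae] with u hu
  obtain ⟨δ, hδ, hfree⟩ := mem_nhdsGT_iff_exists_Ioo_subset.1 (hray u hu)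
  have hδ0 : (0 : ℝ) < δ := hδ
  set J : Set (Space n m) := (fun r : ℝ => x + r • (u : Space n m)) '' Ioo 0 δ with hJ
  have hJc : IsPreconnected J := isPreconnected_Ioo.image _ (by fun_prop)
  have hJf : J ∩ frontier Ω = ∅ := by
    rw [eq_empty_iff_forall_notMem]
    rintro _ ⟨⟨r, hr, rfl⟩, h⟩
    exact hfree hr h
  have hIoo : ∀ᶠ r : ℝ in 𝓝[>] 0, r ∈ Ioo 0 δ := Ioo_mem_nhdsGT hδ0
  by_cases hmeet : (J ∩ Ω).Nonempty
  · left
    have hsub : J ⊆ Ω := by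
      by_contra hnot
      have hcov : J ⊆ Ω ∪ (closure Ω)ᶜ := by
        intro y hy
        by_contra hy'
        rw [mem_union, not_or, notMem_compl_iff] at hy'
        exact eq_empty_iff_forall_notMem.1 hJf y ⟨hy, hΩ.frontier_eq ▸ ⟨hy'.2, hy'.1⟩⟩
      obtain ⟨y, hy1, hy2⟩ := not_subset.1 hnot
      obtain ⟨z, -, hz1, hz2⟩ := hJc Ω (closure Ω)ᶜ hΩ isClosed_closure.isOpen_compl hcov hmeet
        ⟨y, hy1, (hcov hy1).resolve_left hy2⟩
      exact hz2 (subset_closure hz1)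
    filter_upwards [hIoo] with r hr
    exact hsub ⟨r, hr, rfl⟩
  · right
    filter_upwards [hIoo] with r hr hmem
    exact hmeet ⟨_, ⟨r, hr, rfl⟩, hmem⟩

/-- The measure of directions pointing into `Ω` converges as the radius tends to `0`. -/
theorem exists_tendsto_sphereSection (hn : 1 ≤ n) {Ω : Set (Space n m)} (hΩ : IsOpen Ω)
    (hΓ : HasPiecewiseSmoothBoundary Ω) {x : Space n m} (hx : x ∈ frontier Ω) :
    ∃ a : ℝ, Tendsto (fun r : ℝ =>
      (volume : Measure (Space n m)).toSphere.real (sphereSection Ω x r)) (𝓝[>] 0) (𝓝 a) := by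
  have := nontrivial_space (m := m) hn
  set D : Set (Metric.sphere (0 : Space n m) 1) :=
    {u | ∀ᶠ r : ℝ in 𝓝[>] 0, u ∈ sphereSection Ω x r} with hD
  refine ⟨∫ u, D.indicator 1 u ∂(volume : Measure (Space n m)).toSphere, ?_⟩
  have h1 : ∀ r, (volume : Measure (Space n m)).toSphere.real (sphereSection Ω x r) =
      ∫ u, (sphereSection Ω x r).indicator 1 u ∂(volume : Measure (Space n m)).toSphere :=
    fun r => (integral_indicator_one (isOpen_sphereSection hΩ x r).measurableSet).symm
  simp only [h1]
  refine tendsto_integral_filter_of_dominated_convergence (fun _ => (1 : ℝ))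
    (Eventually.of_forall fun r => ?_) (Eventually.of_forall fun r => Eventually.of_forall
      fun u => ?_) (integrable_const _) ?_
  · exact (measurable_one.indicator (isOpen_sphereSection hΩ x r).measurableSet).aestronglyMeasurable
  · refine (norm_indicator_le_norm_self _ _).trans ?_
    simp
  · filter_upwards [ae_eventually_sphereSection_const hΩ hΓ hx] with u hu
    by_cases huD : u ∈ D
    · rw [indicator_of_mem huD]
      refine tendsto_const_nhds.congr' ?_
      filter_upwards [huD] with r hr
      rw [indicator_of_mem hr]
    · rw [indicator_of_notMem huD]
      refine tendsto_const_nhds.congr' ?_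
      filter_upwards [hu.resolve_left huD] with r hr
      rw [indicator_of_notMem hr]

/-- Existence of the solid angle, together with the limit in polar coordinates that determines it. -/
theorem exists_hasSolidAngle (hn : 1 ≤ n) (hm : 1 ≤ m) {Ω : Set (Space n m)} (hΩ : IsOpen Ω)
    (hΓ : HasPiecewiseSmoothBoundary Ω) {x : Space n m} (hx : x ∈ frontier Ω) :
    ∃ τ : ℝ, HasSolidAngle Ω x τ ∧ Tendsto (fun r : ℝ =>
      (volume : Measure (Space n m)).toSphere.real (sphereSection Ω x r)) (𝓝[>] 0)
      (𝓝 (sphereArea n m * τ)) := by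
  obtain ⟨a, ha⟩ := exists_tendsto_sphereSection hn hΩ hΓ hx
  have hpos := sphereArea_pos hn hm
  refine ⟨a / sphereArea n m, ?_, by rwa [mul_div_cancel₀ _ hpos.ne']⟩
  refine (ha.div_const (sphereArea n m)).congr' ?_
  filter_upwards [self_mem_nhdsWithin] with r hr
  have hr0 : 0 < r := hr
  have h1 := surfaceMeasure_sphere_inter hn hm isOpen_univ x hr0
  have h2 : sphereSection (univ : Set (Space n m)) x r = univ := by ext; simp [sphereSection]
  rw [inter_univ, h2, ← sphereArea_eq hn hm] at h1
  rw [surfaceMeasure_sphere_inter hn hm hΩ x hr0, h1, mul_div_mul_left _ _ (by positivity)]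

/-- Polar coordinates centred at `x`: the integral over `Ω` of a radial function. -/
theorem setIntegral_norm_sub_eq (hn : 1 ≤ n) {Ω : Set (Space n m)} (hΩ : IsOpen Ω) (x : Space n m)
    {ψ : ℝ → ℝ} (hψ : IntegrableOn (fun y => ψ ‖y - x‖) Ω) :
    ∫ y in Ω, ψ ‖y - x‖ = ∫ r in Ioi (0 : ℝ), r ^ (dimN n m - 1) * (ψ r *
      (volume : Measure (Space n m)).toSphere.real (sphereSection Ω x r)) := by
  have := nontrivial_space (m := m) hn
  rw [← integral_indicator hΩ.measurableSet]
  rw [← integrable_indicator_iff hΩ.measurableSet] at hψ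
  have hψ2 := hψ.comp_add_left x
  rw [← integral_add_left_eq_self _ x, integral_eq_integral_ray_sphere volume hψ2, finrank_space]
  refine setIntegral_congr_fun measurableSet_Ioi fun r hr => ?_
  have hr0 : 0 < r := hr
  beta_reduce
  congr 1
  rw [← integral_indicator_one (isOpen_sphereSection hΩ x r).measurableSet, ← integral_const_mul]
  refine integral_congr_ae (Eventually.of_forall fun u => ?_)
  have hu : ‖(u : Space n m)‖ = 1 := by simp
  by_cases h : u ∈ sphereSection Ω x r
  · have h' : x + r • (u : Space n m) ∈ Ω := h
    simp [indicator_of_mem h, indicator_of_mem h', norm_smul, hu, abs_of_pos hr0]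
  · have h' : x + r • (u : Space n m) ∉ Ω := h
    simp [indicator_of_notMem h, indicator_of_notMem h']

end Hypercomplex

/-! ### Surface integrals of the Bochner–Martinelli kernel -/

namespace Hypercomplex

section Cutoff

/-- A monotone `C¹` function on the line that vanishes up to `a` and is equal to `1` from `b` on. -/
structure IsMonotoneCutoff (θ : ℝ → ℝ) (a b : ℝ) : Prop where
  contDiff : ContDiff ℝ 1 θ
  monotone : Monotone θ
  eq_zero : ∀ t ≤ a, θ t = 0
  eq_one : ∀ t, b ≤ t → θ t = 1

variable {θ : ℝ → ℝ} {a b : ℝ}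

theorem IsMonotoneCutoff.nonneg (h : IsMonotoneCutoff θ a b) (t : ℝ) : 0 ≤ θ t := by
  rw [← h.eq_zero (min t a) (min_le_right _ _)]
  exact h.monotone (min_le_left _ _)

theorem IsMonotoneCutoff.le_one (h : IsMonotoneCutoff θ a b) (t : ℝ) : θ t ≤ 1 := by
  rw [← h.eq_one (max t b) (le_max_right _ _)]
  exact h.monotone (le_max_left _ _)

theorem IsMonotoneCutoff.deriv_of_lt (h : IsMonotoneCutoff θ a b) {t : ℝ} (ht : t < a) :
    deriv θ t = 0 := by
  have : θ =ᶠ[𝓝 t] fun _ => 0 := by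
    filter_upwards [Iio_mem_nhds ht] with s hs
    exact h.eq_zero s (le_of_lt hs)
  rw [this.deriv_eq, deriv_const]

theorem IsMonotoneCutoff.deriv_of_gt (h : IsMonotoneCutoff θ a b) {t : ℝ} (ht : b < t) :
    deriv θ t = 0 := by
  have : θ =ᶠ[𝓝 t] fun _ => 1 := by
    filter_upwards [Ioi_mem_nhds ht] with s hs
    exact h.eq_one s (le_of_lt hs)
  rw [this.deriv_eq, deriv_const]

/-- Monotone cutoffs, vanishing near `0`, that increase to the indicator function of `[b, ∞)`. -/
theorem exists_seq_isMonotoneCutoff {b : ℝ} (hb : 0 < b) :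
    ∃ θ : ℕ → ℝ → ℝ, (∀ k, IsMonotoneCutoff (θ k) (b / 2) b) ∧
      ∀ t, Tendsto (fun k => θ k t) atTop (𝓝 ((Ici b).indicator 1 t)) := by
  refine ⟨fun k t => Real.smoothTransition (1 + ((k : ℝ) + 2) * (t / b - 1)), fun k => ?_,
    fun t => ?_⟩
  · refine ⟨Real.smoothTransition.contDiff.comp (by fun_prop), fun s t hst => ?_, fun t ht => ?_,
      fun t ht => ?_⟩
    · refine Real.smoothTransition.monotone ?_
      gcongr
    · refine Real.smoothTransition.zero_of_nonpos ?_
      have h1 : t / b ≤ 1 / 2 := by rw [div_le_iff₀ hb]; linarith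
      have h2 : (0 : ℝ) ≤ k := Nat.cast_nonneg k
      nlinarith
    · refine Real.smoothTransition.one_of_one_le ?_
      have h1 : 1 ≤ t / b := by rwa [one_le_div hb]
      have h2 : (0 : ℝ) ≤ k := Nat.cast_nonneg k
      nlinarith
  · by_cases ht : b ≤ t
    · rw [indicator_of_mem (show t ∈ Ici b from ht)]
      refine tendsto_const_nhds.congr fun k => ?_
      have h1 : 1 ≤ t / b := by rwa [one_le_div hb]
      have h2 : (0 : ℝ) ≤ k := Nat.cast_nonneg k
      exact (Real.smoothTransition.one_of_one_le (by nlinarith)).symm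
    · rw [indicator_of_notMem (show t ∉ Ici b from ht)]
      have h1 : t / b - 1 < 0 := by
        rw [sub_neg, div_lt_one hb]; exact not_le.1 ht
      have h2 : Tendsto (fun k : ℕ => 1 + ((k : ℝ) + 2) * (t / b - 1)) atTop atBot :=
        tendsto_atBot_add_const_left _ _ ((tendsto_atTop_add_const_right _ _
          tendsto_natCast_atTop_atTop).atTop_mul_const_of_neg h1)
      refine tendsto_const_nhds.congr' ?_
      filter_upwards [h2.eventually_le_atBot 0] with k hk
      exact (Real.smoothTransition.zero_of_nonpos hk).symm

theorem IsMonotoneCutoff.hasDerivAt_sq (h : IsMonotoneCutoff θ a b) (r : ℝ) :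
    HasDerivAt (fun r => θ (r ^ 2)) (2 * r * deriv θ (r ^ 2)) r := by
  have h1 := (h.contDiff.differentiable one_ne_zero (r ^ 2)).hasDerivAt
  have h2 : HasDerivAt (fun r : ℝ => θ (r ^ 2)) _ r :=
    HasDerivAt.comp r (h₂ := θ) (h := fun r : ℝ => r ^ 2) h1 (hasDerivAt_pow 2 r)
  refine h2.congr_deriv ?_
  norm_num
  ring

theorem IsMonotoneCutoff.deriv_sq_nonneg (h : IsMonotoneCutoff θ a b) {r : ℝ} (hr : 0 < r) :
    0 ≤ 2 * r * deriv θ (r ^ 2) :=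
  mul_nonneg (mul_nonneg zero_le_two hr.le) h.monotone.deriv_nonneg

theorem IsMonotoneCutoff.tendsto_sq (h : IsMonotoneCutoff θ a b) :
    Tendsto (fun r : ℝ => θ (r ^ 2)) atTop (𝓝 1) := by
  refine tendsto_const_nhds.congr' ?_
  filter_upwards [(tendsto_pow_atTop two_ne_zero).eventually_ge_atTop b] with r hr
  exact (h.eq_one _ hr).symm

theorem IsMonotoneCutoff.integrableOn_deriv_sq (h : IsMonotoneCutoff θ a b) :
    IntegrableOn (fun r => 2 * r * deriv θ (r ^ 2)) (Ioi 0) :=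
  integrableOn_Ioi_deriv_of_nonneg' (fun r _ => h.hasDerivAt_sq r)
    (fun _ hr => h.deriv_sq_nonneg hr) h.tendsto_sq

/-- An average of `g` against the derivative of a cutoff is close to `c` when `g` is. -/
theorem IsMonotoneCutoff.abs_integral_sub_le (h : IsMonotoneCutoff θ a (b ^ 2)) (ha : 0 < a)
    (hb : 0 < b) {g : ℝ → ℝ} {c δ : ℝ}
    (hint : IntegrableOn (fun r => 2 * r * deriv θ (r ^ 2) * g r) (Ioi 0))
    (hg : ∀ r ∈ Ioc 0 b, |g r - c| ≤ δ) :
    |(∫ r in Ioi (0 : ℝ), 2 * r * deriv θ (r ^ 2) * g r) - c| ≤ δ := by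
  have hnn : ∀ r ∈ Ioi (0 : ℝ), 0 ≤ 2 * r * deriv θ (r ^ 2) := fun _ hr => h.deriv_sq_nonneg hr
  have hpint := h.integrableOn_deriv_sq
  have hp1 : ∫ r in Ioi (0 : ℝ), 2 * r * deriv θ (r ^ 2) = 1 := by
    rw [integral_Ioi_of_hasDerivAt_of_tendsto' (fun r _ => h.hasDerivAt_sq r) hpint
      h.tendsto_sq, h.eq_zero _ (by
      simpa using ha.le), sub_zero]
  have h1 : (∫ r in Ioi (0 : ℝ), 2 * r * deriv θ (r ^ 2) * g r) - c =
      ∫ r in Ioi (0 : ℝ), 2 * r * deriv θ (r ^ 2) * (g r - c) := by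
    simp only [mul_sub]
    rw [integral_sub hint (hpint.mul_const c), integral_mul_const, hp1, one_mul]
  rw [h1, ← Real.norm_eq_abs]
  calc ‖∫ r in Ioi (0 : ℝ), 2 * r * deriv θ (r ^ 2) * (g r - c)‖
      ≤ ∫ r in Ioi (0 : ℝ), 2 * r * deriv θ (r ^ 2) * δ := by
        refine norm_integral_le_of_norm_le (hpint.mul_const δ) ?_
        refine (ae_restrict_mem measurableSet_Ioi).mono fun r hr => ?_
        rw [norm_mul, Real.norm_of_nonneg (hnn r hr)]
        by_cases hrb : r ≤ b
        · exact mul_le_mul_of_nonneg_left (hg r ⟨hr, hrb⟩) (hnn r hr)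
        · rw [h.deriv_of_gt (by have := not_le.1 hrb; gcongr)]
          simp
    _ = δ := by rw [integral_mul_const, hp1, one_mul]

/-- The function `t ↦ θ(t) t ^ (-N/2)`. -/
noncomputable def radialFactor (N : ℕ) (θ : ℝ → ℝ) (t : ℝ) : ℝ := θ t * (√t ^ N)⁻¹

theorem contDiff_radialFactor (N : ℕ) (h : IsMonotoneCutoff θ a b) (ha : 0 < a) :
    ContDiff ℝ 1 (radialFactor N θ) := by
  rw [contDiff_iff_contDiffAt]
  intro t
  rcases lt_or_ge t a with ht | ht
  · refine contDiffAt_const (c := (0 : ℝ)) |>.congr_of_eventuallyEq ?_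
    filter_upwards [Iio_mem_nhds ht] with s hs
    rw [radialFactor, h.eq_zero s (le_of_lt hs), zero_mul]
  · have ht0 : 0 < t := ha.trans_le ht
    exact h.contDiff.contDiffAt.mul (((contDiffAt_id.sqrt ht0.ne').pow N).inv
      (pow_ne_zero _ (Real.sqrt_pos.2 ht0).ne'))

/-- The divergence of the field `z ↦ q(|z|²) z`, where `q` is the radial factor of `θ`, only involves
the derivative of `θ`. -/
theorem deriv_radialFactor {N : ℕ} (hN : 1 ≤ N) (h : IsMonotoneCutoff θ a b) (ha : 0 < a) (t : ℝ) :
    2 * deriv (radialFactor N θ) t * t + N * radialFactor N θ t =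
      2 * deriv θ t * (t * (√t ^ N)⁻¹) := by
  obtain ⟨k, rfl⟩ : ∃ k, N = k + 1 := ⟨N - 1, by omega⟩
  rcases lt_or_ge t a with ht | ht
  · have h1 : radialFactor (k + 1) θ =ᶠ[𝓝 t] fun _ => 0 := by
      filter_upwards [Iio_mem_nhds ht] with s hs
      rw [radialFactor, h.eq_zero s (le_of_lt hs), zero_mul]
    rw [h1.deriv_eq, deriv_const, h1.self_of_nhds, h.deriv_of_lt ht]
    simp
  · have ht0 : 0 < t := ha.trans_le ht
    have hs : 0 < √t := Real.sqrt_pos.2 ht0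
    have h1 := (h.contDiff.differentiable one_ne_zero t).hasDerivAt
    have h2 := (((Real.hasDerivAt_sqrt ht0.ne').fun_pow (k + 1)).fun_inv
      (pow_ne_zero _ hs.ne'))
    have h3 := h1.fun_mul h2
    have h4 : deriv (radialFactor (k + 1) θ) t = _ := h3.deriv
    rw [h4, radialFactor]
    have h5 : t = √t ^ 2 := (Real.sq_sqrt ht0.le).symm
    set s := √t
    rw [h5]
    push_cast
    field_simp
    ring

end Cutoff

section Kernel

variable {n m : ℕ} {Ω : Set (Space n m)} {θ : ℝ → ℝ} {a b : ℝ}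

theorem radialFactor_norm_sq (N : ℕ) (θ : ℝ → ℝ) (z : Space n m) :
    radialFactor N θ (‖z‖ ^ 2) = θ (‖z‖ ^ 2) * (‖z‖ ^ N)⁻¹ := by
  rw [radialFactor, Real.sqrt_sq (norm_nonneg z)]

theorem contDiff_radialFactor_mul_coord (N : ℕ) (h : IsMonotoneCutoff θ a b) (ha : 0 < a)
    (x : Space n m) (i : Fin n × Fin (m + 1)) :
    ContDiff ℝ 1 fun y : Space n m => radialFactor N θ (‖y - x‖ ^ 2) * (y - x) i := by
  have h1 : ContDiff ℝ 1 fun y : Space n m => radialFactor N θ (‖y - x‖ ^ 2) :=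
    (contDiff_radialFactor N h ha).comp ((contDiff_id.sub contDiff_const).norm_sq ℝ)
  have h2 : ContDiff ℝ 1 fun y : Space n m => (y - x) i := by
    simp only [PiLp.sub_apply]
    fun_prop
  exact h1.mul h2

theorem fderiv_radialFactor_mul_coord (N : ℕ) (h : IsMonotoneCutoff θ a b) (ha : 0 < a)
    (x y : Space n m) (i i' : Fin n × Fin (m + 1)) :
    fderiv ℝ (fun y : Space n m => radialFactor N θ (‖y - x‖ ^ 2) * (y - x) i) y
      (EuclideanSpace.single i' 1) =
      2 * deriv (radialFactor N θ) (‖y - x‖ ^ 2) * ((y - x) i * (y - x) i') +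
        radialFactor N θ (‖y - x‖ ^ 2) * (if i = i' then 1 else 0) := by
  have h0 : HasFDerivAt (fun y : Space n m => y - x) (ContinuousLinearMap.id ℝ _) y :=
    (hasFDerivAt_id y).sub_const x
  have h1 : HasFDerivAt (fun y : Space n m => ‖y - x‖ ^ 2) _ y := h0.norm_sq
  have h2 := ((contDiff_radialFactor N h ha).differentiable one_ne_zero
    (‖y - x‖ ^ 2)).hasDerivAt.comp_hasFDerivAt y h1
  have h3 : HasFDerivAt (fun y : Space n m => (y - x) i) _ y :=
    (EuclideanSpace.proj i : Space n m →L[ℝ] ℝ).hasFDerivAt.comp y h0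
  have h4 : HasFDerivAt (fun y : Space n m => radialFactor N θ (‖y - x‖ ^ 2) * (y - x) i) _ y :=
    h2.fun_mul h3
  rw [h4.fderiv]
  simp [EuclideanSpace.inner_single_right]
  ring

/-- The scalar kernel `∑ Bᵢᵢ' zᵢ νᵢ' / |z|ᴺ`, for a normal vector `ν` and a real matrix `B`; it has
the value `0` at `z = 0`. -/
noncomputable def contractedKernel (B : Fin n × Fin (m + 1) → Fin n × Fin (m + 1) → ℝ) (z ν : Space n m) : ℝ :=
  ∑ i, ∑ i', B i i' * ((‖z‖ ^ dimN n m)⁻¹ * z i * ν i')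

/-- The pairing of a matrix having symmetric part `c δ` with the symmetric matrix `p z zᵀ + q δ`. -/
theorem sum_sum_mul_of_symm {ι : Type*} [Fintype ι] [DecidableEq ι] {B : ι → ι → ℝ} {c : ℝ}
    (hB : ∀ i i', B i i' + B i' i = if i = i' then 2 * c else 0) (z : ι → ℝ) (p q : ℝ) :
    ∑ i, ∑ i', B i i' * (p * (z i * z i') + q * (if i = i' then 1 else 0)) =
      c * (p * ∑ i, z i ^ 2 + Fintype.card ι * q) := by
  have h1 : ∑ i, ∑ i', B i i' * (z i * z i') = c * ∑ i, z i ^ 2 := by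
    have h2 : ∑ i, ∑ i', B i i' * (z i * z i') = ∑ i, ∑ i', B i' i * (z i * z i') := by
      rw [Finset.sum_comm]
      simp only [mul_comm (z _) (z _)]
    have h3 : ∑ i, ∑ i', (B i i' + B i' i) * (z i * z i') = 2 * (c * ∑ i, z i ^ 2) := by
      simp only [hB, ite_mul, zero_mul, Finset.sum_ite_eq, Finset.mem_univ, if_true,
        Finset.mul_sum]
      exact Finset.sum_congr rfl fun i _ => by ring
    simp only [add_mul, Finset.sum_add_distrib] at h3
    linarith
  have h4 : ∀ i, B i i = c := fun i => by
    have := hB i i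
    rw [if_pos rfl] at this
    linarith
  have h5 : ∀ i i', B i i' * (p * (z i * z i') + q * (if i = i' then 1 else 0)) =
      p * (B i i' * (z i * z i')) + if i = i' then B i i' * q else 0 := by
    intro i i'
    split_ifs <;> ring
  simp only [h5, Finset.sum_add_distrib, Finset.sum_ite_eq, Finset.mem_univ, if_true, h4,
    ← Finset.mul_sum, Finset.sum_const, Finset.card_univ, nsmul_eq_mul, h1]
  ring

theorem abs_contractedKernel_le (B : Fin n × Fin (m + 1) → Fin n × Fin (m + 1) → ℝ)
    (z ν : Space n m) :
    |contractedKernel B z ν| ≤ (∑ i, ∑ i', |B i i'|) * ((‖z‖ ^ (dimN n m - 1))⁻¹ * ‖ν‖) := by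
  have hz : ∀ i, (‖z‖ ^ dimN n m)⁻¹ * |z i| ≤ (‖z‖ ^ (dimN n m - 1))⁻¹ := by
    intro i
    by_cases h0 : z = 0
    · subst h0
      simp
    · have h1 : 0 < ‖z‖ := norm_pos_iff.2 h0
      have h2 : 0 < dimN n m := Nat.mul_pos (Nat.succ_pos m) (lt_of_le_of_lt (Nat.zero_le _) i.1.2)
      obtain ⟨k, hk⟩ : ∃ k, dimN n m = k + 1 := ⟨dimN n m - 1, by omega⟩
      rw [hk, Nat.add_sub_cancel]
      calc (‖z‖ ^ (k + 1))⁻¹ * |z i| ≤ (‖z‖ ^ (k + 1))⁻¹ * ‖z‖ := by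
            gcongr; exact PiLp.norm_apply_le z i
        _ = (‖z‖ ^ k)⁻¹ := by
            field_simp
            ring
  rw [contractedKernel]
  refine (Finset.abs_sum_le_sum_abs _ _).trans ?_
  rw [Finset.sum_mul]
  refine Finset.sum_le_sum fun i _ => (Finset.abs_sum_le_sum_abs _ _).trans ?_
  rw [Finset.sum_mul]
  refine Finset.sum_le_sum fun i' _ => ?_
  rw [abs_mul, abs_mul, abs_mul, abs_of_nonneg (by positivity : 0 ≤ (‖z‖ ^ dimN n m)⁻¹)]
  gcongr
  · exact hz i
  · exact PiLp.norm_apply_le ν i'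

theorem aestronglyMeasurable_contractedKernel (hΩ : IsOpen Ω)
    (hsing : surfaceMeasure n m (frontier Ω \ regularPart Ω) = 0)
    (B : Fin n × Fin (m + 1) → Fin n × Fin (m + 1) → ℝ) (x : Space n m) :
    AEStronglyMeasurable (fun y => contractedKernel B (y - x) (outerNormal Ω y))
      ((surfaceMeasure n m).restrict (frontier Ω)) := by
  have hν : ∀ i, AEStronglyMeasurable (fun y => outerNormal Ω y i)
      ((surfaceMeasure n m).restrict (frontier Ω)) := fun i =>
    (EuclideanSpace.proj i : Space n m →L[ℝ] ℝ).continuous.comp_aestronglyMeasurable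
      (aestronglyMeasurable_outerNormal hΩ hsing)
  unfold contractedKernel
  refine Finset.aestronglyMeasurable_fun_sum _ fun i _ =>
    Finset.aestronglyMeasurable_fun_sum _ fun i' _ => ?_
  refine AEStronglyMeasurable.const_mul (AEStronglyMeasurable.mul ?_ (hν i')) _
  have : Measurable fun y : Space n m => (‖y - x‖ ^ dimN n m)⁻¹ * (y - x) i := by
    have h1 : Measurable fun y : Space n m => (y - x) i :=
      ((EuclideanSpace.proj i : Space n m →L[ℝ] ℝ).continuous.comp
        (continuous_id.sub continuous_const)).measurable
    fun_prop
  exact this.aestronglyMeasurable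

theorem measurable_sphereSection (hn : 1 ≤ n) (hΩ : IsOpen Ω) (x : Space n m) :
    Measurable fun r : ℝ =>
      (volume : Measure (Space n m)).toSphere.real (sphereSection Ω x r) := by
  have := nontrivial_space (m := m) hn
  have h1 : MeasurableSet {p : ℝ × Metric.sphere (0 : Space n m) 1 |
      x + p.1 • (p.2 : Space n m) ∈ Ω} :=
    (hΩ.preimage (f := fun p : ℝ × Metric.sphere (0 : Space n m) 1 => x + p.1 • (p.2 : Space n m))
      (by fun_prop)).measurableSet
  exact (measurable_measure_prodMk_left h1).ennreal_toReal

/-- The divergence theorem for the truncated kernel.  The truncated fields have symmetric Jacobian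
matrices, so that only the symmetric part `c δ` of `B` contributes, through the divergence. -/
theorem setIntegral_cutoff_mul_contractedKernel (hn : 1 ≤ n) (hΩ : IsOpen Ω)
    (hΩb : Bornology.IsBounded Ω)
    (hsing : surfaceMeasure n m (frontier Ω \ regularPart Ω) = 0)
    (hfin : surfaceMeasure n m (frontier Ω) < ⊤)
    {B : Fin n × Fin (m + 1) → Fin n × Fin (m + 1) → ℝ} {c : ℝ}
    (hB : ∀ i i', B i i' + B i' i = if i = i' then 2 * c else 0)
    (h : IsMonotoneCutoff θ a b) (ha : 0 < a) (x : Space n m) :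
    ∫ y in frontier Ω, θ (‖y - x‖ ^ 2) * contractedKernel B (y - x) (outerNormal Ω y)
      ∂(surfaceMeasure n m) =
      c * ∫ y in Ω, 2 * deriv θ (‖y - x‖ ^ 2) * (‖y - x‖ ^ 2 * (‖y - x‖ ^ dimN n m)⁻¹) := by
  set N := dimN n m with hN
  have hN1 : 1 ≤ N := Nat.mul_pos (Nat.succ_pos m) hn
  set φ : Fin n × Fin (m + 1) → Space n m → ℝ :=
    fun i y => radialFactor N θ (‖y - x‖ ^ 2) * (y - x) i with hφdef
  have hφ : ∀ i, ContDiff ℝ 1 (φ i) := contDiff_radialFactor_mul_coord N h ha x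
  have hK := isCompact_frontier_of_isBounded hΩb
  have hφint : ∀ i, Integrable (φ i) ((surfaceMeasure n m).restrict (frontier Ω)) := fun i =>
    (hφ i).continuous.continuousOn.integrableOn_of_subset_isCompact hK hK.measurableSet subset_rfl
      hfin.ne
  have hint1 : ∀ i i', Integrable (fun y => B i i' * (φ i y *
      inner ℝ (outerNormal Ω y) (EuclideanSpace.single i' 1)))
      ((surfaceMeasure n m).restrict (frontier Ω)) := fun i i' =>
    (integrable_mul_inner_outerNormal hΩ hsing (hφint i) _).const_mul _
  have hint2 : ∀ i i', IntegrableOn (fun y => B i i' *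
      fderiv ℝ (φ i) y (EuclideanSpace.single i' 1)) Ω := fun i i' => by
    have hc : Continuous fun y => B i i' * fderiv ℝ (φ i) y (EuclideanSpace.single i' 1) := by
      have := (hφ i).continuous_fderiv one_ne_zero
      fun_prop
    exact (hc.continuousOn.integrableOn_compact hΩb.isCompact_closure).mono_set subset_closure
  calc ∫ y in frontier Ω, θ (‖y - x‖ ^ 2) * contractedKernel B (y - x) (outerNormal Ω y)
        ∂(surfaceMeasure n m)
      = ∫ y in frontier Ω, ∑ i, ∑ i', B i i' * (φ i y *
          inner ℝ (outerNormal Ω y) (EuclideanSpace.single i' 1)) ∂(surfaceMeasure n m) := by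
        refine integral_congr_ae (Eventually.of_forall fun y => ?_)
        simp only [contractedKernel, Finset.mul_sum, hφdef, radialFactor_norm_sq,
          EuclideanSpace.inner_single_right]
        refine Finset.sum_congr rfl fun i _ => Finset.sum_congr rfl fun i' _ => ?_
        simp
        ring
    _ = ∑ i, ∑ i', B i i' * ∫ y in Ω, fderiv ℝ (φ i) y (EuclideanSpace.single i' 1) := by
        rw [integral_finsetSum _ fun i _ => integrable_finsetSum _ fun i' _ => hint1 i i']
        refine Finset.sum_congr rfl fun i _ => ?_
        rw [integral_finsetSum _ fun i' _ => hint1 i i']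
        refine Finset.sum_congr rfl fun i' _ => ?_
        rw [integral_const_mul,
          setIntegral_fderiv_eq_integral_frontier hn hΩ hΩb hsing hfin _ (hφ i)]
    _ = ∫ y in Ω, ∑ i, ∑ i', B i i' * fderiv ℝ (φ i) y (EuclideanSpace.single i' 1) := by
        rw [integral_finsetSum _ fun i _ => integrable_finsetSum _ fun i' _ => hint2 i i']
        refine Finset.sum_congr rfl fun i _ => ?_
        rw [integral_finsetSum _ fun i' _ => hint2 i i']
        refine Finset.sum_congr rfl fun i' _ => ?_
        rw [integral_const_mul]
    _ = _ := by
        rw [← integral_const_mul]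
        refine integral_congr_ae (Eventually.of_forall fun y => ?_)
        simp only [hφdef, fderiv_radialFactor_mul_coord N h ha x y]
        rw [sum_sum_mul_of_symm hB (fun i => (y - x) i), ← EuclideanSpace.real_norm_sq_eq,
          ← finrank_euclideanSpace (𝕜 := ℝ), finrank_space, deriv_radialFactor hN1 h ha,
          Real.sqrt_sq (norm_nonneg _)]

/-- In polar coordinates, the integral of the truncated kernel is `c` times an average of the measures
of the sphere sections of radius at most `ε`. -/
theorem abs_setIntegral_cutoff_mul_sub_le (hn : 1 ≤ n) (hΩ : IsOpen Ω)
    (hΩb : Bornology.IsBounded Ω)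
    (hsing : surfaceMeasure n m (frontier Ω \ regularPart Ω) = 0)
    (hfin : surfaceMeasure n m (frontier Ω) < ⊤)
    {B : Fin n × Fin (m + 1) → Fin n × Fin (m + 1) → ℝ} {c : ℝ}
    (hB : ∀ i i', B i i' + B i' i = if i = i' then 2 * c else 0)
    {ε : ℝ} (hε : 0 < ε) (h : IsMonotoneCutoff θ a (ε ^ 2)) (ha : 0 < a) (x : Space n m)
    {g₀ δ : ℝ} (hg : ∀ r ∈ Ioc 0 ε, |(volume : Measure (Space n m)).toSphere.real
      (sphereSection Ω x r) - g₀| ≤ δ) :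
    |(∫ y in frontier Ω, θ (‖y - x‖ ^ 2) * contractedKernel B (y - x) (outerNormal Ω y)
      ∂(surfaceMeasure n m)) - c * g₀| ≤ |c| * δ := by
  have := nontrivial_space (m := m) hn
  have hN1 : 1 ≤ dimN n m := Nat.mul_pos (Nat.succ_pos m) hn
  have hψint : IntegrableOn (fun y : Space n m =>
      2 * deriv θ (‖y - x‖ ^ 2) * (‖y - x‖ ^ 2 * (‖y - x‖ ^ dimN n m)⁻¹)) Ω := by
    have hc : Continuous fun t : ℝ => 2 * deriv θ t * (t * (√t ^ dimN n m)⁻¹) := by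
      have h1 := contDiff_radialFactor (dimN n m) h ha
      have h2 := h1.continuous
      have h3 := h1.continuous_deriv le_rfl
      simp only [← deriv_radialFactor hN1 h ha]
      fun_prop
    have hc2 : Continuous fun y : Space n m =>
        2 * deriv θ (‖y - x‖ ^ 2) * (‖y - x‖ ^ 2 * (‖y - x‖ ^ dimN n m)⁻¹) := by
      have h4 := hc.comp (f := fun y : Space n m => ‖y - x‖ ^ 2) (by fun_prop)
      refine h4.congr fun y => ?_
      simp only [Function.comp, Real.sqrt_sq (norm_nonneg _)]
    exact (hc2.continuousOn.integrableOn_compact hΩb.isCompact_closure).mono_set subset_closure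
  rw [setIntegral_cutoff_mul_contractedKernel hn hΩ hΩb hsing hfin hB h ha x, ← mul_sub, abs_mul]
  refine mul_le_mul_of_nonneg_left ?_ (abs_nonneg c)
  rw [setIntegral_norm_sub_eq hn hΩ x
    (ψ := fun r => 2 * deriv θ (r ^ 2) * (r ^ 2 * (r ^ dimN n m)⁻¹)) hψint]
  have hcongr : ∀ r ∈ Ioi (0 : ℝ), r ^ (dimN n m - 1) *
      (2 * deriv θ (r ^ 2) * (r ^ 2 * (r ^ dimN n m)⁻¹) *
        (volume : Measure (Space n m)).toSphere.real (sphereSection Ω x r)) =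
      2 * r * deriv θ (r ^ 2) *
        (volume : Measure (Space n m)).toSphere.real (sphereSection Ω x r) := by
    intro r hr
    have hr0 : r ≠ 0 := ne_of_gt hr
    obtain ⟨k, hk⟩ : ∃ k, dimN n m = k + 1 := ⟨dimN n m - 1, by omega⟩
    rw [hk, Nat.add_sub_cancel]
    field_simp
    ring
  rw [setIntegral_congr_fun measurableSet_Ioi hcongr]
  refine h.abs_integral_sub_le ha hε ?_ hg
  refine h.integrableOn_deriv_sq.mul_bdd
    (c := (volume : Measure (Space n m)).toSphere.real univ)
    (measurable_sphereSection hn hΩ x).aestronglyMeasurable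
    (Eventually.of_forall fun r => ?_)
  rw [Real.norm_of_nonneg measureReal_nonneg]
  exact measureReal_mono (subset_univ _)

theorem norm_contractedKernel_outerNormal_le
    (B : Fin n × Fin (m + 1) → Fin n × Fin (m + 1) → ℝ) (x y : Space n m) {r : ℝ} (hr : 0 < r)
    (hy : r ≤ ‖y - x‖) : ‖contractedKernel B (y - x) (outerNormal Ω y)‖ ≤
      (∑ i, ∑ i', |B i i'|) * (r ^ (dimN n m - 1))⁻¹ := by
  refine (abs_contractedKernel_le B _ _).trans ?_
  refine mul_le_mul_of_nonneg_left ?_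
    (Finset.sum_nonneg fun i _ => Finset.sum_nonneg fun i' _ => abs_nonneg _)
  calc (‖y - x‖ ^ (dimN n m - 1))⁻¹ * ‖outerNormal Ω y‖ ≤ (r ^ (dimN n m - 1))⁻¹ * 1 := by
        gcongr
        exact norm_outerNormal_le_one _ _
    _ = _ := mul_one _

/-- The truncated integrals of the kernel are close to `c g₀` when the measures of the sphere
sections of small radius are close to `g₀`. -/
theorem abs_setIntegral_contractedKernel_sub_le (hn : 1 ≤ n) (hΩ : IsOpen Ω)
    (hΩb : Bornology.IsBounded Ω)
    (hsing : surfaceMeasure n m (frontier Ω \ regularPart Ω) = 0)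
    (hfin : surfaceMeasure n m (frontier Ω) < ⊤)
    {B : Fin n × Fin (m + 1) → Fin n × Fin (m + 1) → ℝ} {c : ℝ}
    (hB : ∀ i i', B i i' + B i' i = if i = i' then 2 * c else 0)
    {ε : ℝ} (hε : 0 < ε) (x : Space n m)
    {g₀ δ : ℝ} (hg : ∀ r ∈ Ioc 0 ε, |(volume : Measure (Space n m)).toSphere.real
      (sphereSection Ω x r) - g₀| ≤ δ) :
    |(∫ y in frontier Ω \ Metric.ball x ε, contractedKernel B (y - x) (outerNormal Ω y)
      ∂(surfaceMeasure n m)) - c * g₀| ≤ |c| * δ := by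
  have hε2 : 0 < ε ^ 2 := by positivity
  obtain ⟨θ, hθ, hlim⟩ := exists_seq_isMonotoneCutoff hε2
  have : IsFiniteMeasure ((surfaceMeasure n m).restrict (frontier Ω)) :=
    isFiniteMeasure_restrict.2 hfin.ne
  have hmeas := aestronglyMeasurable_contractedKernel hΩ hsing B x
  have hT : Tendsto (fun k => ∫ y in frontier Ω, θ k (‖y - x‖ ^ 2) *
      contractedKernel B (y - x) (outerNormal Ω y) ∂(surfaceMeasure n m)) atTop
      (𝓝 (∫ y in frontier Ω, (Metric.ball x ε)ᶜ.indicator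
        (fun y => contractedKernel B (y - x) (outerNormal Ω y)) y ∂(surfaceMeasure n m))) := by
    refine tendsto_integral_of_dominated_convergence
      (fun _ => (∑ i, ∑ i', |B i i'|) * ((ε / 2) ^ (dimN n m - 1))⁻¹) (fun k => ?_)
      (integrable_const _) (fun k => Eventually.of_forall fun y => ?_)
      (Eventually.of_forall fun y => ?_)
    · have h1 : Continuous fun y : Space n m => θ k (‖y - x‖ ^ 2) :=
        (hθ k).contDiff.continuous.comp (by fun_prop)
      exact h1.aestronglyMeasurable.mul hmeas
    · by_cases hy : ε / 2 ≤ ‖y - x‖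
      · rw [norm_mul, Real.norm_of_nonneg ((hθ k).nonneg _)]
        calc θ k (‖y - x‖ ^ 2) * ‖contractedKernel B (y - x) (outerNormal Ω y)‖
            ≤ 1 * ‖contractedKernel B (y - x) (outerNormal Ω y)‖ := by
              gcongr; exact (hθ k).le_one _
          _ ≤ _ := by
              rw [one_mul]
              exact norm_contractedKernel_outerNormal_le B x y (half_pos hε) hy
      · have h1 : ‖y - x‖ ^ 2 ≤ ε ^ 2 / 2 := by
          have h2 := not_le.1 hy
          have h3 := norm_nonneg (y - x)
          nlinarith
        rw [(hθ k).eq_zero _ h1, zero_mul, norm_zero]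
        have : 0 ≤ ∑ i, ∑ i', |B i i'| :=
          Finset.sum_nonneg fun i _ => Finset.sum_nonneg fun i' _ => abs_nonneg _
        positivity
    · have h1 := (hlim (‖y - x‖ ^ 2)).mul_const
        (contractedKernel B (y - x) (outerNormal Ω y))
      convert h1 using 2
      by_cases hy : ε ≤ ‖y - x‖
      · have h2 : y ∈ (Metric.ball x ε)ᶜ := by
          rw [mem_compl_iff, Metric.mem_ball, dist_eq_norm]; exact not_lt.2 hy
        have h3 : ‖y - x‖ ^ 2 ∈ Ici (ε ^ 2) := by
          rw [mem_Ici]; gcongr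
        rw [indicator_of_mem h2, indicator_of_mem h3, Pi.one_apply, one_mul]
      · have h2 : y ∉ (Metric.ball x ε)ᶜ := by
          rw [notMem_compl_iff, Metric.mem_ball, dist_eq_norm]; exact not_le.1 hy
        have h3 : ‖y - x‖ ^ 2 ∉ Ici (ε ^ 2) := by
          rw [mem_Ici, not_le]
          have := not_le.1 hy
          gcongr
        rw [indicator_of_notMem h2, indicator_of_notMem h3, zero_mul]
  rw [setIntegral_indicator measurableSet_ball.compl, ← sdiff_eq] at hT
  refine le_of_tendsto (hT.sub_const (c * g₀)).abs (Eventually.of_forall fun k => ?_)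
  exact abs_setIntegral_cutoff_mul_sub_le hn hΩ hΩb hsing hfin hB hε (hθ k) (half_pos hε2) x hg

end Kernel

end Hypercomplex

/-! ### Boundary behaviour of the scalar kernels -/

namespace Hypercomplex

section TotalIntegral

variable {n m : ℕ} {Ω : Set (Space n m)}

theorem frontier_sdiff_ball_eq_self {x : Space n m} {ε : ℝ}
    (h : Disjoint (Metric.ball x ε) (frontier Ω)) : frontier Ω \ Metric.ball x ε = frontier Ω :=
  sdiff_eq_left.2 h.symm

theorem exists_ball_disjoint_frontier {x : Space n m} (hx : x ∉ frontier Ω) :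
    ∃ ε > 0, Disjoint (Metric.ball x ε) (frontier Ω) := by
  obtain ⟨ε, hε, hsub⟩ := Metric.isOpen_iff.1 isClosed_frontier.isOpen_compl x hx
  exact ⟨ε, hε, disjoint_left.2 fun y hy => hsub hy⟩

/-- For `x` in `Ω`, small spheres around `x` are contained in `Ω`. -/
theorem setIntegral_contractedKernel_of_mem (hn : 1 ≤ n) (hm : 1 ≤ m) (hΩ : IsOpen Ω)
    (hΩb : Bornology.IsBounded Ω) (hΓ : HasPiecewiseSmoothBoundary Ω)
    {B : Fin n × Fin (m + 1) → Fin n × Fin (m + 1) → ℝ} {c : ℝ}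
    (hB : ∀ i i', B i i' + B i' i = if i = i' then 2 * c else 0) {x : Space n m} (hx : x ∈ Ω) :
    ∫ y in frontier Ω, contractedKernel B (y - x) (outerNormal Ω y) ∂(surfaceMeasure n m) =
      c * sphereArea n m := by
  obtain ⟨ε, hε, hsub⟩ := Metric.nhds_basis_closedBall.mem_iff.1 (hΩ.mem_nhds hx)
  have hdisj : Disjoint (Metric.ball x ε) (frontier Ω) := by
    rw [hΩ.frontier_eq]
    exact disjoint_sdiff_right.mono_left (Metric.ball_subset_closedBall.trans hsub)
  have h1 := abs_setIntegral_contractedKernel_sub_le hn hΩ hΩb hΓ.singular_null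
    (surfaceMeasure_frontier_lt_top hn hm hΩb hΓ) hB hε x (g₀ := sphereArea n m) (δ := 0)
    fun r hr => by
      have h2 : sphereSection Ω x r = univ := eq_univ_of_forall fun u => hsub (by
        simp [norm_smul, abs_of_pos hr.1, hr.2])
      rw [h2, sphereArea_eq hn hm, sub_self, abs_zero]
  rw [frontier_sdiff_ball_eq_self hdisj, mul_zero] at h1
  exact sub_eq_zero.1 (abs_eq_zero.1 (le_antisymm h1 (abs_nonneg _)))

/-- For `x` outside the closure of `Ω`, small spheres around `x` do not meet `Ω`. -/
theorem setIntegral_contractedKernel_of_notMem_closure (hn : 1 ≤ n) (hm : 1 ≤ m) (hΩ : IsOpen Ω)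
    (hΩb : Bornology.IsBounded Ω) (hΓ : HasPiecewiseSmoothBoundary Ω)
    {B : Fin n × Fin (m + 1) → Fin n × Fin (m + 1) → ℝ} {c : ℝ}
    (hB : ∀ i i', B i i' + B i' i = if i = i' then 2 * c else 0) {x : Space n m}
    (hx : x ∈ (closure Ω)ᶜ) :
    ∫ y in frontier Ω, contractedKernel B (y - x) (outerNormal Ω y) ∂(surfaceMeasure n m) = 0 := by
  obtain ⟨ε, hε, hsub⟩ := Metric.nhds_basis_closedBall.mem_iff.1
    (isClosed_closure.isOpen_compl.mem_nhds hx)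
  have hdisj : Disjoint (Metric.ball x ε) (frontier Ω) :=
    (disjoint_compl_left (a := closure Ω)).mono (Metric.ball_subset_closedBall.trans hsub)
      frontier_subset_closure
  have h1 := abs_setIntegral_contractedKernel_sub_le hn hΩ hΩb hΓ.singular_null
    (surfaceMeasure_frontier_lt_top hn hm hΩb hΓ) hB hε x (g₀ := 0) (δ := 0)
    fun r hr => by
      have h2 : sphereSection Ω x r = ∅ := eq_empty_of_forall_notMem fun u hu => hsub (show
        x + r • (u : Space n m) ∈ _ by simp [norm_smul, abs_of_pos hr.1, hr.2])
        (subset_closure hu)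
      rw [h2, measureReal_empty, sub_self, abs_zero]
  rw [frontier_sdiff_ball_eq_self hdisj, mul_zero, mul_zero, sub_zero] at h1
  exact abs_eq_zero.1 (le_antisymm h1 (abs_nonneg _))

theorem tendsto_setIntegral_contractedKernel (hn : 1 ≤ n) (hm : 1 ≤ m) (hΩ : IsOpen Ω)
    (hΩb : Bornology.IsBounded Ω) (hΓ : HasPiecewiseSmoothBoundary Ω)
    {B : Fin n × Fin (m + 1) → Fin n × Fin (m + 1) → ℝ} {c : ℝ}
    (hB : ∀ i i', B i i' + B i' i = if i = i' then 2 * c else 0) {x : Space n m} {g₀ : ℝ}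
    (hg : Tendsto (fun r : ℝ => (volume : Measure (Space n m)).toSphere.real (sphereSection Ω x r))
      (𝓝[>] 0) (𝓝 g₀)) :
    Tendsto (fun ε : ℝ => ∫ y in frontier Ω \ Metric.ball x ε,
      contractedKernel B (y - x) (outerNormal Ω y) ∂(surfaceMeasure n m)) (𝓝[>] 0)
      (𝓝 (c * g₀)) := by
  rw [Metric.tendsto_nhds]
  intro η hη
  have hδ : 0 < η / (|c| + 1) := by positivity
  obtain ⟨r₀, hr₀, hr⟩ := mem_nhdsGT_iff_exists_Ioo_subset.1 (Metric.tendsto_nhds.1 hg _ hδ)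
  filter_upwards [Ioo_mem_nhdsGT (show (0 : ℝ) < r₀ from hr₀)] with ε hε
  have h1 := abs_setIntegral_contractedKernel_sub_le hn hΩ hΩb hΓ.singular_null
    (surfaceMeasure_frontier_lt_top hn hm hΩb hΓ) hB hε.1 x (g₀ := g₀) (δ := η / (|c| + 1))
    fun r hr' => by
      have := hr ⟨hr'.1, hr'.2.trans_lt hε.2⟩
      exact (le_of_lt this)
  rw [Real.dist_eq]
  refine h1.trans_lt ?_
  rw [mul_div_assoc', div_lt_iff₀ (by positivity)]
  nlinarith [abs_nonneg c]

end TotalIntegral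

section Densities

variable {n m : ℕ} {Ω : Set (Space n m)}
  {B : Fin n × Fin (m + 1) → Fin n × Fin (m + 1) → ℝ} {φ : Space n m → ℝ} {C α : ℝ}

theorem continuousOn_of_holder {E : Set (Space n m)} (hα : 0 < α)
    (hφ : ∀ y ∈ E, ∀ y' ∈ E, |φ y - φ y'| ≤ C * ‖y - y'‖ ^ α) : ContinuousOn φ E := by
  intro x hx
  rw [ContinuousWithinAt, tendsto_iff_norm_sub_tendsto_zero]
  have h1 : Tendsto (fun y : Space n m => C * ‖y - x‖ ^ α) (𝓝[E] x) (𝓝 0) := by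
    have h2 : Continuous fun y : Space n m => C * ‖y - x‖ ^ α := by
      have := Real.continuous_rpow_const hα.le
      fun_prop (disch := exact fun _ => Or.inr hα.le)
    have h3 := (h2.tendsto x).mono_left (nhdsWithin_le_nhds (s := E))
    simpa [Real.zero_rpow hα.ne'] using h3
  refine squeeze_zero' (Eventually.of_forall fun _ => norm_nonneg _) ?_ h1
  filter_upwards [self_mem_nhdsWithin] with y hy
  exact hφ y hy x hx

theorem integrableOn_contractedKernel_mul (hΩ : IsOpen Ω)
    (hsing : surfaceMeasure n m (frontier Ω \ regularPart Ω) = 0)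
    (hφ : IntegrableOn φ (frontier Ω) (surfaceMeasure n m)) (x : Space n m) {ε : ℝ} (hε : 0 < ε) :
    IntegrableOn (fun y => contractedKernel B (y - x) (outerNormal Ω y) * φ y)
      (frontier Ω \ Metric.ball x ε) (surfaceMeasure n m) := by
  refine (hφ.mono_set sdiff_subset).bdd_mul
    (c := (∑ i, ∑ i', |B i i'|) * (ε ^ (dimN n m - 1))⁻¹)
    ((aestronglyMeasurable_contractedKernel hΩ hsing B x).mono_set sdiff_subset) ?_
  refine (ae_restrict_iff' (isClosed_frontier.measurableSet.diff measurableSet_ball)).2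
    (Eventually.of_forall fun y hy => ?_)
  refine norm_contractedKernel_outerNormal_le B x y hε ?_
  rw [← dist_eq_norm]
  exact not_lt.1 hy.2

/-- The Hölder condition turns the kernel into a weakly singular one. -/
theorem norm_contractedKernel_mul_sub_le {x x' y : Space n m} {δ : ℝ} (hδ : 0 < δ)
    (hC : 0 ≤ C) (hφ : |φ y - φ x| ≤ C * ‖y - x‖ ^ α) (hxy : δ * ‖y - x‖ ≤ ‖y - x'‖) :
    ‖contractedKernel B (y - x') (outerNormal Ω y) * (φ y - φ x)‖ ≤
      (∑ i, ∑ i', |B i i'|) * (δ ^ (dimN n m - 1))⁻¹ * C *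
        ‖y - x‖ ^ (α - ((dimN n m - 1 : ℕ) : ℝ)) := by
  have hS : 0 ≤ ∑ i, ∑ i', |B i i'| :=
    Finset.sum_nonneg fun i _ => Finset.sum_nonneg fun i' _ => abs_nonneg _
  by_cases h0 : y = x
  · subst h0
    rw [sub_self (φ y), mul_zero, norm_zero]
    positivity
  · have h1 : 0 < ‖y - x‖ := norm_pos_iff.2 (sub_ne_zero.2 h0)
    rw [norm_mul, Real.norm_eq_abs (φ y - φ x)]
    calc ‖contractedKernel B (y - x') (outerNormal Ω y)‖ * |φ y - φ x|
        ≤ ((∑ i, ∑ i', |B i i'|) * ((δ * ‖y - x‖) ^ (dimN n m - 1))⁻¹) * (C * ‖y - x‖ ^ α) := by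
          gcongr
          exact norm_contractedKernel_outerNormal_le B x' y (by positivity) hxy
      _ = _ := by
          rw [Real.rpow_sub h1, Real.rpow_natCast, mul_pow, mul_inv]
          ring

theorem continuousAt_contractedKernel {x y ν : Space n m} (hxy : y ≠ x) :
    ContinuousAt (fun x' => contractedKernel B (y - x') ν) x := by
  have h1 : ‖y - x‖ ^ dimN n m ≠ 0 := pow_ne_zero _ (norm_ne_zero_iff.2 (sub_ne_zero.2 hxy))
  have h2 : ContinuousAt (fun x' : Space n m => (‖y - x'‖ ^ dimN n m)⁻¹) x :=
    ContinuousAt.inv₀ (by fun_prop) h1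
  have h3 : ∀ i, ContinuousAt (fun x' : Space n m => (y - x') i) x := fun i => by
    simp only [PiLp.sub_apply]
    fun_prop
  unfold contractedKernel
  fun_prop

theorem integrableOn_frontier_of_holder (hn : 1 ≤ n) (hm : 1 ≤ m) (hΩb : Bornology.IsBounded Ω)
    (hΓ : HasPiecewiseSmoothBoundary Ω) (hα : 0 < α)
    (hφ : ∀ y ∈ frontier Ω, ∀ y' ∈ frontier Ω, |φ y - φ y'| ≤ C * ‖y - y'‖ ^ α) :
    IntegrableOn φ (frontier Ω) (surfaceMeasure n m) := by
  have hK := isCompact_frontier_of_isBounded hΩb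
  exact (continuousOn_of_holder hα hφ).integrableOn_of_subset_isCompact hK hK.measurableSet
    subset_rfl (surfaceMeasure_frontier_lt_top hn hm hΩb hΓ).ne

theorem aestronglyMeasurable_contractedKernel_mul_sub (hn : 1 ≤ n) (hm : 1 ≤ m) (hΩ : IsOpen Ω)
    (hΩb : Bornology.IsBounded Ω) (hΓ : HasPiecewiseSmoothBoundary Ω) (hα : 0 < α)
    (hφ : ∀ y ∈ frontier Ω, ∀ y' ∈ frontier Ω, |φ y - φ y'| ≤ C * ‖y - y'‖ ^ α)
    (x x' : Space n m) : AEStronglyMeasurable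
      (fun y => contractedKernel B (y - x') (outerNormal Ω y) * (φ y - φ x))
      ((surfaceMeasure n m).restrict (frontier Ω)) :=
  (aestronglyMeasurable_contractedKernel hΩ hΓ.singular_null B x').mul
    ((integrableOn_frontier_of_holder hn hm hΩb hΓ hα hφ).aestronglyMeasurable.sub
      aestronglyMeasurable_const)

theorem integrable_contractedKernel_mul_sub (hn : 1 ≤ n) (hm : 1 ≤ m) (hΩ : IsOpen Ω)
    (hΩb : Bornology.IsBounded Ω) (hΓ : HasPiecewiseSmoothBoundary Ω) (hα : 0 < α) (hα1 : α ≤ 1)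
    (hC : 0 ≤ C) (hφ : ∀ y ∈ frontier Ω, ∀ y' ∈ frontier Ω, |φ y - φ y'| ≤ C * ‖y - y'‖ ^ α)
    {x : Space n m} (hx : x ∈ frontier Ω) :
    Integrable (fun y => contractedKernel B (y - x) (outerNormal Ω y) * (φ y - φ x))
      ((surfaceMeasure n m).restrict (frontier Ω)) := by
  refine ((integrable_norm_sub_rpow_frontier hn hm hΩb hΓ hx hα hα1).const_mul
    ((∑ i, ∑ i', |B i i'|) * (1 ^ (dimN n m - 1))⁻¹ * C)).mono'
    (aestronglyMeasurable_contractedKernel_mul_sub hn hm hΩ hΩb hΓ hα hφ x x) ?_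
  refine (ae_restrict_iff' isClosed_frontier.measurableSet).2 (Eventually.of_forall fun y hy => ?_)
  exact norm_contractedKernel_mul_sub_le one_pos hC (hφ y hy x hx) (by rw [one_mul])

/-- The principal value at a boundary point: the oscillation `φ - φ(x)` gives an absolutely
convergent integral, and the constant `φ(x)` the solid angle. -/
theorem tendsto_truncated_contractedKernel_mul (hn : 1 ≤ n) (hm : 1 ≤ m) (hΩ : IsOpen Ω)
    (hΩb : Bornology.IsBounded Ω) (hΓ : HasPiecewiseSmoothBoundary Ω) {c : ℝ}
    (hB : ∀ i i', B i i' + B i' i = if i = i' then 2 * c else 0) (hα : 0 < α) (hα1 : α ≤ 1)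
    (hC : 0 ≤ C) (hφ : ∀ y ∈ frontier Ω, ∀ y' ∈ frontier Ω, |φ y - φ y'| ≤ C * ‖y - y'‖ ^ α)
    {x : Space n m} (hx : x ∈ frontier Ω) {g₀ : ℝ}
    (hg : Tendsto (fun r : ℝ => (volume : Measure (Space n m)).toSphere.real (sphereSection Ω x r))
      (𝓝[>] 0) (𝓝 g₀)) :
    Tendsto (fun ε : ℝ => ∫ y in frontier Ω \ Metric.ball x ε,
      contractedKernel B (y - x) (outerNormal Ω y) * φ y ∂(surfaceMeasure n m)) (𝓝[>] 0)
      (𝓝 ((∫ y in frontier Ω, contractedKernel B (y - x) (outerNormal Ω y) * (φ y - φ x)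
        ∂(surfaceMeasure n m)) + c * g₀ * φ x)) := by
  have hint := integrable_contractedKernel_mul_sub (B := B) hn hm hΩ hΩb hΓ hα hα1 hC hφ hx
  have h1 : Tendsto (fun ε : ℝ => ∫ y in frontier Ω \ Metric.ball x ε,
      contractedKernel B (y - x) (outerNormal Ω y) * (φ y - φ x) ∂(surfaceMeasure n m)) (𝓝[>] 0)
      (𝓝 (∫ y in frontier Ω, contractedKernel B (y - x) (outerNormal Ω y) * (φ y - φ x)
        ∂(surfaceMeasure n m))) := by
    simp only [sdiff_eq, ← setIntegral_indicator (measurableSet_ball (x := x)).compl]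
    refine tendsto_integral_filter_of_dominated_convergence _
      (Eventually.of_forall fun ε => hint.aestronglyMeasurable.indicator measurableSet_ball.compl)
      (Eventually.of_forall fun ε => Eventually.of_forall fun y => norm_indicator_le_norm_self _ _)
      hint.norm (Eventually.of_forall fun y => ?_)
    by_cases hyx : y = x
    · have h0 : ∀ ε : ℝ, (Metric.ball x ε)ᶜ.indicator (fun y =>
          contractedKernel B (y - x) (outerNormal Ω y) * (φ y - φ x)) y =
          contractedKernel B (y - x) (outerNormal Ω y) * (φ y - φ x) := fun ε => by
        rw [indicator_apply_eq_self, hyx, sub_self (φ x), mul_zero]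
        exact fun _ => rfl
      simp only [h0]
      exact tendsto_const_nhds
    · refine tendsto_const_nhds.congr' ?_
      filter_upwards [Ioo_mem_nhdsGT (dist_pos.2 hyx)] with ε hε
      rw [indicator_of_mem]
      rw [mem_compl_iff, Metric.mem_ball]
      exact not_lt.2 hε.2.le
  have h2 := (tendsto_setIntegral_contractedKernel hn hm hΩ hΩb hΓ hB hg).mul_const (φ x)
  refine (h1.add h2).congr' ?_
  filter_upwards [self_mem_nhdsWithin] with ε hε
  have hfin := surfaceMeasure_frontier_lt_top hn hm hΩb hΓ
  have h3 : IntegrableOn (fun _ : Space n m => φ x) (frontier Ω) (surfaceMeasure n m) :=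
    integrableOn_const hfin.ne
  rw [← integral_mul_const, ← integral_add (hint.mono_measure
    (Measure.restrict_mono sdiff_subset le_rfl))
    (integrableOn_contractedKernel_mul hΩ hΓ.singular_null h3 x hε)]
  refine integral_congr_ae (Eventually.of_forall fun y => ?_)
  simp only
  ring

/-- Non-tangential limits from a set on which the kernel has a constant total integral. -/
theorem tendsto_nontangential_contractedKernel_mul (hn : 1 ≤ n) (hm : 1 ≤ m) (hΩ : IsOpen Ω)
    (hΩb : Bornology.IsBounded Ω) (hΓ : HasPiecewiseSmoothBoundary Ω) (hα : 0 < α) (hα1 : α ≤ 1)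
    (hC : 0 ≤ C) (hφ : ∀ y ∈ frontier Ω, ∀ y' ∈ frontier Ω, |φ y - φ y'| ≤ C * ‖y - y'‖ ^ α)
    {x : Space n m} (hx : x ∈ frontier Ω) {D : Set (Space n m)} (hD : Disjoint D (frontier Ω))
    {s : ℝ} (hs : ∀ x' ∈ D, ∫ y in frontier Ω, contractedKernel B (y - x') (outerNormal Ω y)
      ∂(surfaceMeasure n m) = s) {κ : ℝ} (hκ : 0 < κ) :
    Tendsto (fun x' => ∫ y in frontier Ω, contractedKernel B (y - x') (outerNormal Ω y) * φ y
      ∂(surfaceMeasure n m)) (𝓝[approachRegion D (frontier Ω) x κ] x)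
      (𝓝 ((∫ y in frontier Ω, contractedKernel B (y - x) (outerNormal Ω y) * (φ y - φ x)
        ∂(surfaceMeasure n m)) + s * φ x)) := by
  obtain ⟨δ, hδ, hev⟩ := exists_mul_norm_le_of_mem_approachRegion D (frontier Ω) x hκ
  have h1 : Tendsto (fun x' => ∫ y in frontier Ω,
      contractedKernel B (y - x') (outerNormal Ω y) * (φ y - φ x) ∂(surfaceMeasure n m))
      (𝓝[approachRegion D (frontier Ω) x κ] x)
      (𝓝 (∫ y in frontier Ω, contractedKernel B (y - x) (outerNormal Ω y) * (φ y - φ x)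
        ∂(surfaceMeasure n m))) := by
    refine tendsto_integral_filter_of_dominated_convergence
      (fun y => (∑ i, ∑ i', |B i i'|) * (δ ^ (dimN n m - 1))⁻¹ * C *
        ‖y - x‖ ^ (α - ((dimN n m - 1 : ℕ) : ℝ)))
      (Eventually.of_forall fun x' =>
        aestronglyMeasurable_contractedKernel_mul_sub hn hm hΩ hΩb hΓ hα hφ x x') ?_
      ((integrable_norm_sub_rpow_frontier hn hm hΩb hΓ hx hα hα1).const_mul _)
      (Eventually.of_forall fun y => ?_)
    · filter_upwards [hev] with x' hx'
      refine (ae_restrict_iff' isClosed_frontier.measurableSet).2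
        (Eventually.of_forall fun y hy => ?_)
      exact norm_contractedKernel_mul_sub_le hδ hC (hφ y hy x hx) (hx' y hy)
    · by_cases hyx : y = x
      · simp only [hyx, sub_self (φ x), mul_zero]
        exact tendsto_const_nhds
      · exact ((continuousAt_contractedKernel hyx).tendsto.mono_left nhdsWithin_le_nhds).mul_const _
  refine (h1.add_const (s * φ x)).congr' ?_
  filter_upwards [self_mem_nhdsWithin] with x' hx'
  have hxD : x' ∈ D := hx'.1
  have hfin := surfaceMeasure_frontier_lt_top hn hm hΩb hΓ
  have hxf : x' ∉ frontier Ω := disjoint_left.1 hD hxD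
  obtain ⟨ε, hε, hdisj⟩ := exists_ball_disjoint_frontier hxf
  have hφi := integrableOn_frontier_of_holder hn hm hΩb hΓ hα hφ
  have h3 : IntegrableOn (fun _ : Space n m => φ x) (frontier Ω) (surfaceMeasure n m) :=
    integrableOn_const hfin.ne
  have h4 := integrableOn_contractedKernel_mul (B := B) (φ := fun y => φ y - φ x) hΩ
    hΓ.singular_null (hφi.sub h3) x' hε
  have h5 := integrableOn_contractedKernel_mul (B := B) hΩ hΓ.singular_null h3 x' hε
  rw [frontier_sdiff_ball_eq_self hdisj] at h4 h5
  rw [← hs x' hxD, ← integral_mul_const, ← integral_add h4 h5]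
  refine integral_congr_ae (Eventually.of_forall fun y => ?_)
  simp only
  ring

end Densities

end Hypercomplex

/-! ### Algebra-valued densities -/

namespace Hypercomplex

section Algebra

variable {A : Type*} [NonAssocRing A]

/-- Linearization of left alternativity. -/
theorem IsAlternative.mul_mul_add_mul_mul (hA : IsAlternative A) (x y a : A) :
    x * (y * a) + y * (x * a) = (x * y + y * x) * a := by
  have h := hA.1 (x + y) a
  simp only [add_mul, mul_add, hA.1 x a, hA.1 y a] at h
  rw [add_mul]
  have h2 : x * (x * a) + y * (y * a) + ((y * x) * a + (x * y) * a) =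
      x * (x * a) + y * (y * a) + (y * (x * a) + x * (y * a)) := by
    convert h using 1 <;> abel
  rw [add_comm, ← add_left_cancel h2, add_comm]

variable [Module ℝ A] [StarRing A] {m : ℕ} {v : Fin (m + 1) → A}

theorem IsHypercomplexBasis.star_eq_neg (hv : IsHypercomplexBasis v) {s : Fin (m + 1)}
    (hs : s ≠ 0) : star (v s) = -v s :=
  eq_neg_of_add_eq_zero_right (hv.unit s hs).1

theorem IsHypercomplexBasis.mul_self (hv : IsHypercomplexBasis v) {s : Fin (m + 1)}
    (hs : s ≠ 0) : v s * v s = -1 := by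
  have h := (hv.unit s hs).2
  rw [hv.star_eq_neg hs, mul_neg] at h
  rw [← h, neg_neg]

theorem IsHypercomplexBasis.star_mul_mul_add (hA : IsAlternative A) (hv : IsHypercomplexBasis v)
    (s s' : Fin (m + 1)) (a : A) :
    star (v s) * (v s' * a) + star (v s') * (v s * a) = if s = s' then a + a else 0 := by
  by_cases hs : s = 0
  · subst hs
    by_cases hs' : s' = 0
    · subst hs'
      simp [hv.zero]
    · rw [if_neg (Ne.symm hs'), hv.star_eq_neg hs', hv.zero]
      simp
  · by_cases hs' : s' = 0
    · subst hs'
      rw [if_neg hs, hv.star_eq_neg hs, hv.zero]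
      simp
    · rw [hv.star_eq_neg hs, hv.star_eq_neg hs', neg_mul, neg_mul, ← neg_add,
        hA.mul_mul_add_mul_mul]
      split_ifs with h
      · subst h
        rw [hv.mul_self hs, add_mul, neg_mul, one_mul, neg_add, neg_neg]
      · rw [hv.anticomm s s' hs hs' h, neg_add_cancel, zero_mul, neg_zero]

end Algebra

section Components

variable {A : Type*} [NonAssocRing A] [Module ℝ A] {d : ℕ} (b : Module.Basis (Fin (d + 1)) ℝ A)

theorem abs_repr_le_euclNorm (a : A) (t : Fin (d + 1)) : |b.repr a t| ≤ euclNorm b a := by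
  rw [euclNorm, ← Real.sqrt_sq_eq_abs]
  exact Real.sqrt_le_sqrt (Finset.single_le_sum (f := fun t => (b.repr a t) ^ 2)
    (fun _ _ => sq_nonneg _) (Finset.mem_univ t))

theorem convergesTo_of_forall_repr {X : Type*} {F : X → A} {l : Filter X} {L : A}
    (h : ∀ t, Tendsto (fun z => b.repr (F z) t) l (𝓝 (b.repr L t))) : ConvergesTo b F l L := by
  have h1 : Tendsto (fun z => ∑ t, (b.repr (F z) t - b.repr L t) ^ 2) l (𝓝 (∑ _t : Fin (d + 1), 0)) :=
    tendsto_finsetSum _ fun t _ => by simpa using ((h t).sub_const (b.repr L t)).pow 2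
  have h2 := (Real.continuous_sqrt.tendsto _).comp h1
  simp only [Finset.sum_const_zero, Real.sqrt_zero] at h2
  refine h2.congr fun z => ?_
  simp [euclNorm]

theorem repr_integralComp {X : Type*} [MeasurableSpace X] (μ : Measure X) (g : X → A)
    (t : Fin (d + 1)) : b.repr (integralComp b μ g) t = ∫ y, b.repr (g y) t ∂μ := by
  rw [integralComp, b.repr_sum_self]

theorem IsHolderOn.abs_repr_sub_le {n m : ℕ} {α : ℝ} {E : Set (Space n m)} {f : Space n m → A}
    (hf : IsHolderOn b α E f) : ∃ C : ℝ, 0 ≤ C ∧ ∀ u, ∀ y ∈ E, ∀ y' ∈ E,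
      |b.repr (f y) u - b.repr (f y') u| ≤ C * ‖y - y'‖ ^ α := by
  obtain ⟨C, hC⟩ := hf
  refine ⟨|C|, abs_nonneg C, fun u y hy y' hy' => ?_⟩
  rw [← Finsupp.sub_apply, ← map_sub]
  refine (abs_repr_le_euclNorm b _ u).trans ((hC y hy y' hy').trans ?_)
  gcongr
  exact le_abs_self C

variable [StarRing A] {m : ℕ} (v : Fin (m + 1) → A)

/-- The `t`-th coordinates of the products `vₛᶜ (vₛ' bᵤ)`, as a block-diagonal matrix indexed by the
real coordinates of `Mⁿ`. -/
noncomputable def structureMatrix (n : ℕ) (u t : Fin (d + 1)) (i i' : Fin n × Fin (m + 1)) : ℝ :=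
  if i.1 = i'.1 then b.repr (star (v i.2) * (v i'.2 * b u)) t else 0

variable {v}

/-- The structure matrices have scalar symmetric parts: this is where the hypercomplex relations and
alternativity enter. -/
theorem structureMatrix_add_swap (hA : IsAlternative A) (hv : IsHypercomplexBasis v) (n : ℕ)
    (u t : Fin (d + 1)) (i i' : Fin n × Fin (m + 1)) :
    structureMatrix b v n u t i i' + structureMatrix b v n u t i' i =
      if i = i' then 2 * b.repr (b u) t else 0 := by
  by_cases h1 : i.1 = i'.1
  · rw [structureMatrix, structureMatrix, if_pos h1, if_pos h1.symm, ← Finsupp.add_apply, ← map_add,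
      hv.star_mul_mul_add hA]
    by_cases h2 : i.2 = i'.2
    · rw [if_pos h2, if_pos (Prod.ext h1 h2), map_add, Finsupp.add_apply, two_mul]
    · rw [if_neg h2, if_neg fun h => h2 (congrArg Prod.snd h), map_zero, Finsupp.zero_apply]
  · rw [structureMatrix, structureMatrix, if_neg h1, if_neg (Ne.symm h1),
      if_neg fun h => h1 (congrArg Prod.fst h), add_zero]

theorem contractedKernel_structureMatrix {n : ℕ} (u t : Fin (d + 1)) (z ν : Space n m) :
    contractedKernel (structureMatrix b v n u t) z ν = ∑ j, ∑ s, ∑ s',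
      b.repr (star (v s) * (v s' * b u)) t * ((‖z‖ ^ dimN n m)⁻¹ * z (j, s) * ν (j, s')) := by
  rw [contractedKernel, Fintype.sum_prod_type]
  refine Finset.sum_congr rfl fun j _ => Finset.sum_congr rfl fun s _ => ?_
  rw [Fintype.sum_prod_type, Finset.sum_eq_single j]
  · simp [structureMatrix]
  · intro j' _ hj'
    simp [structureMatrix, Ne.symm hj']
  · simp

theorem repr_bmDensity [IsScalarTower ℝ A A] [SMulCommClass ℝ A A] [StarModule ℝ A] {n : ℕ}
    (Ω : Set (Space n m)) (f : Space n m → A) (x y : Space n m) (t : Fin (d + 1)) :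
    b.repr (bmDensity v Ω f x y) t = ∑ u, (sphereArea n m)⁻¹ *
      (contractedKernel (structureMatrix b v n u t) (y - x) (outerNormal Ω y) *
        b.repr (f y) u) := by
  have h1 : bmDensity v Ω f x y = ∑ u, b.repr (f y) u •
      ∑ j, kernelK v j (y - x) * (hcoord v (outerNormal Ω y) j * b u) := by
    rw [bmDensity]
    conv_lhs => rw [← b.sum_repr (f y)]
    simp only [Finset.mul_sum, mul_smul_comm, Finset.smul_sum]
    exact Finset.sum_comm
  rw [h1, map_sum, Finsupp.finsetSum_apply]
  refine Finset.sum_congr rfl fun u _ => ?_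
  rw [map_smul, Finsupp.smul_apply, smul_eq_mul, mul_comm, contractedKernel_structureMatrix,
    ← mul_assoc]
  congr 1
  rw [map_sum, Finsupp.finsetSum_apply, Finset.mul_sum]
  refine Finset.sum_congr rfl fun j _ => ?_
  simp only [kernelK, hcoord, star_sum, star_smul, star_trivial, Finset.sum_mul, Finset.mul_sum,
    smul_mul_assoc, mul_smul_comm, map_sum, map_smul, Finset.smul_sum, Finsupp.finsetSum_apply,
    Finsupp.smul_apply, smul_eq_mul, mul_inv]
  rw [Finset.sum_comm]
  refine Finset.sum_congr rfl fun s _ => Finset.sum_congr rfl fun s' _ => ?_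
  ring

end Components

end Hypercomplex

/-! ### Boundary values of the Bochner–Martinelli integral -/

namespace Hypercomplex

section BoundaryValues

variable {A : Type*} [NonAssocRing A] [Module ℝ A] [StarRing A] {n m d : ℕ}

/-- The absolutely convergent integral of `K(x,y) * (f(y) - f(x))` over the boundary. -/
noncomputable def oscillationIntegral (v : Fin (m + 1) → A) (b : Module.Basis (Fin (d + 1)) ℝ A)
    (Ω : Set (Space n m)) (f : Space n m → A) (x : Space n m) : A :=
  ∑ t, (∑ u, (sphereArea n m)⁻¹ * ∫ y in frontier Ω,
    contractedKernel (structureMatrix b v n u t) (y - x) (outerNormal Ω y) *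
      (b.repr (f y) u - b.repr (f x) u) ∂(surfaceMeasure n m)) • b t

theorem repr_oscillationIntegral_add_smul (hn : 1 ≤ n) (hm : 1 ≤ m) (v : Fin (m + 1) → A)
    (b : Module.Basis (Fin (d + 1)) ℝ A) (Ω : Set (Space n m)) (f : Space n m → A)
    (x : Space n m) (κ : ℝ) (t : Fin (d + 1)) :
    b.repr (oscillationIntegral v b Ω f x + κ • f x) t = ∑ u, (sphereArea n m)⁻¹ *
      ((∫ y in frontier Ω, contractedKernel (structureMatrix b v n u t) (y - x)
        (outerNormal Ω y) * (b.repr (f y) u - b.repr (f x) u) ∂(surfaceMeasure n m)) +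
        b.repr (b u) t * (sphereArea n m * κ) * b.repr (f x) u) := by
  have hσ := (sphereArea_pos hn hm).ne'
  rw [map_add, Finsupp.add_apply, oscillationIntegral, b.repr_sum_self, map_smul,
    Finsupp.smul_apply, smul_eq_mul]
  simp only [mul_add, Finset.sum_add_distrib]
  congr 1
  rw [Finset.sum_eq_single t]
  · rw [b.repr_self, Finsupp.single_eq_same]
    field_simp
  · intro u _ hu
    rw [b.repr_self, Finsupp.single_eq_of_ne (Ne.symm hu)]
    ring
  · simp

theorem integrableOn_contractedKernel_mul_repr (hn : 1 ≤ n) (hm : 1 ≤ m) (v : Fin (m + 1) → A)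
    (b : Module.Basis (Fin (d + 1)) ℝ A)
    {Ω : Set (Space n m)} (hΩ : IsOpen Ω) (hΩb : Bornology.IsBounded Ω)
    (hΓ : HasPiecewiseSmoothBoundary Ω) {α : ℝ} (hα : 0 < α) {f : Space n m → A}
    (hf : IsHolderOn b α (frontier Ω) f) (x : Space n m) {ε : ℝ} (hε : 0 < ε)
    (u t : Fin (d + 1)) : IntegrableOn (fun y => contractedKernel (structureMatrix b v n u t)
      (y - x) (outerNormal Ω y) * b.repr (f y) u) (frontier Ω \ Metric.ball x ε)
      (surfaceMeasure n m) := by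
  obtain ⟨C, -, hC⟩ := hf.abs_repr_sub_le
  exact integrableOn_contractedKernel_mul (φ := fun y => b.repr (f y) u) hΩ hΓ.singular_null
    (integrableOn_frontier_of_holder hn hm hΩb hΓ hα (hC u)) x hε

theorem integrableOn_contractedKernel_mul_repr_of_notMem (hn : 1 ≤ n) (hm : 1 ≤ m)
    (v : Fin (m + 1) → A) (b : Module.Basis (Fin (d + 1)) ℝ A)
    {Ω : Set (Space n m)} (hΩ : IsOpen Ω) (hΩb : Bornology.IsBounded Ω)
    (hΓ : HasPiecewiseSmoothBoundary Ω) {α : ℝ} (hα : 0 < α) {f : Space n m → A}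
    (hf : IsHolderOn b α (frontier Ω) f) {x : Space n m} (hx : x ∉ frontier Ω)
    (u t : Fin (d + 1)) : IntegrableOn (fun y => contractedKernel (structureMatrix b v n u t)
      (y - x) (outerNormal Ω y) * b.repr (f y) u) (frontier Ω) (surfaceMeasure n m) := by
  obtain ⟨ε, hε, hdisj⟩ := exists_ball_disjoint_frontier hx
  have h := integrableOn_contractedKernel_mul_repr hn hm v b hΩ hΩb hΓ hα hf x hε u t
  rwa [frontier_sdiff_ball_eq_self hdisj] at h

variable [IsScalarTower ℝ A A] [SMulCommClass ℝ A A] [StarModule ℝ A]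

theorem integrableComp_bmDensity (v : Fin (m + 1) → A) (b : Module.Basis (Fin (d + 1)) ℝ A)
    {Ω E : Set (Space n m)} {f : Space n m → A} {x : Space n m}
    (h : ∀ u t, IntegrableOn (fun y => contractedKernel (structureMatrix b v n u t) (y - x)
      (outerNormal Ω y) * b.repr (f y) u) E (surfaceMeasure n m)) :
    IntegrableComp b ((surfaceMeasure n m).restrict E) (bmDensity v Ω f x) := by
  intro t
  simp only [repr_bmDensity]
  exact integrable_finsetSum _ fun u _ => (h u t).const_mul _

theorem repr_integralComp_bmDensity (v : Fin (m + 1) → A) (b : Module.Basis (Fin (d + 1)) ℝ A)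
    {Ω E : Set (Space n m)} {f : Space n m → A} {x : Space n m}
    (h : ∀ u t, IntegrableOn (fun y => contractedKernel (structureMatrix b v n u t) (y - x)
      (outerNormal Ω y) * b.repr (f y) u) E (surfaceMeasure n m)) (t : Fin (d + 1)) :
    b.repr (integralComp b ((surfaceMeasure n m).restrict E) (bmDensity v Ω f x)) t =
      ∑ u, (sphereArea n m)⁻¹ * ∫ y in E, contractedKernel (structureMatrix b v n u t) (y - x)
        (outerNormal Ω y) * b.repr (f y) u ∂(surfaceMeasure n m) := by
  rw [repr_integralComp]
  simp only [repr_bmDensity]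
  rw [integral_finsetSum _ fun u _ => (h u t).const_mul _]
  refine Finset.sum_congr rfl fun u _ => ?_
  rw [integral_const_mul]

theorem hasPrincipalValue_oscillationIntegral (hA : IsAlternative A) (hn : 1 ≤ n)
    {v : Fin (m + 1) → A} (hv : IsHypercomplexBasis v) (b : Module.Basis (Fin (d + 1)) ℝ A)
    {Ω : Set (Space n m)} (hΩ : IsOpen Ω) (hΩb : Bornology.IsBounded Ω)
    (hΓ : HasPiecewiseSmoothBoundary Ω) {α : ℝ} (hα : 0 < α) (hα1 : α ≤ 1) {f : Space n m → A}
    (hf : IsHolderOn b α (frontier Ω) f) {x : Space n m} (hx : x ∈ frontier Ω) {τ : ℝ}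
    (hτ : Tendsto (fun r : ℝ => (volume : Measure (Space n m)).toSphere.real (sphereSection Ω x r))
      (𝓝[>] 0) (𝓝 (sphereArea n m * τ))) :
    HasPrincipalValue v b Ω f x (oscillationIntegral v b Ω f x + τ • f x) := by
  have hm := hv.one_le
  have hint := fun ε (hε : 0 < ε) =>
    integrableOn_contractedKernel_mul_repr hn hm v b hΩ hΩb hΓ hα hf x hε
  refine ⟨fun ε hε => integrableComp_bmDensity v b (hint ε hε),
    convergesTo_of_forall_repr b fun t => ?_⟩
  rw [repr_oscillationIntegral_add_smul hn hm]
  obtain ⟨C, hC0, hC⟩ := hf.abs_repr_sub_le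
  refine (tendsto_finsetSum _ fun u _ => (tendsto_truncated_contractedKernel_mul
    (φ := fun y => b.repr (f y) u) hn hm hΩ hΩb hΓ (structureMatrix_add_swap b hA hv n u t) hα hα1
    hC0 (hC u) hx hτ).const_mul (sphereArea n m)⁻¹).congr' ?_
  filter_upwards [self_mem_nhdsWithin] with ε hε
  exact (repr_integralComp_bmDensity v b (hint ε hε) t).symm

/-- Non-tangential limits from a set `D` on which the Bochner–Martinelli integrals of constants `a`
have the value `κ a`. -/
theorem hasNTLimit_oscillationIntegral (hn : 1 ≤ n)
    {v : Fin (m + 1) → A} (hv : IsHypercomplexBasis v) (b : Module.Basis (Fin (d + 1)) ℝ A)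
    {Ω : Set (Space n m)} (hΩ : IsOpen Ω) (hΩb : Bornology.IsBounded Ω)
    (hΓ : HasPiecewiseSmoothBoundary Ω) {α : ℝ} (hα : 0 < α) (hα1 : α ≤ 1) {f : Space n m → A}
    (hf : IsHolderOn b α (frontier Ω) f) {x : Space n m} (hx : x ∈ frontier Ω)
    {D : Set (Space n m)} (hD : Disjoint D (frontier Ω)) {κ : ℝ}
    (hκ : ∀ u t, ∀ x' ∈ D, ∫ y in frontier Ω, contractedKernel (structureMatrix b v n u t) (y - x')
      (outerNormal Ω y) ∂(surfaceMeasure n m) = b.repr (b u) t * (sphereArea n m * κ)) :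
    HasNTLimit b D (frontier Ω) (bmIntegral v b Ω f) x
      (oscillationIntegral v b Ω f x + κ • f x) := by
  have hm := hv.one_le
  refine fun c hc => convergesTo_of_forall_repr b fun t => ?_
  rw [repr_oscillationIntegral_add_smul hn hm]
  obtain ⟨C, hC0, hC⟩ := hf.abs_repr_sub_le
  refine (tendsto_finsetSum _ fun u _ => (tendsto_nontangential_contractedKernel_mul
    (φ := fun y => b.repr (f y) u) hn hm hΩ hΩb hΓ hα hα1 hC0 (hC u) hx hD (hκ u t)
    hc).const_mul (sphereArea n m)⁻¹).congr' ?_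
  filter_upwards [self_mem_nhdsWithin] with x' hx'
  exact (repr_integralComp_bmDensity v b (integrableOn_contractedKernel_mul_repr_of_notMem hn hm v b
    hΩ hΩb hΓ hα hf (disjoint_left.1 hD hx'.1)) t).symm

end BoundaryValues

end Hypercomplex

theorem mainTheorem3 {A : Type*} [NonAssocRing A] [Module ℝ A] [IsScalarTower ℝ A A]
    [SMulCommClass ℝ A A] [StarRing A] [StarModule ℝ A] (hA : IsAlternative A)
    {n m d : ℕ} (hn : 1 ≤ n)
    (v : Fin (m + 1) → A) (hv : IsHypercomplexBasis v)
    (b : Module.Basis (Fin (d + 1)) ℝ A) (hmd : m + 1 ≤ d + 1)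
    (hb : ∀ s : Fin (m + 1), b (Fin.castLE hmd s) = v s)
    (Ω : Set (Space n m)) (hΩo : IsOpen Ω) (hΩc : IsConnected Ω) (hΩb : Bornology.IsBounded Ω)
    (hΓ : HasPiecewiseSmoothBoundary Ω)
    (α : ℝ) (hα0 : 0 < α) (hα1 : α < 1)
    (f : Space n m → A) (hf : IsHolderOn b α (frontier Ω) f) :
    (∀ x ∉ frontier Ω,
      IntegrableComp b ((surfaceMeasure n m).restrict (frontier Ω)) (bmDensity v Ω f x)) ∧
    ∀ x ∈ frontier Ω, ∃ (τ : ℝ) (Cx : A),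
      HasSolidAngle Ω x τ ∧
      HasPrincipalValue v b Ω f x Cx ∧
      HasNTLimit b Ω (frontier Ω) (bmIntegral v b Ω f) x (Cx + (1 - τ) • f x) ∧
      HasNTLimit b (closure Ω)ᶜ (frontier Ω) (bmIntegral v b Ω f) x (Cx - τ • f x) := by
  have hm := hv.one_le
  refine ⟨fun x hx => integrableComp_bmDensity v b
    (integrableOn_contractedKernel_mul_repr_of_notMem hn hm v b hΩo hΩb hΓ hα0 hf hx),
    fun x hx => ?_⟩
  obtain ⟨τ, hτ, hg⟩ := exists_hasSolidAngle hn hm hΩo hΓ hx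
  have hdisj : Disjoint Ω (frontier Ω) := by
    rw [hΩo.frontier_eq]; exact disjoint_sdiff_right
  have hdisj' : Disjoint (closure Ω)ᶜ (frontier Ω) :=
    (disjoint_compl_left (a := closure Ω)).mono_right frontier_subset_closure
  refine ⟨τ, oscillationIntegral v b Ω f x + τ • f x, hτ,
    hasPrincipalValue_oscillationIntegral hA hn hv b hΩo hΩb hΓ hα0 hα1.le hf hx hg, ?_, ?_⟩
  · have h := hasNTLimit_oscillationIntegral hn hv b hΩo hΩb hΓ hα0 hα1.le hf hx hdisj (κ := 1)
      fun u t x' hx' => by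
        rw [setIntegral_contractedKernel_of_mem hn hm hΩo hΩb hΓ
          (structureMatrix_add_swap b hA hv n u t) hx', mul_one]
    rw [add_assoc, ← add_smul, add_sub_cancel]
    exact h
  · have h := hasNTLimit_oscillationIntegral hn hv b hΩo hΩb hΓ hα0 hα1.le hf hx hdisj' (κ := 0)
      fun u t x' hx' => by
        rw [setIntegral_contractedKernel_of_notMem_closure hn hm hΩo hΩb hΓ
          (structureMatrix_add_swap b hA hv n u t) hx', mul_zero, mul_zero]
    rw [add_sub_cancel_right]
    rwa [zero_smul, add_zero] at h
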